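/- Let $\sigma=\{R_1^{r_1},\dots,R_p^{r_p},c_1,\dots,c_q,f_1^{k_1},\dots,f_s^{k_s}\}$ be a finite vocabulary that contains at least one relation or function symbol of positive arity. A finite ordered $\sigma$-structure $\mathbf A$ has domain $\{0,\dots,n-1\}$, $n\ge 1$, with the natural order. Its binary encoding $\mathrm{bin}(\mathbf A)$ is the concatenation of the characteristic strings of its relations (tuples in lexicographic order), its constants with $\lceil\log_2 n\rceil$ binary digits each, and, for each function $f_i$ and each of the $\lceil\log_2 n\rceil$ bit positions, the characteristic string of the relation "this bit of $f_i(\bar a)$ is $1$"; its length is $$\hat n=\sum_i n^{r_i}+q\lceil\log_2 n\rceil+\lceil\log_2 n\rceil\sum_i n^{k_i}.$$ All machines are deterministic, with a finite set of states, a set of final states, a partial transition function (where no transition applies, the machine stops; moving left from the leftmost cell is not allowed), tape alphabet $\{0,1,\sqcup\}$, and tapes with a leftmost but no rightmost cell. A *random-access Turing machine* has a read-only input-tape, one address-tape (initially holding a single $0$) and one or more work-tapes (initially blank). If $i$ is the number written in binary on the address-tape between its leftmost cell and its first blank ($i=0$ if the leftmost cell is blank), the input-tape head scans the $(i+1)$-th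 input symbol, or an end-marker if $i$ is at least the length of the input. A *direct-access Turing machine* for $\sigma$ takes structures $\mathbf A$ as input. It has an address-tape for every argument place of every relation and function symbol, a read-only value-tape for every $f_i$, a read-only constant-tape for every $c_i$ (holding $c_i^{\mathbf A}$ with $\lceil\log_2 n\rceil$ binary digits), one more read-only constant-tape holding $n$ in binary, and one or more work-tapes; all other tapes are initially blank. A transition depends on the state, the scanned symbols and, for each $R_i$, on whether the tuple of numbers on the address-tapes of $R_i$ belongs to $R_i^{\mathbf A}$. It changes the state, writes on the address- and work-tapes and moves all heads; after it, each value-tape of $f_i$ is updated to hold $f_i^{\mathbf A}(n_1,\dots,n_{k_i})$ with $\lceil\log_2 n\rceil$ binary digits, where $n_1,\dots,n_{k_i}$ are the numbers now on the address-tapes of $f_i$ (only blanks if some $n_j\ge n$). A machine accepts if it reaches a final state, and rejects if it stops without having reached one. It *decides* a class $\mathcal C$ of finite ordered $\sigma$-structures if it accepts (on input $\mathrm{bin}(\mathbf A)$, respectively $\mathbf A$) every $\mathbf A\in\mathcal C$ and rejects every $\mathbf A\notin\mathcal C$. It works in *polylogarithmic space with respect to* $m$, where $m=\hat n$ or $m=n$,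 if for some $k\in\mathbb N$, on inputs $\mathbf A$, it visits at most $O(\lceil\log_2 m\rceil^k)$ cells (as $m\to\infty$) of each of its tapes, other than the input-tape of a random-access machine, before accepting or rejecting. **Corollary.** For every class $\mathcal C$ of finite ordered $\sigma$-structures, $\mathcal C$ is decidable by a random-access Turing machine working in polylogarithmic space with respect to $\hat n$ if and only if $\mathcal C$ is decidable by a direct-access Turing machine working in polylogarithmic space with respect to $n$. -/

import Mathlib

/-! ### Finite ordered structures and their binary encoding -/

/-- A finite vocabulary: finitely many relation symbols, constant symbols and function symbols,
the relation and function symbols with their arities.  The order symbol is not part of it. -/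
structure FinVocabulary where
  numRel : ℕ
  relArity : Fin numRel → ℕ
  numConst : ℕ
  numFun : ℕ
  funArity : Fin numFun → ℕ

/-- A finite ordered structure of vocabulary `σ`, with domain `{0, …, size - 1}` (nonempty),
ordered as an initial segment of the natural numbers. -/
structure FinOrderedStructure (σ : FinVocabulary) where
  size : ℕ
  size_pos : 0 < size
  rel : (i : Fin σ.numRel) → Set (Fin (σ.relArity i) → Fin size)
  const : Fin σ.numConst → Fin size
  func : (i : Fin σ.numFun) → (Fin (σ.funArity i) → Fin size) → Fin size

/-- The bit in position `m` (positions `0, …, w - 1`, most significant bit first) of the binary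
representation of `x` with `w` digits. -/
def binaryDigit (w x m : ℕ) : Bool := x.testBit (w - 1 - m)

/-- The binary representation of `x` with `w` digits, most significant bit first. -/
def binaryWord (w x : ℕ) : List Bool := (List.range w).map (binaryDigit w x)

/-- All `r`-tuples over `{0, …, n - 1}` in lexicographic order. -/
def lexTuples (n : ℕ) : (r : ℕ) → List (Fin r → Fin n)
  | 0 => [Fin.elim0]
  | r + 1 => (List.finRange n).flatMap fun a =>
      (lexTuples n r).map fun t => (Fin.cons a t : Fin (r + 1) → Fin n)

namespace FinOrderedStructure

variable {σ : FinVocabulary} (A : FinOrderedStructure σ)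

/-- `⌈log₂ n⌉` for the size `n` of the domain. -/
def logSize : ℕ := Nat.clog 2 A.size

open Classical in
/-- The code of the relation `i`: one bit per tuple, in lexicographic order. -/
noncomputable def encodeRel (i : Fin σ.numRel) : List Bool :=
  (lexTuples A.size (σ.relArity i)).map fun t => decide (t ∈ A.rel i)

/-- The code of a constant: its value with `⌈log₂ n⌉` binary digits. -/
def encodeConst (i : Fin σ.numConst) : List Bool := binaryWord A.logSize (A.const i)

/-- The code of a function: `⌈log₂ n⌉` relations, one for each bit position of the value. -/
def encodeFun (i : Fin σ.numFun) : List Bool :=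
  (List.range A.logSize).flatMap fun m =>
    (lexTuples A.size (σ.funArity i)).map fun t => binaryDigit A.logSize (A.func i t) m

/-- The binary encoding of a structure: the codes of its relations, then of its constants, then
of its functions. -/
noncomputable def encode : List Bool :=
  (List.finRange σ.numRel).flatMap A.encodeRel ++
    (List.finRange σ.numConst).flatMap A.encodeConst ++
    (List.finRange σ.numFun).flatMap A.encodeFun

end FinOrderedStructure

/-! ### Semi-infinite tapes -/

/-- The tape alphabet `{0, 1, ⊔}`. -/
inductive TapeSymbol where
  | zero
  | one
  | blank
  deriving DecidableEq

/-- The head directions: left, right, stay. -/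
inductive HeadMove where
  | left
  | right
  | stay
  deriving DecidableEq

/-- The symbol of a bit. -/
def TapeSymbol.ofBool : Bool → TapeSymbol
  | false => .zero
  | true => .one

/-- The contents of the cells `0, 1, 2, …` of a tape that holds the word `w` from its leftmost
cell on, and blanks elsewhere. -/
def wordCells (w : List Bool) (j : ℕ) : TapeSymbol :=
  match w[j]? with
  | some b => .ofBool b
  | none => .blank

/-- A tape with a leftmost cell (cell `0`) and no rightmost cell, with its head position. -/
structure SemiTape where
  cells : ℕ → TapeSymbol
  head : ℕ

namespace SemiTape

/-- The tape that holds the word `w` only, with the head on the leftmost cell. -/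
def ofWord (w : List Bool) : SemiTape := ⟨wordCells w, 0⟩

/-- The scanned symbol. -/
def read (T : SemiTape) : TapeSymbol := T.cells T.head

/-- Move the head.  (A move to the left from cell `0` is excluded by the machines below.) -/
def move (T : SemiTape) : HeadMove → SemiTape
  | .left => ⟨T.cells, T.head - 1⟩
  | .right => ⟨T.cells, T.head + 1⟩
  | .stay => T

/-- Write a symbol into the scanned cell. -/
def write (T : SemiTape) (a : TapeSymbol) : SemiTape := ⟨Function.update T.cells T.head a, T.head⟩

/-- The head would fall off the left end of the tape. -/
def Blocked (T : SemiTape) (d : HeadMove) : Prop := d = .left ∧ T.head = 0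

/-- The number stored in binary (most significant digit first) between the leftmost cell and the
first blank cell; it is `0` if the leftmost cell is blank. -/
noncomputable def number (T : SemiTape) : ℕ :=
  let len := sInf {j | T.cells j = .blank}
  ∑ j ∈ Finset.range len, if T.cells j = .one then 2 ^ (len - 1 - j) else 0

end SemiTape

/-! ### Computations of a deterministic step function -/

section Computation

variable {α : Type} (step : α → Option α) (accepting : α → Prop) (init : α)

/-- The configuration after `t` steps, if the computation has not stopped before. -/
def runFor : ℕ → Option α
  | 0 => some init
  | t + 1 => (runFor t).bind step

/-- An accepting configuration is reached. -/
def AcceptsFrom : Prop := ∃ t c, runFor step init t = some c ∧ accepting c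

/-- The computation stops, and no accepting configuration is reached. -/
def RejectsFrom : Prop :=
  (∃ t c, runFor step init t = some c ∧ step c = none) ∧ ¬ AcceptsFrom step accepting init

/-- The cells visited by the head whose position is `head`, up to the moment at which the
computation accepts or rejects. -/
def visitedCells (head : α → ℕ) : Set ℕ :=
  {h | ∃ t c, runFor step init t = some c ∧
    (∀ s < t, ∀ d, runFor step init s = some d → ¬ accepting d) ∧ head c = h}

end Computation

/-! ### Random-access Turing machines -/

/-- The symbols that can be scanned on the input-tape: a tape symbol or the end-marker. -/
inductive InputSymbol where
  | sym (a : TapeSymbol)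
  | endMarker
  deriving DecidableEq

/-- The symbol in position `i` of the input word, and the end-marker beyond the word. -/
def inputSymbolAt (w : List Bool) (i : ℕ) : InputSymbol :=
  match w[i]? with
  | some b => .sym (.ofBool b)
  | none => .endMarker

/-- A random-access Turing machine.  The tapes `Fin (numWork + 1)` are the address-tape (tape `0`)
and the work-tapes.  Where the transition function is undefined (`none`), the machine stops. -/
structure RandomAccessTM where
  State : Type
  finite_state : Finite State
  start : State
  final : Set State
  numWork : ℕ
  numWork_pos : 0 < numWork
  trans : State → InputSymbol → (Fin (numWork + 1) → TapeSymbol) →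
    Option (State × (Fin (numWork + 1) → TapeSymbol × HeadMove))

namespace RandomAccessTM

variable (M : RandomAccessTM)

/-- A configuration: the state and the address- and work-tapes with their heads.  The head of the
input-tape is determined by the address-tape. -/
structure Config where
  state : M.State
  tape : Fin (M.numWork + 1) → SemiTape

/-- The address-tape holds a single `0`, the work-tapes are blank. -/
def initial : M.Config where
  state := M.start
  tape l := if l = 0 then SemiTape.ofWord [false] else SemiTape.ofWord []

open Classical in
/-- One step on the input word `w`.  A head in the leftmost cell is not allowed to move left: a
transition that asks for it cannot be applied. -/
noncomputable def step (w : List Bool) (c : M.Config) : Option M.Config :=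
  match M.trans c.state (inputSymbolAt w (c.tape 0).number) (fun l => (c.tape l).read) with
  | none => none
  | some (q, act) =>
      if ∃ l, (c.tape l).Blocked (act l).2 then none
      else some ⟨q, fun l => ((c.tape l).write (act l).1).move (act l).2⟩

/-- The machine accepts the input word `w`. -/
def Accepts (w : List Bool) : Prop := AcceptsFrom (M.step w) (fun c => c.state ∈ M.final) M.initial

/-- The machine rejects the input word `w`. -/
def Rejects (w : List Bool) : Prop := RejectsFrom (M.step w) (fun c => c.state ∈ M.final) M.initial

/-- The cells of the tape `l` visited on the input word `w` before accepting or rejecting. -/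
def visited (w : List Bool) (l : Fin (M.numWork + 1)) : Set ℕ :=
  visitedCells (M.step w) (fun c => c.state ∈ M.final) M.initial fun c => (c.tape l).head

variable {σ : FinVocabulary}

/-- The machine decides the class `C` of structures, given by their binary encodings. -/
def Decides (C : Set (FinOrderedStructure σ)) : Prop :=
  ∀ A : FinOrderedStructure σ, (A ∈ C → M.Accepts A.encode) ∧ (A ∉ C → M.Rejects A.encode)

variable (σ) in
/-- On encodings of `σ`-structures the machine visits at most `O(⌈log₂ n̂⌉ ^ k)` cells of its
address-tape and of each work-tape, for some `k`, where `n̂` is the length of the encoding. -/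
def WorksInPolylogSpace : Prop :=
  ∃ k c n₀ : ℕ, ∀ A : FinOrderedStructure σ, n₀ ≤ A.encode.length →
    ∀ l, (M.visited A.encode l).encard ≤ (c * Nat.clog 2 A.encode.length ^ k : ℕ)

end RandomAccessTM

/-! ### Direct-access Turing machines -/

/-- The tapes of a direct-access machine that can be written: an address-tape for every argument
place of every relation and function symbol, and `k` ordinary work-tapes. -/
inductive WritableTape (σ : FinVocabulary) (k : ℕ) where
  | relAddr (i : Fin σ.numRel) (j : Fin (σ.relArity i))
  | funAddr (i : Fin σ.numFun) (j : Fin (σ.funArity i))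
  | work (i : Fin k)

/-- The read-only tapes of a direct-access machine: a value-tape for every function symbol, a
constant-tape for every constant symbol, and a constant-tape for the size of the domain. -/
inductive ReadOnlyTape (σ : FinVocabulary) where
  | value (i : Fin σ.numFun)
  | const (i : Fin σ.numConst)
  | size

/-- A direct-access Turing machine that takes `σ`-structures as input.  The arguments of the
transition function are the state, the scanned symbols, and the answers to the queries to the
relations.  Where it is undefined (`none`), the machine stops. -/
structure DirectAccessTM (σ : FinVocabulary) where
  State : Type
  finite_state : Finite State
  start : State
  final : Set State
  numWork : ℕ
  numWork_pos : 0 < numWork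
  trans : State → (WritableTape σ numWork → TapeSymbol) → (ReadOnlyTape σ → TapeSymbol) →
    (Fin σ.numRel → Bool) →
    Option (State × (WritableTape σ numWork → TapeSymbol × HeadMove) × (ReadOnlyTape σ → HeadMove))

namespace DirectAccessTM

variable {σ : FinVocabulary} (M : DirectAccessTM σ)

/-- A configuration: the state and all tapes with their heads. -/
structure Config where
  state : M.State
  tape : WritableTape σ M.numWork → SemiTape
  rotape : ReadOnlyTape σ → SemiTape

/-- The constant-tapes hold the constants (with `⌈log₂ n⌉` binary digits) and the size `n` of the
domain (in binary, without leading zeros); all other tapes are blank. -/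
def initial (A : FinOrderedStructure σ) : M.Config where
  state := M.start
  tape _ := SemiTape.ofWord []
  rotape
    | .value _ => SemiTape.ofWord []
    | .const i => SemiTape.ofWord (A.encodeConst i)
    | .size => SemiTape.ofWord (binaryWord (Nat.size A.size) A.size)

open Classical in
/-- The answer to the query whether the numbers on the address-tapes of the relation symbol `i`
form a tuple in the relation. -/
noncomputable def answer (A : FinOrderedStructure σ)
    (tape : WritableTape σ M.numWork → SemiTape) (i : Fin σ.numRel) : Bool :=
  decide (∃ t ∈ A.rel i, ∀ j, (t j : ℕ) = (tape (.relAddr i j)).number)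

open Classical in
/-- The contents of the value-tape of the function symbol `i`: the value, with `⌈log₂ n⌉` binary
digits, at the numbers on its address-tapes; only blanks if one of these numbers is too large. -/
noncomputable def valueWord (A : FinOrderedStructure σ)
    (tape : WritableTape σ M.numWork → SemiTape) (i : Fin σ.numFun) : List Bool :=
  if h : ∀ j, (tape (.funAddr i j)).number < A.size then
    binaryWord A.logSize (A.func i fun j => ⟨(tape (.funAddr i j)).number, h j⟩)
  else []

open Classical in
/-- One step on the input structure `A`.  First all heads write and move as the transition
function tells, then the contents of the value-tapes are updated according to the new contents of
the address-tapes, their heads remaining in place. -/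
noncomputable def step (A : FinOrderedStructure σ) (c : M.Config) : Option M.Config :=
  match M.trans c.state (fun l => (c.tape l).read) (fun l => (c.rotape l).read)
      (M.answer A c.tape) with
  | none => none
  | some (q, act, ract) =>
      if (∃ l, (c.tape l).Blocked (act l).2) ∨ (∃ l, (c.rotape l).Blocked (ract l)) then none
      else
        let newTape : WritableTape σ M.numWork → SemiTape :=
          fun l => ((c.tape l).write (act l).1).move (act l).2
        some
          { state := q
            tape := newTape
            rotape := fun l =>
              match l with
              | .value i => ⟨wordCells (M.valueWord A newTape i),
                  ((c.rotape (.value i)).move (ract (.value i))).head⟩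
              | .const i => (c.rotape (.const i)).move (ract (.const i))
              | .size => (c.rotape .size).move (ract .size) }

/-- The machine accepts the structure `A`. -/
def Accepts (A : FinOrderedStructure σ) : Prop :=
  AcceptsFrom (M.step A) (fun c => c.state ∈ M.final) (M.initial A)

/-- The machine rejects the structure `A`. -/
def Rejects (A : FinOrderedStructure σ) : Prop :=
  RejectsFrom (M.step A) (fun c => c.state ∈ M.final) (M.initial A)

/-- The cells of the address- or work-tape `l` visited on `A` before accepting or rejecting. -/
def visited (A : FinOrderedStructure σ) (l : WritableTape σ M.numWork) : Set ℕ :=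
  visitedCells (M.step A) (fun c => c.state ∈ M.final) (M.initial A) fun c => (c.tape l).head

/-- The cells of the value- or constant-tape `l` visited on `A` before accepting or rejecting. -/
def visitedReadOnly (A : FinOrderedStructure σ) (l : ReadOnlyTape σ) : Set ℕ :=
  visitedCells (M.step A) (fun c => c.state ∈ M.final) (M.initial A) fun c => (c.rotape l).head

/-- The machine decides the class `C` of structures. -/
def Decides (C : Set (FinOrderedStructure σ)) : Prop :=
  ∀ A : FinOrderedStructure σ, (A ∈ C → M.Accepts A) ∧ (A ∉ C → M.Rejects A)

/-- The machine visits at most `O(⌈log₂ n⌉ ^ k)` cells of each tape, for some `k`, where `n` is the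
size of the domain.  The read-only tapes are included: their contents have only about `log₂ n`
symbols, but a head that may leave them to the right without bound would be an unbounded
counter. -/
def WorksInPolylogSpace : Prop :=
  ∃ k c n₀ : ℕ, ∀ A : FinOrderedStructure σ, n₀ ≤ A.size →
    (∀ l, (M.visited A l).encard ≤ (c * Nat.clog 2 A.size ^ k : ℕ)) ∧
    (∀ l, (M.visitedReadOnly A l).encard ≤ (c * Nat.clog 2 A.size ^ k : ℕ))

end DirectAccessTM

/-! Only space is bounded, not time, so neither simulation has to compute addresses arithmetically.
Both rest on one device, `spec_walk`: nested loop counters pass through all bit positions of the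
encoding in their order (`codeItems`, and `encode_eq_map` for the bits themselves). A counter for a
number below `2 ^ K` needs `K` cells, so a walk costs logarithmic space although it takes
polynomially many rounds.

From random access to direct access, the loop counters are at the same time the address-tapes. At
every position of the walk the corresponding bit is therefore available, as the answer of a relation
or as a symbol on a constant- or value-tape. To read the input symbol at address `p`, the walk
counts down from `p` and records the bit met when the count is `0`; if nothing is recorded, the
address lies beyond the encoding and the symbol is the end-marker (`spec_askInput`).

From direct access to random access, one step needs the answers of all relations and the symbols
under the heads of all value- and constant-tapes. The address is increased along with the walk, and
the current input symbol is recorded whenever the loop counters agree with the saved addresses and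
head positions (`spec_askAll`). At most one bit matches each query, and the record is the symbol
seen by the simulated machine (`found_rel`, `found_const`, `found_value`). The size `n` of the
domain is not part of this input. It is the least `m` such that the input is not longer than a code
for size `m`, because the length of the code is strictly increasing in the size
(`length_codeItems_lt`); this is where a symbol of positive arity is needed.

For the space bounds, `n ≤ n̂` for `n ≥ 2` (`size_le_length_encode`) and `⌈log₂ n̂⌉ ≤ D * ⌈log₂ n⌉`
(`exists_clog_length_encode_le`), so polylogarithmic bounds in `n` and in `n̂` translate into each
other. A bound on the number of visited cells is a bound on head positions, since a head moves by
single cells from the left end (`lt_of_mem_visitedCells`). The simulating machine does not depend on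
`K`. On the structures below the threshold of the asymptotic bound, a suitable `K` exists because
the computation halts.

The machines are written as controls `Ctrl`, composed by `bind` and `iterate`. The inductive
relation `Runs` contains termination and the space bound `K` at once. Heads may not fall off the
left end, and a machine cannot see that end; therefore every tape is accompanied by a marked tape
whose head moves in parallel, and `ofCtrl_spec` turns runs of controls into runs of machines of
either kind. On top of this, `Spec` describes controls by their effect on abstract counters, so that
the digits, including leading zeros, disappear from the later arguments. -/

set_option linter.unusedSectionVars false

/-! ### Tapes, memories, finite controls and their composition. -/

section

namespace SemiTape

/-- Write a symbol (or nothing) and move the head. -/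
def act (T : SemiTape) (a : Option TapeSymbol × HeadMove) : SemiTape :=
  (T.write (a.1.getD T.read)).move a.2

@[simp] theorem write_read (T : SemiTape) : T.write T.read = T := by
  simp [write, read]

@[simp] theorem act_none_stay (T : SemiTape) : T.act (none, .stay) = T := by
  simp [act, move]

@[simp] theorem act_none_left (T : SemiTape) : T.act (none, .left) = ⟨T.cells, T.head - 1⟩ := by
  simp [act, move]

@[simp] theorem act_none_right (T : SemiTape) : T.act (none, .right) = ⟨T.cells, T.head + 1⟩ := by
  simp [act, move]

@[simp] theorem act_some_stay (T : SemiTape) (a : TapeSymbol) :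
    T.act (some a, .stay) = ⟨Function.update T.cells T.head a, T.head⟩ := by
  simp [act, move, write]

@[simp] theorem act_some_left (T : SemiTape) (a : TapeSymbol) :
    T.act (some a, .left) = ⟨Function.update T.cells T.head a, T.head - 1⟩ := by
  simp [act, move, write]

@[simp] theorem act_some_right (T : SemiTape) (a : TapeSymbol) :
    T.act (some a, .right) = ⟨Function.update T.cells T.head a, T.head + 1⟩ := by
  simp [act, move, write]

end SemiTape

/-- Move a head position. -/
def HeadMove.app : HeadMove → ℕ → ℕ
  | .left, p => p - 1
  | .right, p => p + 1
  | .stay, p => p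

@[simp] theorem SemiTape.head_move (T : SemiTape) (d : HeadMove) :
    (T.move d).head = d.app T.head := by
  cases d <;> rfl

@[simp] theorem SemiTape.cells_move (T : SemiTape) (d : HeadMove) : (T.move d).cells = T.cells := by
  cases d <;> rfl

@[simp] theorem SemiTape.head_write (T : SemiTape) (a : TapeSymbol) : (T.write a).head = T.head :=
  rfl

theorem HeadMove.app_le (d : HeadMove) (p : ℕ) : d.app p ≤ p + 1 := by
  cases d <;> simp only [HeadMove.app] <;> omega

/-- A memory: tapes with observable left ends, and further heads of which only the position
matters. -/
structure TapeMem (R H : Type) where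
  tape : R → SemiTape
  pos : H → ℕ

/-- What a control sees of a memory. -/
structure TapeObs (R H O : Type) where
  sym : R → TapeSymbol
  atLeft : R → Bool
  posZero : H → Bool
  ans : O

/-- What a control does to a memory in one step. -/
structure TapeAction (R H : Type) where
  tape : R → Option TapeSymbol × HeadMove
  pos : H → HeadMove

variable {R H O E F S : Type}

namespace TapeMem

/-- The observation, where the oracle answers according to the numbers on the tapes and the
positions of the heads. -/
noncomputable def obs (ora : (R → ℕ) → (H → ℕ) → O) (m : TapeMem R H) : TapeObs R H O where
  sym r := (m.tape r).read
  atLeft r := (m.tape r).head == 0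
  posZero h := m.pos h == 0
  ans := ora (fun r => (m.tape r).number) m.pos

def act (m : TapeMem R H) (a : TapeAction R H) : TapeMem R H where
  tape r := (m.tape r).act (a.tape r)
  pos h := (a.pos h).app (m.pos h)

/-- No head is asked to fall off the left end. -/
def Allowed (m : TapeMem R H) (a : TapeAction R H) : Prop :=
  (∀ r, (a.tape r).2 = .left → (m.tape r).head ≠ 0) ∧ ∀ h, a.pos h = .left → m.pos h ≠ 0

/-- All heads are in the first `K + 1` cells. -/
def InSpace (K : ℕ) (m : TapeMem R H) : Prop :=
  (∀ r, (m.tape r).head ≤ K) ∧ ∀ h, m.pos h ≤ K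

end TapeMem

/-- A finite control that returns a value when it exits. -/
structure Ctrl (R H O E : Type) where
  Q : Type
  finite_Q : Finite Q
  start : Q
  trans : Q → TapeObs R H O → TapeAction R H × (Q ⊕ E)

namespace Ctrl

/-- From the state `q` and the memory `m`, the control exits with the value `e` and the last
memory, all memories before it being within the space `K`. -/
inductive Reach (ora : (R → ℕ) → (H → ℕ) → O) (K : ℕ) (P : Ctrl R H O E) :
    P.Q → TapeMem R H → E → TapeMem R H → Prop
  | exit {q m e a} : m.InSpace K → P.trans q (m.obs ora) = (a, .inr e) → m.Allowed a →
      Reach ora K P q m e (m.act a)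
  | step {q q' m e a m'} : m.InSpace K → P.trans q (m.obs ora) = (a, .inl q') → m.Allowed a →
      Reach ora K P q' (m.act a) e m' → Reach ora K P q m e m'

/-- A complete run of a control. -/
def Runs (ora : (R → ℕ) → (H → ℕ) → O) (K : ℕ) (P : Ctrl R H O E) (m : TapeMem R H) (e : E)
    (m' : TapeMem R H) : Prop :=
  Reach ora K P P.start m e m'

/-- One step. -/
def prim (f : TapeObs R H O → TapeAction R H × E) : Ctrl R H O E where
  Q := Unit
  finite_Q := inferInstance
  start := ()
  trans _ o := ((f o).1, .inr (f o).2)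

/-- One control after another. -/
def bind [Finite E] (P : Ctrl R H O E) (G : E → Ctrl R H O F) : Ctrl R H O F where
  Q := P.Q ⊕ Σ e, (G e).Q
  finite_Q := by
    have := P.finite_Q
    have := fun e => (G e).finite_Q
    infer_instance
  start := .inl P.start
  trans
    | .inl q, o => match P.trans q o with
      | (a, .inl q') => (a, .inl (.inl q'))
      | (a, .inr e) => (a, .inl (.inr ⟨e, (G e).start⟩))
    | .inr ⟨e, q⟩, o => match (G e).trans q o with
      | (a, .inl q') => (a, .inl (.inr ⟨e, q'⟩))
      | (a, .inr f) => (a, .inr f)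

/-- Repeat a control until it returns a value in the right summand. -/
def iterate [Finite S] (B : S → Ctrl R H O (S ⊕ E)) (s : S) : Ctrl R H O E where
  Q := Σ s, (B s).Q
  finite_Q := by
    have := fun s => (B s).finite_Q
    infer_instance
  start := ⟨s, (B s).start⟩
  trans | ⟨s, q⟩, o => match (B s).trans q o with
    | (a, .inl q') => (a, .inl ⟨s, q'⟩)
    | (a, .inr (.inl s')) => (a, .inl ⟨s', (B s').start⟩)
    | (a, .inr (.inr e)) => (a, .inr e)

variable {ora : (R → ℕ) → (H → ℕ) → O} {K : ℕ}

theorem Runs.prim {f : TapeObs R H O → TapeAction R H × E} {m : TapeMem R H} {a : TapeAction R H}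
    {e : E} (hm : m.InSpace K) (hf : f (m.obs ora) = (a, e)) (ha : m.Allowed a) :
    (Ctrl.prim f).Runs ora K m e (m.act a) :=
  Reach.exit hm (by simp [Ctrl.prim, hf]) ha

theorem Reach.bind_right [Finite E] {P : Ctrl R H O E} {G : E → Ctrl R H O F} {e : E} {q : (G e).Q}
    {m : TapeMem R H} {f : F} {m' : TapeMem R H} (h : Reach ora K (G e) q m f m') :
    Reach ora K (P.bind G) (.inr ⟨e, q⟩) m f m' := by
  induction h with
  | exit h1 h2 h3 => exact .exit h1 (by simp [bind, h2]) h3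
  | step h1 h2 h3 _ ih => exact .step h1 (by simp only [bind, h2]) h3 ih

theorem Reach.bind_left [Finite E] {P : Ctrl R H O E} {G : E → Ctrl R H O F} {e : E} {q : P.Q}
    {m : TapeMem R H} {f : F} {m' m'' : TapeMem R H} (h : Reach ora K P q m e m')
    (h' : Runs ora K (G e) m' f m'') :
    Reach ora K (P.bind G) (.inl q) m f m'' := by
  induction h with
  | exit h1 h2 h3 => exact .step h1 (by simp only [bind, h2]) h3 h'.bind_right
  | step h1 h2 h3 _ ih => exact .step h1 (by simp only [bind, h2]) h3 (ih h')

theorem Runs.bind [Finite E] {P : Ctrl R H O E} {G : E → Ctrl R H O F} {e : E}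
    {m : TapeMem R H} {f : F} {m' m'' : TapeMem R H} (h : Runs ora K P m e m')
    (h' : Runs ora K (G e) m' f m'') : Runs ora K (P.bind G) m f m'' :=
  Reach.bind_left h h'

/-- The exit value is a variable with the equation `hx`, so that induction on the run of the body is
possible. -/
theorem Reach.iterate_done [Finite S] {B : S → Ctrl R H O (S ⊕ E)} {s s₀ : S} {q : (B s).Q}
    {m m' : TapeMem R H} {x : S ⊕ E} (h : Reach ora K (B s) q m x m') {e : E} (hx : x = .inr e) :
    Reach ora K (iterate B s₀) ⟨s, q⟩ m e m' := by
  induction h with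
  | exit h1 h2 h3 => exact .exit h1 (by simp [iterate, h2, hx]) h3
  | step h1 h2 h3 _ ih => exact .step h1 (by simp only [iterate, h2]) h3 (ih hx)

theorem Reach.iterate_next [Finite S] {B : S → Ctrl R H O (S ⊕ E)} {s s' s₀ : S} {q : (B s).Q}
    {m m' m'' : TapeMem R H} {x : S ⊕ E} (h : Reach ora K (B s) q m x m') {e : E}
    (hx : x = .inl s') (h' : Reach ora K (iterate B s₀) ⟨s', (B s').start⟩ m' e m'') :
    Reach ora K (iterate B s₀) ⟨s, q⟩ m e m'' := by
  induction h with
  | exit h1 h2 h3 => exact .step h1 (by simp only [iterate, h2, hx]) h3 h'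
  | step h1 h2 h3 _ ih => exact .step h1 (by simp only [iterate, h2]) h3 (ih hx h')

/-- The parameter of a loop enters only its start state, never its transitions. This allows
continuing a loop that was started with another parameter. -/
theorem Reach.iterate_start [Finite S] {B : S → Ctrl R H O (S ⊕ E)} {s s' : S}
    {q : (iterate B s).Q} {m m' : TapeMem R H} {e : E} (h : Reach ora K (iterate B s) q m e m') :
    Reach ora K (iterate B s') q m e m' := by
  induction h with
  | exit h1 h2 h3 => exact .exit h1 h2 h3
  | step h1 h2 h3 _ ih => exact .step h1 h2 h3 ih

theorem Runs.iterate_done [Finite S] {B : S → Ctrl R H O (S ⊕ E)} {s : S} {m m' : TapeMem R H}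
    {e : E} (h : (B s).Runs ora K m (.inr e) m') : (iterate B s).Runs ora K m e m' :=
  Reach.iterate_done h rfl

theorem Runs.iterate_next [Finite S] {B : S → Ctrl R H O (S ⊕ E)} {s s' : S}
    {m m' m'' : TapeMem R H} {e : E} (h : (B s).Runs ora K m (.inl s') m')
    (h' : (iterate B s').Runs ora K m' e m'') : (iterate B s).Runs ora K m e m'' :=
  Reach.iterate_next h rfl (Reach.iterate_start h')

end Ctrl

/-! ### Finite computations of a deterministic step function -/

section Path

variable {α : Type} {step : α → Option α} {acc N : α → Prop}

/-- A computation all of whose configurations but the last one have the property `N`. -/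
inductive StepPath (step : α → Option α) (N : α → Prop) : α → α → Prop
  | refl (c) : StepPath step N c c
  | head {c d e} : N c → step c = some d → StepPath step N d e → StepPath step N c e

/-- `runFor` adds steps at the end, `StepPath` in front; this peels off the first step. -/
theorem runFor_succ_of_step {c d : α} (h : step c = some d) (t : ℕ) :
    runFor step c (t + 1) = runFor step d t := by
  induction t with
  | zero => simp [runFor, h]
  | succ t ih => rw [runFor, ih, runFor]

theorem runFor_succ_of_step_none {c : α} (h : step c = none) (t : ℕ) :
    runFor step c (t + 1) = none := by
  induction t with
  | zero => simp [runFor, h]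
  | succ t ih => rw [runFor, ih]; rfl

theorem StepPath.exists_runFor {c d : α} (h : StepPath step N c d) :
    ∃ t, runFor step c t = some d ∧ (∀ s < t, ∃ b, runFor step c s = some b ∧ N b) := by
  induction h with
  | refl c => exact ⟨0, rfl, by simp⟩
  | @head c d e h1 h2 _ ih =>
    obtain ⟨t, ht, hs⟩ := ih
    refine ⟨t + 1, by rw [runFor_succ_of_step h2, ht], fun s hst => ?_⟩
    cases s with
    | zero => exact ⟨c, rfl, h1⟩
    | succ s => rw [runFor_succ_of_step h2]; exact hs s (by omega)

theorem StepPath.acceptsFrom {c d : α} (h : StepPath step N c d) (hd : acc d) :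
    AcceptsFrom step acc c := by
  obtain ⟨t, ht, -⟩ := h.exists_runFor
  exact ⟨t, d, ht, hd⟩

theorem runFor_eq_none_of_le {c : α} {t : ℕ} (h : runFor step c t = none) {s : ℕ} (hs : t ≤ s) :
    runFor step c s = none := by
  induction s, hs using Nat.le_induction with
  | base => exact h
  | succ s _ ih => rw [runFor, ih]; rfl

/-- By determinism every reached configuration lies on the path, as nothing follows its end. -/
theorem StepPath.rejectsFrom {c d : α} (h : StepPath step N c d) (hN : ∀ b, N b → ¬ acc b)
    (hd : ¬ acc d) (hs : step d = none) : RejectsFrom step acc c := by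
  obtain ⟨t, ht, hlt⟩ := h.exists_runFor
  refine ⟨⟨t, d, ht, hs⟩, ?_⟩
  rintro ⟨s, b, hb, hab⟩
  rcases lt_trichotomy s t with hst | rfl | hst
  · obtain ⟨b', hb', hN'⟩ := hlt s hst
    rw [hb] at hb'
    cases hb'
    exact hN _ hN' hab
  · rw [ht] at hb
    cases hb
    exact hd hab
  · have : runFor step c (t + 1) = none := by rw [runFor, ht]; exact hs
    rw [runFor_eq_none_of_le this hst] at hb
    cases hb

/-- Configurations after `d` do not count: either `d` has already accepted, or the computation has
stopped there. -/
theorem StepPath.visitedCells_subset {c d : α} (h : StepPath step N c d) {head : α → ℕ} {K : ℕ}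
    (hN : ∀ b, N b → head b ≤ K) (hd : head d ≤ K) (hend : acc d ∨ step d = none) :
    visitedCells step acc c head ⊆ Set.Iic K := by
  obtain ⟨t, ht, hlt⟩ := h.exists_runFor
  rintro x ⟨s, b, hb, hacc, rfl⟩
  rcases lt_trichotomy s t with hst | rfl | hst
  · obtain ⟨b', hb', hN'⟩ := hlt s hst
    rw [hb] at hb'
    cases hb'
    exact hN _ hN'
  · rw [ht] at hb
    cases hb
    exact hd
  · rcases hend with hend | hend
    · exact absurd hend (hacc t hst d ht)
    · have : runFor step c (t + 1) = none := by rw [runFor, ht]; exact hend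
      rw [runFor_eq_none_of_le this hst] at hb
      cases hb

theorem stepPath_of_runFor {c d : α} {t : ℕ} (h : runFor step c t = some d)
    (hN : ∀ s < t, ∀ b, runFor step c s = some b → N b) : StepPath step N c d := by
  induction t generalizing c with
  | zero => cases h; exact .refl _
  | succ t ih =>
    cases hc : step c with
    | none => rw [runFor_succ_of_step_none hc] at h; cases h
    | some b =>
      refine .head (hN 0 (by omega) c rfl) hc (ih (by rwa [← runFor_succ_of_step hc]) ?_)
      intro s hs b' hb'
      exact hN (s + 1) (by omega) b' (by rwa [runFor_succ_of_step hc])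

/-- A computation that accepts or rejects is finite, and its configurations are those that count
for the visited cells. -/
theorem exists_stepPath {c : α} (h : AcceptsFrom step acc c ∨ RejectsFrom step acc c)
    {ι : Type} (head : ι → α → ℕ) :
    ∃ d, StepPath step (fun b => ¬ acc b ∧ ∀ l, head l b ∈ visitedCells step acc c (head l)) c d ∧
      (∀ l, head l d ∈ visitedCells step acc c (head l)) ∧
      (AcceptsFrom step acc c ∧ acc d ∨ RejectsFrom step acc c ∧ ¬ acc d ∧ step d = none) := by
  classical
  rcases h with h | h
  · have hex : ∃ t, ∃ d, runFor step c t = some d ∧ acc d := h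
    obtain ⟨d, hd, had⟩ := Nat.find_spec hex
    have hmin : ∀ s < Nat.find hex, ∀ b, runFor step c s = some b → ¬ acc b :=
      fun s hs b hb hab => Nat.find_min hex hs ⟨b, hb, hab⟩
    refine ⟨d, stepPath_of_runFor hd fun s hs b hb => ⟨hmin s hs b hb, fun l => ?_⟩,
      fun l => ⟨_, d, hd, hmin, rfl⟩, .inl ⟨h, had⟩⟩
    exact ⟨s, b, hb, fun s' hs' => hmin s' (hs'.trans hs), rfl⟩
  · obtain ⟨⟨t, d, hd, hs⟩, hna⟩ := id h
    have hmin : ∀ s b, runFor step c s = some b → ¬ acc b :=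
      fun s b hb hab => hna ⟨s, b, hb, hab⟩
    refine ⟨d, stepPath_of_runFor hd fun s hs b hb => ⟨hmin s b hb, fun l => ?_⟩,
      fun l => ⟨_, d, hd, fun s _ => hmin s, rfl⟩, .inr ⟨h, hmin t d hd, hs⟩⟩
    exact ⟨s, b, hb, fun s' _ => hmin s', rfl⟩

/-- The cells visited by a head that starts in the leftmost cell are an initial segment. -/
theorem Iic_subset_visitedCells {c : α} {head : α → ℕ} (h0 : head c = 0)
    (hstep : ∀ b d, step b = some d → head d ≤ head b + 1) {x : ℕ}
    (hx : x ∈ visitedCells step acc c head) : Set.Iic x ⊆ visitedCells step acc c head := by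
  obtain ⟨t, b, hb, hacc, rfl⟩ := hx
  induction t generalizing b with
  | zero =>
    cases hb
    intro y hy
    obtain rfl : y = 0 := by simpa [h0] using hy
    exact ⟨0, _, rfl, by simp, h0⟩
  | succ t ih =>
    intro y hy
    cases hd : runFor step c t with
    | none => simp [runFor, hd] at hb
    | some d =>
      have hdb : step d = some b := by simpa [runFor, hd] using hb
      rcases eq_or_lt_of_le (Set.mem_Iic.1 hy) with rfl | hlt
      · exact ⟨t + 1, b, hb, hacc, rfl⟩
      -- The head moved by at most one cell, so a position strictly below the new one is at most the
      -- previous one.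
      · exact ih d hd (fun s hs => hacc s (by omega)) (Set.mem_Iic.2 (by
          have := hstep d b hdb; omega))

/-- With a position `x` all `x + 1` cells up to it have been visited. This converts a bound on the
number of cells into a bound on positions. -/
theorem lt_of_mem_visitedCells {c : α} {head : α → ℕ} (h0 : head c = 0)
    (hstep : ∀ b d, step b = some d → head d ≤ head b + 1) {B : ℕ}
    (hB : (visitedCells step acc c head).encard ≤ (B : ℕ)) {x : ℕ}
    (hx : x ∈ visitedCells step acc c head) : x < B := by
  have h1 := (Set.encard_le_encard (Iic_subset_visitedCells h0 hstep hx)).trans hB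
  have h2 : (Set.Iic x).encard = ((x + 1 : ℕ) : ℕ∞) := by
    rw [← Finset.coe_Iic, Set.encard_coe_eq_coe_finsetCard, Nat.card_Iic]
  rw [h2, Nat.cast_le] at h1
  omega

end Path

end

section

variable {R H O E F S : Type}

/-! ### Controls as Turing machines

Every tape of the memory is represented by two tapes, the second of which has a mark in its
leftmost cell and a head that moves in parallel; every further head is represented by such a marked
tape. -/

/-- The tape that has a mark in its leftmost cell. -/
def markTape (p : ℕ) : SemiTape := ⟨fun j => if j = 0 then .one else .blank, p⟩

/-- The mark makes the left end observable: it is read exactly in cell `0`. -/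
theorem markTape_read (p : ℕ) : decide ((markTape p).read = .one) = (p == 0) := by
  by_cases h : p = 0 <;> simp [markTape, SemiTape.read, h]

namespace TapeMem

/-- The contents of the tape with a given role: a tape of the memory, or the marked tape of a tape
or of a further head. -/
def roleTape (m : TapeMem R H) : R ⊕ R ⊕ H → SemiTape
  | .inl r => m.tape r
  | .inr (.inl r) => markTape (m.tape r).head
  | .inr (.inr h) => markTape (m.pos h)

/-- All tapes hold the word `0`. -/
def initial (R H : Type) : TapeMem R H := ⟨fun _ => .ofWord [false], fun _ => 0⟩

theorem InSpace.head_roleTape_le {K : ℕ} {m : TapeMem R H} (hm : m.InSpace K) (ρ : R ⊕ R ⊕ H) :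
    (m.roleTape ρ).head ≤ K := by
  rcases ρ with r | r | h
  · exact hm.1 r
  · exact hm.1 r
  · exact hm.2 h

end TapeMem

namespace TapeAction

def roleAct (a : TapeAction R H) : R ⊕ R ⊕ H → Option TapeSymbol × HeadMove
  | .inl r => a.tape r
  | .inr (.inl r) => (none, (a.tape r).2)
  | .inr (.inr h) => (none, a.pos h)

/-- The tape and its marked companion make the same moves, and the companion rewrites what it reads,
so the two heads stay in the same position. -/
theorem roleTape_act (m : TapeMem R H) (a : TapeAction R H) (ρ : R ⊕ R ⊕ H) :
    (m.act a).roleTape ρ =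
      ((m.roleTape ρ).write ((a.roleAct ρ).1.getD (m.roleTape ρ).read)).move (a.roleAct ρ).2 := by
  rcases ρ with r | r | h
  · rfl
  · cases hd : (a.tape r).2 <;>
      simp [roleAct, TapeMem.roleTape, TapeMem.act, SemiTape.act, markTape, HeadMove.app, hd,
        SemiTape.move]
  · cases hd : a.pos h <;>
      simp [roleAct, TapeMem.roleTape, TapeMem.act, markTape, HeadMove.app, hd, SemiTape.move]

theorem not_blocked {m : TapeMem R H} {a : TapeAction R H} (h : m.Allowed a) (ρ : R ⊕ R ⊕ H) :
    ¬ (m.roleTape ρ).Blocked (a.roleAct ρ).2 := by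
  rintro ⟨h1, h2⟩
  rcases ρ with r | r | p
  · exact h.1 r h1 h2
  · exact h.1 r h1 h2
  · exact h.2 p h1 h2

end TapeAction

/-- The symbol that is written in the first step on a tape with a given role. -/
def initialMark : R ⊕ R ⊕ H → TapeSymbol
  | .inl _ => .zero
  | .inr _ => .one

/-- Initially a tape is blank, or holds `0` if it is the address-tape of a random-access machine. In
both cases one write in the leftmost cell produces the tape required at the start of a control: the
word `0`, or a mark. -/
theorem write_zero_wordCells (w : List Bool) (hw : w = [] ∨ w = [false]) :
    Function.update (wordCells w) 0 .zero = wordCells [false] := by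
  funext j
  rcases hw with rfl | rfl <;> cases j <;> simp [wordCells, Function.update, TapeSymbol.ofBool]

theorem write_one_wordCells (w : List Bool) (hw : w = [] ∨ w = [false]) :
    Function.update (wordCells w) 0 .one = (markTape 0).cells := by
  funext j
  rcases hw with rfl | rfl <;> cases j <;> simp [wordCells, Function.update, markTape]

theorem initial_roleTape {w : List Bool} (hw : w = [] ∨ w = [false]) (ρ : R ⊕ R ⊕ H) :
    ((SemiTape.ofWord w).write (initialMark ρ)).move .stay =
      (TapeMem.initial R H).roleTape ρ := by
  rcases ρ with r | r | h
  · simp [SemiTape.move, SemiTape.write, SemiTape.ofWord, initialMark, TapeMem.roleTape,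
      TapeMem.initial, write_zero_wordCells w hw]
  · simp [SemiTape.move, SemiTape.write, SemiTape.ofWord, initialMark, TapeMem.roleTape,
      TapeMem.initial, write_one_wordCells w hw]
    rfl
  · simp [SemiTape.move, SemiTape.write, SemiTape.ofWord, initialMark, TapeMem.roleTape,
      TapeMem.initial, write_one_wordCells w hw]
    rfl

/-! ### The random-access machine of a control. -/

namespace RandomAccessTM

theorem step_eq_some {M : RandomAccessTM} {w : List Bool} {c d : M.Config}
    {act : Fin (M.numWork + 1) → TapeSymbol × HeadMove}
    (h : M.trans c.state (inputSymbolAt w (c.tape 0).number) (fun l => (c.tape l).read) =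
      some (d.state, act))
    (hb : ∀ l, ¬ (c.tape l).Blocked (act l).2)
    (hd : ∀ l, ((c.tape l).write (act l).1).move (act l).2 = d.tape l) : M.step w c = some d := by
  simp only [step, h]
  rw [if_neg (by simpa using hb)]
  simp only [hd]

/-- The oracle of a random-access machine with the address-tape `r₀`. -/
def oracle (w : List Bool) (r₀ : R) (num : R → ℕ) (_ : Empty → ℕ) : InputSymbol :=
  inputSymbolAt w (num r₀)

variable [Finite R] (r₀ : R) (P : Ctrl R Empty InputSymbol Bool)

/-- The roles of the tapes. -/
noncomputable def layout (R : Type) [Finite R] (r₀ : R) :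
    Fin (Nat.card (R ⊕ R ⊕ Empty) + 1) → R ⊕ R ⊕ Empty :=
  Fin.cases (.inl r₀) (Finite.equivFin _).symm

/-- A tape with a given role. -/
noncomputable def tapeOf (R : Type) [Finite R] (ρ : R ⊕ R ⊕ Empty) :
    Fin (Nat.card (R ⊕ R ⊕ Empty) + 1) :=
  (Finite.equivFin _ ρ).succ

-- Every role is carried by a work-tape. The role of `r₀` is carried by the address-tape as well,
-- which just repeats the actions of that work-tape.
@[simp] theorem layout_tapeOf (ρ : R ⊕ R ⊕ Empty) : layout R r₀ (tapeOf R ρ) = ρ := by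
  simp [layout, tapeOf]

/-- The random-access machine of a control. -/
noncomputable def ofCtrl : RandomAccessTM where
  State := Option (P.Q ⊕ Bool)
  finite_state := by
    have := P.finite_Q
    infer_instance
  start := none
  final := {some (.inr true)}
  numWork := Nat.card (R ⊕ R ⊕ Empty)
  numWork_pos := Nat.card_pos_iff.2 ⟨⟨.inl r₀⟩, inferInstance⟩
  trans
    -- The additional first step writes the marks and the initial zeros.
    | none, _, _ => some (some (.inl P.start), fun t => (initialMark (layout R r₀ t), .stay))
    | some (.inr _), _, _ => none
    | some (.inl q), x, s =>
        let y := P.trans q ⟨fun r => s (tapeOf R (.inl r)),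
          fun r => decide (s (tapeOf R (.inr (.inl r))) = .one), fun h => h.elim, x⟩
        some (some y.2, fun t => ((y.1.roleAct (layout R r₀ t)).1.getD (s t),
          (y.1.roleAct (layout R r₀ t)).2))

/-- The configuration that represents a memory. -/
noncomputable def configOf (q : P.Q ⊕ Bool) (m : TapeMem R Empty) : (ofCtrl r₀ P).Config where
  state := some q
  tape t := m.roleTape (layout R r₀ t)

theorem not_mem_final {c : (ofCtrl r₀ P).Config} {x : Option (P.Q ⊕ Bool)} (hc : c.state = x)
    (hx : x ≠ some (.inr true)) : c.state ∉ (ofCtrl r₀ P).final :=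
  fun h => hx (hc.symm.trans h)

theorem step_initial (w : List Bool) :
    (ofCtrl r₀ P).step w (ofCtrl r₀ P).initial =
      some (configOf r₀ P (.inl P.start) (TapeMem.initial R Empty)) := by
  refine step_eq_some rfl (fun l hl => by cases hl.1) fun l => ?_
  refine Eq.trans ?_ (initial_roleTape (w := if l = 0 then [false] else []) ?_ _)
  · simp only [initial]
    split_ifs <;> rfl
  · split_ifs <;> simp

/-- The symbols on the tapes `tapeOf` recover the observation of the memory, with the marks
supplying the information on left ends. -/
theorem step_configOf (w : List Bool) (q : P.Q) {m : TapeMem R Empty} {a : TapeAction R Empty}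
    {x : P.Q ⊕ Bool} (h : P.trans q (m.obs (oracle w r₀)) = (a, x)) (ha : m.Allowed a) :
    (ofCtrl r₀ P).step w (configOf r₀ P (.inl q) m) = some (configOf r₀ P x (m.act a)) := by
  have hobs : (⟨fun r => ((configOf r₀ P (.inl q) m).tape (tapeOf R (.inl r))).read,
      fun r => decide (((configOf r₀ P (.inl q) m).tape (tapeOf R (.inr (.inl r)))).read = .one),
      fun h => h.elim,
      inputSymbolAt w ((configOf r₀ P (.inl q) m).tape 0).number⟩ : TapeObs R Empty InputSymbol) =
      m.obs (oracle w r₀) := by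
    simp only [configOf, layout_tapeOf, TapeMem.obs, TapeMem.roleTape, markTape_read]
    congr 1
    funext h
    exact h.elim
  have htr : (ofCtrl r₀ P).trans (some (.inl q))
      (inputSymbolAt w ((configOf r₀ P (.inl q) m).tape 0).number)
      (fun t => ((configOf r₀ P (.inl q) m).tape t).read) =
      some (some x, fun t => ((a.roleAct (layout R r₀ t)).1.getD
        ((configOf r₀ P (.inl q) m).tape t).read, (a.roleAct (layout R r₀ t)).2)) := by
    simp only [ofCtrl]
    rw [hobs, h]
  exact step_eq_some htr (fun l => TapeAction.not_blocked ha _)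
    fun l => (TapeAction.roleTape_act m a _).symm

theorem stepPath_of_reach {w : List Bool} {K : ℕ} {q : P.Q} {m m' : TapeMem R Empty} {b : Bool}
    (h : Ctrl.Reach (oracle w r₀) K P q m b m') :
    StepPath ((ofCtrl r₀ P).step w)
      (fun c => c.state ∉ (ofCtrl r₀ P).final ∧ ∀ l, (c.tape l).head ≤ K)
      (configOf r₀ P (.inl q) m) (configOf r₀ P (.inr b) m') := by
  induction h with
  | exit h1 h2 h3 =>
    exact .head ⟨not_mem_final r₀ P (x := some (.inl _)) rfl (by simp),
      fun l => h1.head_roleTape_le _⟩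
      (step_configOf r₀ P w _ h2 h3) (.refl _)
  | step h1 h2 h3 _ ih =>
    exact .head ⟨not_mem_final r₀ P (x := some (.inl _)) rfl (by simp),
      fun l => h1.head_roleTape_le _⟩
      (step_configOf r₀ P w _ h2 h3) ih

/-- A run is finite by definition and ends in a state without transitions, whose Boolean decides on
acceptance. The positions `0, …, K` account for the bound `K + 1`. -/
theorem ofCtrl_spec {w : List Bool} {K : ℕ} {b : Bool} {m : TapeMem R Empty}
    (h : P.Runs (oracle w r₀) K (TapeMem.initial R Empty) b m) (hm : m.InSpace K) :
    (b = true → (ofCtrl r₀ P).Accepts w) ∧ (b = false → (ofCtrl r₀ P).Rejects w) ∧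
      ∀ l, ((ofCtrl r₀ P).visited w l).encard ≤ (K + 1 : ℕ) := by
  have hp : StepPath ((ofCtrl r₀ P).step w)
      (fun c => c.state ∉ (ofCtrl r₀ P).final ∧ ∀ l, (c.tape l).head ≤ K)
      (ofCtrl r₀ P).initial (configOf r₀ P (.inr b) m) :=
    .head ⟨not_mem_final r₀ P (x := none) rfl (by simp),
      fun l => by simp [initial]; split_ifs <;> simp [SemiTape.ofWord]⟩
      (step_initial r₀ P w) (stepPath_of_reach r₀ P h)
  have hs : (ofCtrl r₀ P).step w (configOf r₀ P (.inr b) m) = none := rfl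
  refine ⟨fun hb => hp.acceptsFrom (by subst hb; exact Set.mem_singleton _),
    fun hb => hp.rejectsFrom (fun c hc => hc.1) (not_mem_final r₀ P (x := some (.inr b)) rfl
      (by simp [hb])) hs, fun l => ?_⟩
  have := hp.visitedCells_subset (acc := fun c => c.state ∈ (ofCtrl r₀ P).final)
    (head := fun c => (c.tape l).head) (fun c hc => hc.2 l) (hm.head_roleTape_le _) (.inr hs)
  refine (Set.encard_le_encard this).trans ?_
  rw [← Finset.coe_Iic, Set.encard_coe_eq_coe_finsetCard, Nat.card_Iic]

end RandomAccessTM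

/-! ### The direct-access machine of a control. -/

namespace DirectAccessTM

variable {σ : FinVocabulary}

theorem step_eq_some {M : DirectAccessTM σ} {A : FinOrderedStructure σ} {c d : M.Config}
    {act : WritableTape σ M.numWork → TapeSymbol × HeadMove} {ract : ReadOnlyTape σ → HeadMove}
    (h : M.trans c.state (fun l => (c.tape l).read) (fun l => (c.rotape l).read)
      (M.answer A c.tape) = some (d.state, act, ract))
    (hb : ∀ l, ¬ (c.tape l).Blocked (act l).2) (hb' : ∀ l, ¬ (c.rotape l).Blocked (ract l))
    (hd : ∀ l, ((c.tape l).write (act l).1).move (act l).2 = d.tape l)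
    (hv : ∀ i, (d.rotape (.value i)) = ⟨wordCells (M.valueWord A d.tape i),
      (ract (.value i)).app (c.rotape (.value i)).head⟩)
    (hc : ∀ i, d.rotape (.const i) = (c.rotape (.const i)).move (ract (.const i)))
    (hs : d.rotape .size = (c.rotape .size).move (ract .size)) : M.step A c = some d := by
  simp only [step, h]
  rw [if_neg (by simpa using ⟨hb, hb'⟩)]
  simp only [hd, Option.some.injEq]
  congr 1
  funext l
  cases l with
  | value i =>
    refine ((hv i).trans ?_).symm
    rw [← SemiTape.head_move]
  | const i => exact (hc i).symm
  | size => exact hs.symm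

instance (k : ℕ) : Finite (WritableTape σ k) :=
  Finite.of_injective
    (β := (Σ i, Fin (σ.relArity i)) ⊕ (Σ i, Fin (σ.funArity i)) ⊕ Fin k)
    (fun | .relAddr i j => .inl ⟨i, j⟩ | .funAddr i j => .inr (.inl ⟨i, j⟩)
         | .work i => .inr (.inr i))
    (by
      rintro (⟨i, j⟩ | ⟨i, j⟩ | i) (⟨i', j'⟩ | ⟨i', j'⟩ | i') h
      all_goals simp_all)

instance : Finite (ReadOnlyTape σ) :=
  Finite.of_injective (β := Fin σ.numFun ⊕ Fin σ.numConst ⊕ Unit)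
    (fun | .value i => .inl i | .const i => .inr (.inl i) | .size => .inr (.inr ()))
    (by rintro (i | i | _) (i' | i' | _) h <;> simp_all)

open Classical in
/-- The value word at given numbers. -/
noncomputable def valueWordAt (A : FinOrderedStructure σ) (i : Fin σ.numFun)
    (num : Fin (σ.funArity i) → ℕ) : List Bool :=
  if h : ∀ j, num j < A.size then binaryWord A.logSize (A.func i fun j => ⟨num j, h j⟩) else []

/-- The symbol on a read-only tape, depending on the numbers on the address-tapes. -/
noncomputable def readOnlyCells (A : FinOrderedStructure σ)
    (num : (i : Fin σ.numFun) → Fin (σ.funArity i) → ℕ) : ReadOnlyTape σ → ℕ → TapeSymbol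
  | .value i => wordCells (valueWordAt A i (num i))
  | .const i => wordCells (A.encodeConst i)
  | .size => wordCells (binaryWord (Nat.size A.size) A.size)

/-- The answers of a direct-access machine. -/
abbrev Answer (σ : FinVocabulary) : Type :=
  (ReadOnlyTape σ → TapeSymbol) × (Fin σ.numRel → Bool)

open Classical in
/-- The oracle of a direct-access machine with given address-tapes. -/
noncomputable def oracle (A : FinOrderedStructure σ)
    (ra : (i : Fin σ.numRel) → Fin (σ.relArity i) → R)
    (fa : (i : Fin σ.numFun) → Fin (σ.funArity i) → R)
    (num : R → ℕ) (pos : ReadOnlyTape σ → ℕ) : Answer σ :=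
  (fun l => readOnlyCells A (fun i j => num (fa i j)) l (pos l),
    fun i => decide (∃ t ∈ A.rel i, ∀ j, (t j : ℕ) = num (ra i j)))

variable [Finite R]

abbrev Role (σ : FinVocabulary) (R : Type) : Type := R ⊕ R ⊕ ReadOnlyTape σ

variable (ra : (i : Fin σ.numRel) → Fin (σ.relArity i) → R)
  (fa : (i : Fin σ.numFun) → Fin (σ.funArity i) → R) (P : Ctrl R (ReadOnlyTape σ) (Answer σ) Bool)

/-- The roles of the tapes. -/
noncomputable def layout : WritableTape σ (Nat.card (Role σ R)) → Role σ R
  | .relAddr i j => .inl (ra i j)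
  | .funAddr i j => .inl (fa i j)
  | .work i => (Finite.equivFin _).symm i

/-- A tape with a given role. -/
noncomputable def tapeOf (ρ : Role σ R) : WritableTape σ (Nat.card (Role σ R)) :=
  .work (Finite.equivFin _ ρ)

@[simp] theorem layout_tapeOf (ρ : Role σ R) : layout ra fa (tapeOf ρ) = ρ := by
  simp [layout, tapeOf]

/-- The direct-access machine of a control. -/
noncomputable def ofCtrl : DirectAccessTM σ where
  State := Option (P.Q ⊕ Bool)
  finite_state := by
    have := P.finite_Q
    infer_instance
  start := none
  final := {some (.inr true)}
  numWork := Nat.card (Role σ R)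
  numWork_pos := Nat.card_pos_iff.2 ⟨⟨.inr (.inr .size)⟩, inferInstance⟩
  trans
    | none, _, _, _ => some (some (.inl P.start),
        fun t => (initialMark (layout ra fa t), .stay), fun _ => .stay)
    | some (.inr _), _, _, _ => none
    | some (.inl q), s, v, b =>
        let y := P.trans q ⟨fun r => s (tapeOf (.inl r)),
          fun r => decide (s (tapeOf (.inr (.inl r))) = .one),
          fun h => decide (s (tapeOf (.inr (.inr h))) = .one), (v, b)⟩
        some (some y.2, fun t => ((y.1.roleAct (layout ra fa t)).1.getD (s t),
          (y.1.roleAct (layout ra fa t)).2), y.1.pos)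

/-- The configuration that represents a memory. -/
noncomputable def configOf (A : FinOrderedStructure σ) (q : P.Q ⊕ Bool)
    (m : TapeMem R (ReadOnlyTape σ)) : (ofCtrl ra fa P).Config where
  state := some q
  tape t := m.roleTape (layout ra fa t)
  rotape l := ⟨readOnlyCells A (fun i j => (m.tape (fa i j)).number) l, m.pos l⟩

theorem not_mem_final {c : (ofCtrl ra fa P).Config} {x : Option (P.Q ⊕ Bool)} (hc : c.state = x)
    (hx : x ≠ some (.inr true)) : c.state ∉ (ofCtrl ra fa P).final :=
  fun h => hx (hc.symm.trans h)

/-- The value-tapes are blank only before this step, which ignores them. Afterwards they hold the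
values at the arguments `0`, as the oracle has it for the initial memory. -/
theorem step_initial (A : FinOrderedStructure σ) :
    (ofCtrl ra fa P).step A ((ofCtrl ra fa P).initial A) =
      some (configOf ra fa P A (.inl P.start) (TapeMem.initial R (ReadOnlyTape σ))) :=
  step_eq_some rfl (fun l hl => by cases hl.1) (fun l hl => by cases hl.1)
    (fun l => initial_roleTape (w := []) (.inl rfl) (layout ra fa l)) (fun i => rfl) (fun i => rfl)
    rfl

theorem step_configOf (A : FinOrderedStructure σ) (q : P.Q) {m : TapeMem R (ReadOnlyTape σ)}
    {a : TapeAction R (ReadOnlyTape σ)} {x : P.Q ⊕ Bool}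
    (h : P.trans q (m.obs (oracle A ra fa)) = (a, x)) (ha : m.Allowed a) :
    (ofCtrl ra fa P).step A (configOf ra fa P A (.inl q) m) =
      some (configOf ra fa P A x (m.act a)) := by
  set c := configOf ra fa P A (.inl q) m with hc
  have hobs : (⟨fun r => (c.tape (tapeOf (.inl r))).read,
      fun r => decide ((c.tape (tapeOf (.inr (.inl r)))).read = .one),
      fun h => decide ((c.tape (tapeOf (.inr (.inr h)))).read = .one),
      (fun l => (c.rotape l).read, (ofCtrl ra fa P).answer A c.tape)⟩ :
        TapeObs R (ReadOnlyTape σ) (Answer σ)) = m.obs (oracle A ra fa) := by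
    simp only [hc, configOf, layout_tapeOf, TapeMem.obs, TapeMem.roleTape, markTape_read]
    congr 1
  have htr : (ofCtrl ra fa P).trans (some (.inl q)) (fun t => (c.tape t).read)
      (fun l => (c.rotape l).read) ((ofCtrl ra fa P).answer A c.tape) =
      some (some x, fun t => ((a.roleAct (layout ra fa t)).1.getD (c.tape t).read,
        (a.roleAct (layout ra fa t)).2), a.pos) := by
    simp only [ofCtrl]
    simp only [ofCtrl] at hobs
    rw [hobs, h]
  refine step_eq_some htr (fun l => TapeAction.not_blocked ha _) (fun l hl => ha.2 l hl.1 hl.2)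
    (fun l => (TapeAction.roleTape_act m a _).symm) (fun i => rfl) (fun i => ?_) ?_
  · cases hd : a.pos (.const i) <;>
      simp [configOf, TapeMem.act, hc, hd, HeadMove.app, SemiTape.move, readOnlyCells]
  · cases hd : a.pos .size <;>
      simp [configOf, TapeMem.act, hc, hd, HeadMove.app, SemiTape.move, readOnlyCells]

theorem stepPath_of_reach {A : FinOrderedStructure σ} {K : ℕ} {q : P.Q}
    {m m' : TapeMem R (ReadOnlyTape σ)} {b : Bool}
    (h : Ctrl.Reach (oracle A ra fa) K P q m b m') :
    StepPath ((ofCtrl ra fa P).step A)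
      (fun c => c.state ∉ (ofCtrl ra fa P).final ∧ (∀ l, (c.tape l).head ≤ K) ∧
        ∀ l, (c.rotape l).head ≤ K)
      (configOf ra fa P A (.inl q) m) (configOf ra fa P A (.inr b) m') := by
  induction h with
  | exit h1 h2 h3 =>
    exact .head ⟨not_mem_final ra fa P (x := some (.inl _)) rfl (by simp),
      fun l => h1.head_roleTape_le _, h1.2⟩
      (step_configOf ra fa P A _ h2 h3) (.refl _)
  | step h1 h2 h3 _ ih =>
    exact .head ⟨not_mem_final ra fa P (x := some (.inl _)) rfl (by simp),
      fun l => h1.head_roleTape_le _, h1.2⟩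
      (step_configOf ra fa P A _ h2 h3) ih

theorem ofCtrl_spec {A : FinOrderedStructure σ} {K : ℕ} {b : Bool}
    {m : TapeMem R (ReadOnlyTape σ)}
    (h : P.Runs (oracle A ra fa) K (TapeMem.initial R (ReadOnlyTape σ)) b m) (hm : m.InSpace K) :
    (b = true → (ofCtrl ra fa P).Accepts A) ∧ (b = false → (ofCtrl ra fa P).Rejects A) ∧
      (∀ l, ((ofCtrl ra fa P).visited A l).encard ≤ (K + 1 : ℕ)) ∧
      ∀ l, ((ofCtrl ra fa P).visitedReadOnly A l).encard ≤ (K + 1 : ℕ) := by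
  have hp : StepPath ((ofCtrl ra fa P).step A)
      (fun c => c.state ∉ (ofCtrl ra fa P).final ∧ (∀ l, (c.tape l).head ≤ K) ∧
        ∀ l, (c.rotape l).head ≤ K)
      ((ofCtrl ra fa P).initial A) (configOf ra fa P A (.inr b) m) :=
    .head ⟨not_mem_final ra fa P (x := none) rfl (by simp),
      fun l => by simp [initial, SemiTape.ofWord],
      fun l => by cases l <;> simp [initial, SemiTape.ofWord]⟩
      (step_initial ra fa P A) (stepPath_of_reach ra fa P h)
  have hs : (ofCtrl ra fa P).step A (configOf ra fa P A (.inr b) m) = none := rfl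
  have hcard : (Set.Iic K).encard ≤ (K + 1 : ℕ) := by
    rw [← Finset.coe_Iic, Set.encard_coe_eq_coe_finsetCard, Nat.card_Iic]
  refine ⟨fun hb => hp.acceptsFrom (by subst hb; exact Set.mem_singleton _),
    fun hb => hp.rejectsFrom (fun c hc => hc.1) (not_mem_final ra fa P (x := some (.inr b)) rfl
      (by simp [hb])) hs,
    fun l => ?_, fun l => ?_⟩
  · exact (Set.encard_le_encard (hp.visitedCells_subset
      (acc := fun c => c.state ∈ (ofCtrl ra fa P).final)
      (head := fun c => (c.tape l).head) (fun c hc => hc.2.1 l) (hm.head_roleTape_le _)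
      (.inr hs))).trans hcard
  · exact (Set.encard_le_encard (hp.visitedCells_subset
      (acc := fun c => c.state ∈ (ofCtrl ra fa P).final)
      (head := fun c => (c.rotape l).head) (fun c hc => hc.2.2 l) (hm.2 l)
      (.inr hs))).trans hcard

end DirectAccessTM

end

section

variable {R H O E F S : Type}

/-! ### Binary words -/

/-- The number with a given binary representation, most significant bit first. -/
def wordVal (w : List Bool) : ℕ := w.foldl (fun x b => 2 * x + b.toNat) 0

theorem wordVal_append_singleton (w : List Bool) (b : Bool) :
    wordVal (w ++ [b]) = 2 * wordVal w + b.toNat := by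
  simp [wordVal]

@[simp] theorem wordVal_nil : wordVal [] = 0 := rfl

theorem wordVal_append (u v : List Bool) :
    wordVal (u ++ v) = wordVal u * 2 ^ v.length + wordVal v := by
  induction v using List.reverseRecOn with
  | nil => simp
  | append_singleton v b ih =>
    rw [← List.append_assoc, wordVal_append_singleton, ih, wordVal_append_singleton,
      List.length_append, List.length_singleton, pow_succ]
    ring

theorem wordVal_cons (b : Bool) (v : List Bool) :
    wordVal (b :: v) = b.toNat * 2 ^ v.length + wordVal v := by
  rw [← List.singleton_append, wordVal_append]
  simp [wordVal]

@[simp] theorem wordVal_replicate_false (k : ℕ) : wordVal (List.replicate k false) = 0 := by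
  induction k with
  | zero => rfl
  | succ k ih => rw [List.replicate_succ, wordVal_cons, ih]; simp

theorem wordVal_replicate_true (k : ℕ) : wordVal (List.replicate k true) + 1 = 2 ^ k := by
  induction k with
  | zero => rfl
  | succ k ih =>
    rw [List.replicate_succ, wordVal_cons, add_assoc, ih, List.length_replicate, pow_succ]
    simp
    ring

theorem wordVal_lt (w : List Bool) : wordVal w < 2 ^ w.length := by
  induction w with
  | nil => simp
  | cons b w ih =>
    rw [wordVal_cons, List.length_cons, pow_succ]
    cases b <;> simp <;> omega

theorem eq_of_wordVal_eq {u v : List Bool} (hl : u.length = v.length)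
    (hv : wordVal u = wordVal v) : u = v := by
  induction u generalizing v with
  | nil => cases v <;> simp_all
  | cons b u ih =>
    cases v with
    | nil => simp at hl
    | cons c v =>
      have hl' : u.length = v.length := by simpa using hl
      rw [wordVal_cons, wordVal_cons, hl'] at hv
      have h1 := wordVal_lt u
      have h2 := wordVal_lt v
      rw [hl'] at h1
      cases b <;> cases c <;> simp at hv
      · rw [ih hl' hv]
      · omega
      · omega
      · rw [ih hl' hv]

theorem exists_wordVal_eq_zero_iff (w : List Bool) :
    wordVal w = 0 ↔ w = List.replicate w.length false := by
  refine ⟨fun h => eq_of_wordVal_eq (by simp) (by simp [h]), fun h => ?_⟩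
  rw [h]
  simp

/-- A word is constant, or it has a last bit different from the given one. -/
theorem eq_replicate_or_exists_last (b : Bool) (w : List Bool) :
    w = List.replicate w.length b ∨ ∃ u k, w = u ++ (!b) :: List.replicate k b := by
  induction w using List.reverseRecOn with
  | nil => simp
  | append_singleton w c ih =>
    by_cases hc : c = b
    · subst hc
      rcases ih with h | ⟨u, k, h⟩
      · left
        conv_lhs => rw [h]
        simp [List.replicate_succ']
      · right
        refine ⟨u, k + 1, ?_⟩
        conv_lhs => rw [h]
        simp [List.replicate_succ']
    · right
      refine ⟨w, 0, ?_⟩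
      cases c <;> cases b <;> simp_all

/-- The sum is the one that defines `SemiTape.number`. -/
theorem wordVal_map_range (f : ℕ → Bool) (n : ℕ) :
    wordVal ((List.range n).map f) = ∑ j ∈ Finset.range n, if f j then 2 ^ (n - 1 - j) else 0 := by
  induction n with
  | zero => rfl
  | succ n ih =>
    rw [List.range_succ, List.map_append, List.map_singleton, wordVal_append_singleton, ih,
      Finset.sum_range_succ, Finset.mul_sum]
    congr 1
    · refine Finset.sum_congr rfl fun j hj => ?_
      have : j < n := Finset.mem_range.1 hj
      split_ifs
      · rw [← pow_succ']
        congr 1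
        omega
      · rfl
    · cases f n <;> simp

theorem length_binaryWord (w x : ℕ) : (binaryWord w x).length = w := by simp [binaryWord]

/-- Removing the last digit leaves the word of `x / 2`, and this digit is `x % 2`. -/
theorem wordVal_binaryWord {w x : ℕ} (h : x < 2 ^ w) : wordVal (binaryWord w x) = x := by
  induction w generalizing x with
  | zero => simp [binaryWord] at *; omega
  | succ w ih =>
    have h1 : binaryWord (w + 1) x = binaryWord w (x / 2) ++ [x.testBit 0] := by
      unfold binaryWord
      rw [List.range_succ, List.map_append, List.map_singleton]
      congr 1
      · refine List.map_congr_left fun j hj => ?_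
        have : j < w := List.mem_range.1 hj
        rw [binaryDigit, binaryDigit, Nat.testBit_div_two]
        congr 1
        omega
      · simp [binaryDigit]
    rw [h1, wordVal_append_singleton, ih (by rw [pow_succ] at h; omega)]
    have : (x.testBit 0).toNat = x % 2 := by
      rw [Nat.testBit_zero]
      rcases Nat.mod_two_eq_zero_or_one x with h | h <;> simp [h]
    omega

/-! ### Words on tapes -/

@[simp] theorem wordCells_append_cons (u v : List Bool) (b : Bool) :
    wordCells (u ++ b :: v) u.length = .ofBool b := by
  simp [wordCells]

@[simp] theorem wordCells_length (w : List Bool) : wordCells w w.length = .blank := by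
  simp [wordCells]

theorem wordCells_of_le {w : List Bool} {j : ℕ} (h : w.length ≤ j) :
    wordCells w j = .blank := by
  simp [wordCells, h]

theorem wordCells_of_lt {w : List Bool} {j : ℕ} (h : j < w.length) :
    wordCells w j = .ofBool w[j] := by
  simp [wordCells, h]

theorem TapeSymbol.ofBool_ne_blank (b : Bool) : TapeSymbol.ofBool b ≠ .blank := by
  cases b <;> simp [ofBool]

theorem wordCells_eq_blank_iff {w : List Bool} {j : ℕ} :
    wordCells w j = .blank ↔ w.length ≤ j := by
  refine ⟨fun h => ?_, wordCells_of_le⟩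
  by_contra hj
  rw [wordCells_of_lt (not_le.1 hj)] at h
  exact TapeSymbol.ofBool_ne_blank _ h

theorem TapeSymbol.ofBool_inj {a b : Bool} : TapeSymbol.ofBool a = .ofBool b ↔ a = b := by
  cases a <;> cases b <;> simp [ofBool]

theorem update_wordCells (u v : List Bool) (b c : Bool) :
    Function.update (wordCells (u ++ b :: v)) u.length (.ofBool c) = wordCells (u ++ c :: v) := by
  funext j
  by_cases hj : j = u.length
  · subst hj; simp
  · rw [Function.update_of_ne hj]
    rcases lt_or_gt_of_ne hj with h | h
    · simp [wordCells, List.getElem?_append_left h]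
    · obtain ⟨k, hk⟩ : ∃ k, j - u.length = k + 1 := ⟨j - u.length - 1, by omega⟩
      simp [wordCells, List.getElem?_append_right h.le, hk]

theorem update_wordCells_length (u : List Bool) (c : Bool) :
    Function.update (wordCells u) u.length (.ofBool c) = wordCells (u ++ [c]) := by
  funext j
  by_cases hj : j = u.length
  · subst hj; simp
  · rw [Function.update_of_ne hj]
    rcases lt_or_gt_of_ne hj with h | h
    · simp [wordCells, List.getElem?_append_left h]
    · rw [wordCells_of_le h.le, wordCells_of_le (by simp; omega)]

theorem update_wordCells_last (u : List Bool) (c : Bool) :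
    Function.update (wordCells (u ++ [c])) u.length .blank = wordCells u := by
  rw [← update_wordCells_length, Function.update_idem, ← wordCells_length u,
    Function.update_eq_self]

namespace SemiTape

/-- The word between the leftmost cell and the first blank. -/
noncomputable def word (T : SemiTape) : List Bool :=
  (List.range (sInf {j | T.cells j = .blank})).map fun j => decide (T.cells j = .one)

/-- This needs no blank cell: without one, `sInf ∅ = 0` makes the word empty and the number `0`. A
blank is needed only where the end of the word is to be found by a head. -/
theorem number_eq_wordVal (T : SemiTape) : T.number = wordVal T.word := by
  rw [word, wordVal_map_range]
  simp [number]

theorem wordCells_word {T : SemiTape} {j : ℕ} (h : j < T.word.length) :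
    wordCells T.word j = T.cells j := by
  rw [wordCells_of_lt h]
  have h' : j < sInf {j | T.cells j = .blank} := by simpa [word] using h
  have : T.cells j ≠ .blank := fun hb =>
    absurd (Nat.sInf_le (s := {j | T.cells j = .blank}) hb) (by omega)
  simp only [word, List.getElem_map, List.getElem_range]
  cases hT : T.cells j <;> simp_all [TapeSymbol.ofBool]

theorem cells_word_length {T : SemiTape} {k : ℕ} (h : T.cells k = .blank) :
    T.cells T.word.length = .blank := by
  have : T.word.length = sInf {j | T.cells j = .blank} := by simp [word]
  rw [this]
  exact Nat.sInf_mem (s := {j | T.cells j = .blank}) ⟨k, h⟩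

theorem word_length_le {T : SemiTape} {k : ℕ} (h : T.cells k = .blank) : T.word.length ≤ k := by
  have : T.word.length = sInf {j | T.cells j = .blank} := by simp [word]
  rw [this]
  exact Nat.sInf_le h

theorem word_mk_wordCells (w : List Bool) (h : ℕ) : (⟨wordCells w, h⟩ : SemiTape).word = w := by
  set T : SemiTape := ⟨wordCells w, h⟩
  have hl : T.word.length = w.length := by
    apply le_antisymm
    · exact word_length_le (wordCells_length w)
    · exact wordCells_eq_blank_iff.1 (cells_word_length (T := T) (wordCells_length w))
  refine List.ext_getElem hl fun j h1 h2 => ?_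
  have := wordCells_word h1
  rw [wordCells_of_lt h1] at this
  exact TapeSymbol.ofBool_inj.1 (this.trans (wordCells_of_lt h2))

theorem number_ofWord (w : List Bool) : (ofWord w).number = wordVal w := by
  rw [number_eq_wordVal, ofWord, word_mk_wordCells]

end SemiTape

/-! ### Controls that use one tape -/

variable [DecidableEq R]

namespace TapeMem

def setTape (m : TapeMem R H) (r : R) (T : SemiTape) : TapeMem R H :=
  ⟨Function.update m.tape r T, m.pos⟩

@[simp] theorem setTape_setTape (m : TapeMem R H) (r : R) (T T' : SemiTape) :
    (m.setTape r T).setTape r T' = m.setTape r T' := by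
  simp [setTape]

@[simp] theorem tape_setTape (m : TapeMem R H) (r : R) (T : SemiTape) :
    (m.setTape r T).tape r = T := by
  simp [setTape]

theorem tape_setTape_of_ne (m : TapeMem R H) {r r' : R} (h : r' ≠ r) (T : SemiTape) :
    (m.setTape r T).tape r' = m.tape r' := by
  simp [setTape, h]

theorem setTape_eq_self (m : TapeMem R H) {r : R} {T : SemiTape} (h : m.tape r = T) :
    m.setTape r T = m := by
  subst h
  simp [setTape]

theorem setTape_comm (m : TapeMem R H) {r r' : R} (h : r ≠ r') (T T' : SemiTape) :
    (m.setTape r T).setTape r' T' = (m.setTape r' T').setTape r T := by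
  simp only [setTape, Function.update_comm h]

theorem InSpace.setTape {K : ℕ} {m : TapeMem R H} (hm : m.InSpace K) {r : R} {T : SemiTape}
    (hT : T.head ≤ K) : (m.setTape r T).InSpace K := by
  refine ⟨fun r' => ?_, hm.2⟩
  by_cases h : r' = r
  · subst h; simpa
  · rw [tape_setTape_of_ne m h]; exact hm.1 r'

end TapeMem

namespace TapeAction

/-- The action on a single tape. -/
def onTape (r : R) (a : Option TapeSymbol × HeadMove) : TapeAction R H :=
  ⟨Function.update (fun _ => (none, .stay)) r a, fun _ => .stay⟩

theorem act_onTape (m : TapeMem R H) (r : R) (a : Option TapeSymbol × HeadMove) :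
    m.act (onTape r a) = m.setTape r ((m.tape r).act a) := by
  simp only [TapeMem.act, onTape, TapeMem.setTape, HeadMove.app]
  congr 1
  funext r'
  by_cases h : r' = r
  · subst h; simp
  · simp [h]

theorem allowed_onTape {m : TapeMem R H} {r : R} {a : Option TapeSymbol × HeadMove}
    (h : a.2 = .left → (m.tape r).head ≠ 0) : m.Allowed (onTape r a) := by
  refine ⟨fun r' => ?_, by simp [onTape]⟩
  by_cases hr : r' = r
  · subst hr; simpa [onTape] using h
  · simp [onTape, hr]

end TapeAction

namespace Ctrl

variable {ora : (R → ℕ) → (H → ℕ) → O} {K : ℕ}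

/-- The control changes the tape `r` only. -/
def OnTape (ora : (R → ℕ) → (H → ℕ) → O) (K : ℕ) (P : Ctrl R H O E) (r : R) (T : SemiTape) (e : E)
    (T' : SemiTape) : Prop :=
  T'.head ≤ K ∧ ∀ m : TapeMem R H, m.InSpace K → m.tape r = T → P.Runs ora K m e (m.setTape r T')

/-- `OnTape` quantifies over all memories with the given tape, so composition needs no separate
frame condition for the other tapes. -/
theorem OnTape.bind [Finite E] {P : Ctrl R H O E} {G : E → Ctrl R H O F} {r : R}
    {T T' T'' : SemiTape} {e : E} {f : F} (h : OnTape ora K P r T e T')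
    (h' : OnTape ora K (G e) r T' f T'') : OnTape ora K (P.bind G) r T f T'' :=
  ⟨h'.1, fun m hm hT => (h.2 m hm hT).bind
    (by simpa using h'.2 (m.setTape r T') (hm.setTape h.1) (by simp))⟩

theorem OnTape.iterate_done [Finite S] {B : S → Ctrl R H O (S ⊕ E)} {s : S} {r : R}
    {T T' : SemiTape} {e : E} (h : OnTape ora K (B s) r T (.inr e) T') :
    OnTape ora K (iterate B s) r T e T' :=
  ⟨h.1, fun m hm hT => (h.2 m hm hT).iterate_done⟩

theorem OnTape.iterate_next [Finite S] {B : S → Ctrl R H O (S ⊕ E)} {s s' : S} {r : R}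
    {T T' T'' : SemiTape} {e : E} (h : OnTape ora K (B s) r T (.inl s') T')
    (h' : OnTape ora K (iterate B s') r T' e T'') : OnTape ora K (iterate B s) r T e T'' :=
  ⟨h'.1, fun m hm hT => (h.2 m hm hT).iterate_next
    (by simpa using h'.2 (m.setTape r T') (hm.setTape h.1) (by simp))⟩

/-- One step on one tape. -/
def tapeStep (r : R) (f : TapeSymbol → Bool → (Option TapeSymbol × HeadMove) × E) : Ctrl R H O E :=
  prim fun o => (TapeAction.onTape r (f (o.sym r) (o.atLeft r)).1, (f (o.sym r) (o.atLeft r)).2)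

theorem onTape_tapeStep {r : R} {f : TapeSymbol → Bool → (Option TapeSymbol × HeadMove) × E}
    {T T' : SemiTape} {a : Option TapeSymbol × HeadMove} {e : E}
    (hf : f T.read (T.head == 0) = (a, e)) (ha : a.2 = .left → T.head ≠ 0) (hT' : T.act a = T')
    (hK : T'.head ≤ K) : OnTape ora K (tapeStep r f) r T e T' := by
  refine ⟨hK, fun m hm hT => ?_⟩
  rw [← hT', ← hT, ← TapeAction.act_onTape]
  refine Runs.prim hm ?_ (TapeAction.allowed_onTape (by rwa [hT]))
  simp only [TapeMem.obs, hT, hf]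

/-- Move right to the first blank. -/
def seekBlank (r : R) : Ctrl R H O Unit :=
  iterate (fun _ : Unit => tapeStep r fun s _ =>
    if s = .blank then ((none, .stay), .inr ()) else ((none, .right), .inl ())) ()

theorem onTape_seekBlank {r : R} {w : List Bool} {h : ℕ} (hw : h ≤ w.length) (hK : w.length ≤ K) :
    OnTape ora K (seekBlank r) r ⟨wordCells w, h⟩ () ⟨wordCells w, w.length⟩ := by
  obtain ⟨k, hk⟩ := Nat.exists_eq_add_of_le hw
  induction k generalizing h with
  | zero =>
    obtain rfl : h = w.length := by omega
    exact OnTape.iterate_done (onTape_tapeStep (a := (none, .stay)) (by simp [SemiTape.read])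
      (by simp) (by simp) hK)
  | succ k ih =>
    refine OnTape.iterate_next (T' := ⟨wordCells w, h + 1⟩) (onTape_tapeStep (a := (none, .right))
      ?_ (by simp) (by simp) (by simp; omega)) (ih (by omega) (by omega))
    rw [if_neg]
    simp only [SemiTape.read, wordCells_eq_blank_iff]
    omega

/-- Move to the leftmost cell. -/
def rewind (r : R) : Ctrl R H O Unit :=
  iterate (fun _ : Unit => tapeStep r fun _ l =>
    if l then ((none, .stay), .inr ()) else ((none, .left), .inl ())) ()

theorem onTape_rewind {r : R} {c : ℕ → TapeSymbol} {h : ℕ} (hK : h ≤ K) :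
    OnTape ora K (rewind r) r ⟨c, h⟩ () ⟨c, 0⟩ := by
  induction h with
  | zero => exact OnTape.iterate_done (onTape_tapeStep (a := (none, .stay)) (by simp)
      (by simp) (by simp) (by simp))
  | succ h ih =>
    exact OnTape.iterate_next (T' := ⟨c, h⟩) (onTape_tapeStep (a := (none, .left))
      (by simp) (by simp) (by simp) (by simp; omega)) (ih (by omega))

/-- Going to the left, replace the bits `b` by the opposite ones; replace the first other bit too,
and stop there.  The value tells that there is no other bit. -/
def flip (r : R) (b : Bool) : Ctrl R H O Bool :=
  iterate (fun _ : Unit => tapeStep r fun s l =>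
    if s = .ofBool b then
      if l then ((some (.ofBool !b), .stay), .inr true) else ((some (.ofBool !b), .left), .inl ())
    else ((some (.ofBool b), .stay), .inr false)) ()

/-- This is the carry of an increment for `b = true` and the borrow of a decrement for `b = false`.
The word `v` collects the part already flipped. -/
theorem onTape_flip {r : R} {b : Bool} {u v : List Bool} {k : ℕ} (hK : u.length + k ≤ K) :
    OnTape ora K (flip r b) r ⟨wordCells (u ++ (!b) :: (List.replicate k b ++ v)), u.length + k⟩
      false ⟨wordCells (u ++ b :: (List.replicate k (!b) ++ v)), u.length⟩ := by
  induction k generalizing v with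
  | zero =>
    refine OnTape.iterate_done (onTape_tapeStep (a := (some (.ofBool b), .stay)) ?_
      (by simp) (by simp [update_wordCells]) (by simp; omega))
    rw [if_neg]
    simp [SemiTape.read, TapeSymbol.ofBool_inj]
  | succ k ih =>
    have e1 : u ++ (!b) :: (List.replicate (k + 1) b ++ v) =
        (u ++ (!b) :: List.replicate k b) ++ b :: v := by simp [List.replicate_succ']
    have e2 : u ++ b :: (List.replicate (k + 1) (!b) ++ v) =
        u ++ b :: (List.replicate k (!b) ++ ((!b) :: v)) := by simp [List.replicate_succ']
    have e3 : u.length + (k + 1) = (u ++ (!b) :: List.replicate k b).length := by simp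
    rw [e2]
    refine OnTape.iterate_next (onTape_tapeStep (a := (some (.ofBool !b), .left)) ?_ ?_ ?_ ?_)
      (ih (v := (!b) :: v) (by omega))
    · rw [e1, e3, if_pos (by simp only [SemiTape.read, wordCells_append_cons])]
      simp
    · simp
    · simp only [SemiTape.act_some_left]
      rw [e1, e3, update_wordCells]
      simp
    · simp; omega

/-- No opposite bit stops the carry, which runs into the left end; the value `true` reports the
overflow. -/
theorem onTape_flip_all {r : R} {b : Bool} {v : List Bool} {k : ℕ} (hK : k ≤ K) :
    OnTape ora K (flip r b) r ⟨wordCells (List.replicate (k + 1) b ++ v), k⟩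
      true ⟨wordCells (List.replicate (k + 1) (!b) ++ v), 0⟩ := by
  induction k generalizing v with
  | zero =>
    refine OnTape.iterate_done (onTape_tapeStep (a := (some (.ofBool !b), .stay)) ?_
      (by simp) ?_ (by simp))
    · simpa [SemiTape.read] using wordCells_append_cons [] v b
    · simpa using update_wordCells [] v b (!b)
  | succ k ih =>
    have e1 : List.replicate (k + 1 + 1) b ++ v = List.replicate (k + 1) b ++ b :: v := by
      rw [List.replicate_succ']; simp
    have e2 : List.replicate (k + 1 + 1) (!b) ++ v =
        List.replicate (k + 1) (!b) ++ (!b) :: v := by rw [List.replicate_succ']; simp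
    have e3 : k + 1 = (List.replicate (k + 1) b).length := by simp
    rw [e2]
    refine OnTape.iterate_next (onTape_tapeStep (a := (some (.ofBool !b), .left)) ?_ ?_ ?_ ?_)
      (ih (v := (!b) :: v) (by omega))
    · rw [e1]
      have := wordCells_append_cons (List.replicate (k + 1) b) v b
      rw [← e3] at this
      simp [SemiTape.read, this]
    · simp
    · rw [e1]
      have := update_wordCells (List.replicate (k + 1) b) v b (!b)
      rw [← e3] at this
      simp [this]
    · simp; omega

/-- Write a symbol. -/
def put (r : R) (a : TapeSymbol) : Ctrl R H O Unit :=
  tapeStep r fun _ _ => ((some a, .stay), ())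

theorem onTape_put {r : R} {a : TapeSymbol} {T : SemiTape} (h : T.head ≤ K) :
    OnTape ora K (put r a) r T () ⟨Function.update T.cells T.head a, T.head⟩ :=
  onTape_tapeStep (a := (some a, .stay)) rfl (by simp) (by simp) h

/-- Move the head to the left. -/
def goLeft (r : R) : Ctrl R H O Unit :=
  tapeStep r fun _ _ => ((none, .left), ())

theorem onTape_goLeft {r : R} {c : ℕ → TapeSymbol} {h : ℕ} (hK : h ≤ K) :
    OnTape ora K (goLeft r) r ⟨c, h + 1⟩ () ⟨c, h⟩ :=
  onTape_tapeStep (a := (none, .left)) rfl (by simp) (by simp) hK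

/-- Add `1` to the binary word on a tape. -/
def inc (r : R) : Ctrl R H O Unit :=
  (seekBlank r).bind fun _ => (goLeft r).bind fun _ => (flip r true).bind fun b =>
    if b then (put r .one).bind fun _ => (seekBlank r).bind fun _ => (put r .zero).bind fun _ =>
      rewind r
    else rewind r

/-- The word `w'` arises from `w` by adding `1`. -/
def IncWord (w w' : List Bool) : Prop :=
  wordVal w' = wordVal w + 1 ∧
    w'.length = if wordVal w + 1 = 2 ^ w.length then w.length + 1 else w.length

/-- If some digit is `0`, the carry stops there and the length is kept. If all digits are `1`,
flipping leaves only zeros; the first one is replaced by `1` and a further `0` is appended. In that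
case the bound on the value gives `2 ^ w.length < 2 ^ K`, which leaves room for the new digit. -/
theorem exists_onTape_inc {r : R} {w : List Bool} (hw : w ≠ []) (hl : w.length ≤ K)
    (hK : wordVal w + 1 < 2 ^ K) : ∃ w', IncWord w w' ∧ w'.length ≤ K ∧
      OnTape ora K (inc r) r (.ofWord w) () (.ofWord w') := by
  have hseek := onTape_seekBlank (ora := ora) (r := r) (Nat.zero_le w.length) hl
  have hgo : OnTape ora K (goLeft r) r ⟨wordCells w, w.length⟩ () ⟨wordCells w, w.length - 1⟩ := by
    have := onTape_goLeft (ora := ora) (r := r) (c := wordCells w) (h := w.length - 1)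
      (K := K) (by omega)
    rwa [Nat.sub_add_cancel (List.length_pos_iff.2 hw)] at this
  rcases eq_replicate_or_exists_last true w with h | ⟨u, k, h⟩
  · obtain ⟨k, hk⟩ : ∃ k, w.length = k + 1 :=
      Nat.exists_eq_succ_of_ne_zero (by simpa using hw)
    rw [hk] at h
    have hval : wordVal w + 1 = 2 ^ (k + 1) := by rw [h]; exact wordVal_replicate_true _
    have hkK : k + 1 < K := by
      rw [hval] at hK
      exact (Nat.pow_lt_pow_iff_right (by norm_num)).1 hK
    refine ⟨true :: List.replicate (k + 1) false, ⟨?_, ?_⟩, by simpa using hkK, ?_⟩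
    · rw [hval, wordVal_cons]; simp
    · rw [hk, if_pos hval]; simp
    · refine hseek.bind (hgo.bind ?_)
      have hf := onTape_flip_all (ora := ora) (r := r) (b := true) (v := []) (k := k) (K := K)
        (by omega)
      simp only [List.append_nil, ← h, Bool.not_true] at hf
      rw [hk, Nat.add_sub_cancel]
      refine hf.bind ?_
      rw [if_pos rfl]
      have e : Function.update (wordCells (List.replicate (k + 1) false)) 0 .one =
          wordCells (true :: List.replicate k false) := by
        simpa [List.replicate_succ, TapeSymbol.ofBool] using
          update_wordCells [] (List.replicate k false) false true
      refine (onTape_put (by simp)).bind ?_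
      simp only [e]
      refine (onTape_seekBlank (by simp) (by simp; omega)).bind
        ((onTape_put (by simp; omega)).bind ?_)
      have e2 := update_wordCells_length (true :: List.replicate k false) false
      simp only [TapeSymbol.ofBool] at e2
      simp only [e2]
      have := onTape_rewind (ora := ora) (r := r) (K := K)
        (c := wordCells (true :: List.replicate (k + 1) false))
        (h := (true :: List.replicate k false).length) (by simp; omega)
      rw [List.replicate_succ'] at this ⊢
      exact this
  · subst h
    have h2 := wordVal_replicate_true k
    have hval : wordVal (u ++ true :: List.replicate k false) =
        wordVal (u ++ (!true) :: List.replicate k true) + 1 := by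
      rw [wordVal_append, wordVal_append, wordVal_cons, wordVal_cons]
      simp
      omega
    have hlen : (u ++ true :: List.replicate k false).length =
      (u ++ (!true) :: List.replicate k true).length := by simp
    refine ⟨u ++ true :: List.replicate k false, ⟨hval, ?_⟩, hlen.trans_le hl, ?_⟩
    · rw [if_neg, hlen]
      rw [← hval, ← hlen]
      exact (wordVal_lt _).ne
    · refine hseek.bind (hgo.bind ?_)
      have hf := onTape_flip (ora := ora) (r := r) (b := true) (u := u) (v := []) (k := k) (K := K)
        (by simp at hl; omega)
      simp only [List.append_nil] at hf
      have e : (u ++ (!true) :: List.replicate k true).length - 1 = u.length + k := by simp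
      rw [e]
      refine hf.bind ?_
      simp only [Bool.false_eq_true, if_false]
      exact onTape_rewind (by simp at hl; omega)

/-- Subtract `1` from the nonzero binary word on a tape. -/
def dec (r : R) : Ctrl R H O Unit :=
  (seekBlank r).bind fun _ => (goLeft r).bind fun _ => (flip r false).bind fun _ => rewind r

/-- A nonzero word contains a `1`, at which the borrow stops. The length is kept, so leading zeros
may arise. -/
theorem exists_onTape_dec {r : R} {w : List Bool} (hl : w.length ≤ K) (h0 : wordVal w ≠ 0) :
    ∃ w', wordVal w' + 1 = wordVal w ∧ w'.length = w.length ∧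
      OnTape ora K (dec r) r (.ofWord w) () (.ofWord w') := by
  rcases eq_replicate_or_exists_last false w with h | ⟨u, k, h⟩
  · exact absurd ((exists_wordVal_eq_zero_iff w).2 h) h0
  · subst h
    have h2 := wordVal_replicate_true k
    have hval : wordVal (u ++ (!false) :: List.replicate k false) =
        wordVal (u ++ false :: List.replicate k true) + 1 := by
      rw [wordVal_append, wordVal_append, wordVal_cons, wordVal_cons]
      simp
      omega
    refine ⟨u ++ false :: List.replicate k true, hval.symm, by simp, ?_⟩
    have hl' : u.length + k + 1 ≤ K := by simp at hl; omega
    have hseek := onTape_seekBlank (ora := ora) (r := r)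
      (Nat.zero_le (u ++ (!false) :: List.replicate k false).length) hl
    have e : (u ++ (!false) :: List.replicate k false).length = u.length + k + 1 := by
      simp; omega
    rw [e] at hseek
    refine hseek.bind ((onTape_goLeft (by omega)).bind ?_)
    have hf := onTape_flip (ora := ora) (r := r) (b := false) (u := u) (v := []) (k := k) (K := K)
      (by omega)
    simp only [List.append_nil] at hf
    exact hf.bind (onTape_rewind (by omega))

/-- Whether the binary word on a tape represents `0`. -/
def isZero (r : R) : Ctrl R H O Bool :=
  (iterate (fun _ : Unit => tapeStep r fun s _ =>
    if s = .zero then ((none, .right), .inl ())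
    else ((none, .stay), .inr (decide (s = .blank)))) ()).bind fun b =>
  (rewind r).bind fun _ => tapeStep r fun _ _ => ((none, .stay), b)

theorem onTape_isZero {r : R} {w : List Bool} (hl : w.length ≤ K) :
    OnTape ora K (isZero r) r (.ofWord w) (decide (wordVal w = 0)) (.ofWord w) := by
  -- `u` is the part already scanned, consisting of zeros only, and `v` is the rest.
  have key : ∀ u v : List Bool, w = u ++ v → wordVal u = 0 → ∃ h ≤ K,
      OnTape ora K (iterate (fun _ : Unit => tapeStep r fun s _ =>
        if s = .zero then ((none, .right), .inl ())
        else ((none, .stay), .inr (decide (s = .blank)))) ()) r ⟨wordCells w, u.length⟩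
        (decide (wordVal w = 0)) ⟨wordCells w, h⟩ := by
    intro u v
    induction v generalizing u with
    | nil =>
      intro hw hu
      rw [List.append_nil] at hw
      subst hw
      exact ⟨w.length, hl, OnTape.iterate_done (onTape_tapeStep (a := (none, .stay))
        (by simp [SemiTape.read, hu]) (by simp) (by simp) hl)⟩
    | cons b v ih =>
      intro hw hu
      have hlen : u.length + 1 ≤ K := by
        rw [hw] at hl; simp at hl; omega
      cases b with
      | false =>
        obtain ⟨h, hh, hO⟩ := ih (u ++ [false]) (by simp [hw])
          (by rw [wordVal_append_singleton, hu]; rfl)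
        refine ⟨h, hh, OnTape.iterate_next (s' := ()) (T' := ⟨wordCells w, u.length + 1⟩)
          (onTape_tapeStep (a := (none, .right)) ?_ (by simp)
          (by simp) ?_) (by simpa using hO)⟩
        · simp [SemiTape.read, hw, TapeSymbol.ofBool]
        · simpa using hlen
      | true =>
        have hne : wordVal w ≠ 0 := by
          rw [hw, wordVal_append, wordVal_cons]
          simp
        refine ⟨u.length, by omega, OnTape.iterate_done (onTape_tapeStep (a := (none, .stay)) ?_
          (by simp) (by simp) (by simp; omega))⟩
        have : wordCells w u.length = .one := by rw [hw]; simp [TapeSymbol.ofBool]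
        simp [SemiTape.read, hne, this]
  obtain ⟨h, hh, hO⟩ := key [] w rfl rfl
  exact hO.bind ((onTape_rewind hh).bind
    (onTape_tapeStep (a := (none, .stay)) rfl (by simp) (by simp [SemiTape.ofWord])
      (by simp [SemiTape.ofWord])))

/-- Make a tape that holds a word blank. -/
def erase (r : R) : Ctrl R H O Unit :=
  (seekBlank r).bind fun _ => iterate (fun _ : Unit => tapeStep r fun _ l =>
    if l then ((some .blank, .stay), .inr ()) else ((some .blank, .left), .inl ())) ()

theorem onTape_erase {r : R} {w : List Bool} (hl : w.length ≤ K) :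
    OnTape ora K (erase r) r (.ofWord w) () (.ofWord []) := by
  refine (onTape_seekBlank (Nat.zero_le _) hl).bind ?_
  have e : wordCells w = Function.update (wordCells w) w.length .blank := by
    rw [← wordCells_length w, Function.update_eq_self]
  -- The invariant describes the tape up to the scanned cell, which is still to be blanked. Blanking
  -- it and moving left gives the same situation for the word without its last letter.
  have key : ∀ c : ℕ → TapeSymbol, Function.update c w.length .blank = wordCells w →
    OnTape ora K (iterate (fun _ : Unit => tapeStep r fun _ l =>
      if l then ((some .blank, .stay), .inr ()) else ((some .blank, .left), .inl ())) ()) r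
      ⟨c, w.length⟩ () (.ofWord []) := by
    clear e
    induction w using List.reverseRecOn with
    | nil =>
      intro c hc
      exact OnTape.iterate_done (onTape_tapeStep (a := (some .blank, .stay)) (by simp) (by simp)
        (by simpa [SemiTape.ofWord] using hc) (by simp [SemiTape.ofWord]))
    | append_singleton u b ih =>
      intro c hc
      have hl' : u.length + 1 ≤ K := by simpa using hl
      refine OnTape.iterate_next (s' := ()) (onTape_tapeStep (a := (some .blank, .left)) (by simp)
        (by simp)
        rfl (by simp; omega)) ?_
      simp only [SemiTape.act_some_left, hc]
      have := ih (by omega) (wordCells (u ++ [b])) (update_wordCells_last u b)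
      simpa using this
  exact key _ e.symm

end Ctrl

end

section

variable {R H O E F S X V : Type}

/-! ### Controls that use two tapes -/

section TwoTapes

variable [DecidableEq R]

namespace TapeAction

/-- The action on two tapes. -/
def onTapes (r s : R) (a b : Option TapeSymbol × HeadMove) : TapeAction R H :=
  ⟨Function.update (Function.update (fun _ => (none, .stay)) r a) s b, fun _ => .stay⟩

theorem act_onTapes (m : TapeMem R H) {r s : R} (hrs : r ≠ s)
    (a b : Option TapeSymbol × HeadMove) :
    m.act (onTapes r s a b) =
      (m.setTape r ((m.tape r).act a)).setTape s ((m.tape s).act b) := by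
  simp only [TapeMem.act, onTapes, TapeMem.setTape, HeadMove.app]
  congr 1
  funext r'
  by_cases h : r' = s
  · subst h; simp
  · by_cases h' : r' = r
    · subst h'; simp [hrs]
    · simp [h, h']

theorem allowed_onTapes {m : TapeMem R H} {r s : R} (hrs : r ≠ s)
    {a b : Option TapeSymbol × HeadMove}
    (h : a.2 = .left → (m.tape r).head ≠ 0) (h' : b.2 = .left → (m.tape s).head ≠ 0) :
    m.Allowed (onTapes r s a b) := by
  refine ⟨fun r' => ?_, by simp [onTapes]⟩
  by_cases hr : r' = s
  · subst hr; simpa [onTapes] using h'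
  · by_cases hr' : r' = r
    · subst hr'; simpa [onTapes, hrs] using h
    · simp [onTapes, hr, hr']

end TapeAction

namespace Ctrl

variable {ora : (R → ℕ) → (H → ℕ) → O} {K : ℕ}

/-- The control changes the tapes `r` and `s` only. -/
def OnTapes (ora : (R → ℕ) → (H → ℕ) → O) (K : ℕ) (P : Ctrl R H O E) (r s : R) (T U : SemiTape)
    (e : E) (T' U' : SemiTape) : Prop :=
  T'.head ≤ K ∧ U'.head ≤ K ∧ ∀ m : TapeMem R H, m.InSpace K → m.tape r = T → m.tape s = U →
    P.Runs ora K m e ((m.setTape r T').setTape s U')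

theorem TapeMem.setTape_twice (m : TapeMem R H) {r s : R} (hrs : r ≠ s) (T T' U U' : SemiTape) :
    (((m.setTape r T).setTape s U).setTape r T').setTape s U' =
      (m.setTape r T').setTape s U' := by
  rw [TapeMem.setTape_comm _ hrs, TapeMem.setTape_setTape, TapeMem.setTape_comm _ hrs.symm,
    TapeMem.setTape_setTape]

theorem OnTapes.continue {P : Ctrl R H O E} {r s : R} (hrs : r ≠ s) {T' U' T'' U'' : SemiTape}
    {e : E} (h : OnTapes ora K P r s T' U' e T'' U'') (hT : T'.head ≤ K) (hU : U'.head ≤ K)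
    {m : TapeMem R H} (hm : m.InSpace K) :
    P.Runs ora K ((m.setTape r T').setTape s U') e ((m.setTape r T'').setTape s U'') := by
  rw [← TapeMem.setTape_twice m hrs T' T'' U' U'']
  exact h.2.2 _ ((hm.setTape hT).setTape hU)
    (by rw [TapeMem.tape_setTape_of_ne _ hrs, TapeMem.tape_setTape]) (by simp)

theorem OnTapes.bind [Finite E] {P : Ctrl R H O E} {G : E → Ctrl R H O F} {r s : R} (hrs : r ≠ s)
    {T U T' U' T'' U'' : SemiTape} {e : E} {f : F} (h : OnTapes ora K P r s T U e T' U')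
    (h' : OnTapes ora K (G e) r s T' U' f T'' U'') :
    OnTapes ora K (P.bind G) r s T U f T'' U'' :=
  ⟨h'.1, h'.2.1, fun m hm hT hU => (h.2.2 m hm hT hU).bind
    (h'.continue hrs h.1 h.2.1 hm)⟩

theorem OnTapes.iterate_done [Finite S] {B : S → Ctrl R H O (S ⊕ E)} {x : S} {r s : R}
    {T U T' U' : SemiTape} {e : E} (h : OnTapes ora K (B x) r s T U (.inr e) T' U') :
    OnTapes ora K (iterate B x) r s T U e T' U' :=
  ⟨h.1, h.2.1, fun m hm hT hU => (h.2.2 m hm hT hU).iterate_done⟩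

theorem OnTapes.iterate_next [Finite S] {B : S → Ctrl R H O (S ⊕ E)} {x x' : S} {r s : R}
    (hrs : r ≠ s) {T U T' U' T'' U'' : SemiTape} {e : E}
    (h : OnTapes ora K (B x) r s T U (.inl x') T' U')
    (h' : OnTapes ora K (iterate B x') r s T' U' e T'' U'') :
    OnTapes ora K (iterate B x) r s T U e T'' U'' :=
  ⟨h'.1, h'.2.1, fun m hm hT hU => (h.2.2 m hm hT hU).iterate_next
    (h'.continue hrs h.1 h.2.1 hm)⟩

theorem OnTape.onTapes_right {P : Ctrl R H O E} {r s : R} {T U U' : SemiTape} {e : E}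
    (h : OnTape ora K P s U e U') (hT : T.head ≤ K) : OnTapes ora K P r s T U e T U' :=
  ⟨hT, h.1, fun m hm hmT hmU => by
    rw [TapeMem.setTape_eq_self m hmT]
    exact h.2 m hm hmU⟩

/-- One step on two tapes. -/
def tapesStep (r s : R) (f : TapeSymbol → Bool → TapeSymbol → Bool →
    (Option TapeSymbol × HeadMove) × (Option TapeSymbol × HeadMove) × E) : Ctrl R H O E :=
  prim fun o =>
    let y := f (o.sym r) (o.atLeft r) (o.sym s) (o.atLeft s)
    (TapeAction.onTapes r s y.1 y.2.1, y.2.2)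

theorem onTapes_tapesStep {r s : R} (hrs : r ≠ s)
    {f : TapeSymbol → Bool → TapeSymbol → Bool →
      (Option TapeSymbol × HeadMove) × (Option TapeSymbol × HeadMove) × E}
    {T T' U U' : SemiTape} {a b : Option TapeSymbol × HeadMove} {e : E}
    (hf : f T.read (T.head == 0) U.read (U.head == 0) = (a, b, e))
    (ha : a.2 = .left → T.head ≠ 0) (hb : b.2 = .left → U.head ≠ 0)
    (hT' : T.act a = T') (hU' : U.act b = U') (hK : T'.head ≤ K) (hK' : U'.head ≤ K) :
    OnTapes ora K (tapesStep r s f) r s T U e T' U' := by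
  refine ⟨hK, hK', fun m hm hT hU => ?_⟩
  rw [← hT', ← hU', ← hT, ← hU, ← TapeAction.act_onTapes m hrs]
  refine Runs.prim hm ?_ (TapeAction.allowed_onTapes hrs (by rwa [hT]) (by rwa [hU]))
  simp only [TapeMem.obs, hT, hU, hf]

/-- Copy the word between the leftmost cell and the first blank of the tape `r`, the head of which
is on the leftmost cell, to the tape `s`, which holds a word. -/
def copyWord (r s : R) : Ctrl R H O Unit :=
  (erase s).bind fun _ =>
  (iterate (fun _ : Unit => tapesStep r s fun a _ _ _ =>
    if a = .blank then ((none, .stay), (none, .stay), .inr ())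
    else ((none, .right), (some a, .right), .inl ())) ()).bind fun _ =>
  (tapeStep s fun _ l => (if l then (some .zero, .stay) else (none, .stay), ())).bind fun _ =>
  iterate (fun _ : Unit => tapesStep r s fun _ _ _ l =>
    if l then ((none, .stay), (none, .stay), .inr ())
    else ((none, .left), (none, .left), .inl ())) ()

/-- The source may hold anything beyond its first blank. If its word is empty, the head on `s` has
not left the left end after copying, and a single `0` is written: counters are nonempty words. Both
heads then return in parallel until `s` shows its left end. -/
theorem exists_onTapes_copyWord {r s : R} (hrs : r ≠ s) {c : ℕ → TapeSymbol} {w : List Bool}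
    {k : ℕ} (hk : c k = .blank) (hkK : k ≤ K) (hK : 0 < K) (hw : w.length ≤ K) :
    ∃ u, u ≠ [] ∧ u.length ≤ K ∧ wordVal u = (⟨c, 0⟩ : SemiTape).number ∧
      OnTapes ora K (copyWord r s) r s ⟨c, 0⟩ (.ofWord w) () ⟨c, 0⟩ (.ofWord u) := by
  set T : SemiTape := ⟨c, 0⟩
  set v := T.word with hv
  have hvc : c v.length = .blank := T.cells_word_length hk
  have hvK : v.length ≤ K := (T.word_length_le hk).trans hkK
  -- `x` has been copied and `y` remains.
  have hcopy : ∀ y x : List Bool, v = x ++ y →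
      OnTapes ora K (iterate (fun _ : Unit => tapesStep r s fun a _ _ _ =>
        if a = .blank then ((none, .stay), (none, .stay), .inr ())
        else ((none, .right), (some a, .right), .inl ())) ()) r s
        ⟨c, x.length⟩ ⟨wordCells x, x.length⟩ () ⟨c, v.length⟩ ⟨wordCells v, v.length⟩ := by
    intro y
    induction y with
    | nil =>
      intro x hx
      rw [List.append_nil] at hx
      rw [← hx]
      refine OnTapes.iterate_done (onTapes_tapesStep hrs (a := (none, .stay)) (b := (none, .stay))
        ?_ (by simp) (by simp) (by simp) (by simp) hvK hvK)
      rw [if_pos (by exact hvc)]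
    | cons b y ih =>
      intro x hx
      have hxv : x.length < v.length := by rw [hx]; simp
      have hcx : c x.length = .ofBool b := by
        have := SemiTape.wordCells_word (T := T) hxv
        rw [← hv, hx, wordCells_append_cons] at this
        exact this.symm
      refine OnTapes.iterate_next hrs (x' := ()) (onTapes_tapesStep hrs (a := (none, .right))
        (b := (some (.ofBool b), .right)) ?_ (by simp) (by simp) rfl rfl (by simp; omega)
        (by simp; omega)) ?_
      · rw [if_neg (by simp only [SemiTape.read, hcx]; exact TapeSymbol.ofBool_ne_blank b)]
        simp [SemiTape.read, hcx]
      · have := ih (x ++ [b]) (by simp [hx])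
        simpa [update_wordCells_length] using this
  have hback : ∀ (d : ℕ → TapeSymbol) (h : ℕ), h ≤ K →
      OnTapes ora K (iterate (fun _ : Unit => tapesStep r s fun _ _ _ l =>
        if l then ((none, .stay), (none, .stay), .inr ())
        else ((none, .left), (none, .left), .inl ())) ()) r s
        ⟨c, h⟩ ⟨d, h⟩ () ⟨c, 0⟩ ⟨d, 0⟩ := by
    intro d h
    induction h with
    | zero =>
      intro _
      exact OnTapes.iterate_done (onTapes_tapesStep hrs (a := (none, .stay)) (b := (none, .stay))
        (by simp) (by simp) (by simp) (by simp) (by simp) (by simp) (by simp))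
    | succ h ih =>
      intro hh
      exact OnTapes.iterate_next hrs (x' := ()) (onTapes_tapesStep hrs (a := (none, .left))
        (b := (none, .left)) (by simp) (by simp) (by simp) rfl rfl (by simp; omega)
        (by simp; omega)) (by simpa using ih (by omega))
  have hstart := (onTape_erase (ora := ora) (r := s) hw).onTapes_right (r := r)
    (T := T) (Nat.zero_le _)
  by_cases hv0 : v = []
  · refine ⟨[false], by simp, by simpa using Nat.succ_le_of_lt hK, ?_, ?_⟩
    · rw [SemiTape.number_eq_wordVal, ← hv, hv0]; rfl
    · refine hstart.bind hrs ((hcopy v [] rfl).bind hrs ?_)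
      simp only [hv0, List.length_nil]
      refine OnTapes.bind hrs (e := ()) (T' := ⟨c, 0⟩) (U' := ⟨wordCells [false], 0⟩) ?_
        (hback _ 0 (by simp))
      refine (onTape_tapeStep (a := (some .zero, .stay)) (by simp) (by simp) ?_
        (by simp)).onTapes_right (by simp)
      simpa [TapeSymbol.ofBool] using update_wordCells_length [] false
  · refine ⟨v, hv0, hvK, (T.number_eq_wordVal).symm, ?_⟩
    refine hstart.bind hrs ((hcopy v [] rfl).bind hrs ?_)
    refine OnTapes.bind hrs (e := ()) (T' := ⟨c, v.length⟩) (U' := ⟨wordCells v, v.length⟩) ?_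
      (hback _ _ hvK)
    exact (onTape_tapeStep (a := (none, .stay)) (by simp [hv0]) (by simp) (by simp)
      hvK).onTapes_right hvK

end Ctrl

end TwoTapes

/-! ### Memories with counters -/

/-- A memory of tapes, further heads, and counters. -/
structure CounterMem (X V H : Type) where
  raw : TapeMem X H
  cnt : V → ℕ

/-- The tape holds the number `x` in binary, with at most `K` digits. -/
def IsCounter (K : ℕ) (T : SemiTape) (x : ℕ) : Prop :=
  ∃ w, w ≠ [] ∧ w.length ≤ K ∧ wordVal w = x ∧ T = .ofWord w

namespace CounterMem

/-- The memory `m` represents the memory with counters `a`. -/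
structure Rep (K : ℕ) (m : TapeMem (X ⊕ V) H) (a : CounterMem X V H) : Prop where
  raw : (⟨fun x => m.tape (.inl x), m.pos⟩ : TapeMem X H) = a.raw
  space : a.raw.InSpace K
  cnt : ∀ v, IsCounter K (m.tape (.inr v)) (a.cnt v)

variable {K : ℕ} {m : TapeMem (X ⊕ V) H} {a : CounterMem X V H}

theorem Rep.cnt_lt (h : Rep K m a) (v : V) : a.cnt v < 2 ^ K := by
  obtain ⟨w, -, hK, hw, -⟩ := h.cnt v
  exact hw ▸ (wordVal_lt w).trans_le (Nat.pow_le_pow_right (by norm_num) hK)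

theorem Rep.tape (h : Rep K m a) (x : X) : m.tape (.inl x) = a.raw.tape x := by
  rw [← h.raw]

theorem Rep.pos (h : Rep K m a) : m.pos = a.raw.pos := by
  rw [← h.raw]

theorem Rep.inSpace (h : Rep K m a) : m.InSpace K := by
  refine ⟨?_, fun p => by rw [h.pos]; exact h.space.2 p⟩
  rintro (x | v)
  · rw [h.tape]; exact h.space.1 x
  · obtain ⟨w, -, -, -, hT⟩ := h.cnt v
    rw [hT]; exact Nat.zero_le _

/-- The numbers on all tapes. -/
noncomputable def num (a : CounterMem X V H) : X ⊕ V → ℕ :=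
  Sum.elim (fun x => (a.raw.tape x).number) a.cnt

theorem Rep.num (h : Rep K m a) : (fun r => (m.tape r).number) = a.num := by
  funext r
  rcases r with x | v
  · rw [h.tape]; rfl
  · obtain ⟨w, -, -, hw, hT⟩ := h.cnt v
    rw [hT, SemiTape.number_ofWord, hw]; rfl

variable [DecidableEq X] [DecidableEq V]

def setCnt (a : CounterMem X V H) (v : V) (x : ℕ) : CounterMem X V H :=
  ⟨a.raw, Function.update a.cnt v x⟩

def setRaw (a : CounterMem X V H) (x : X) (T : SemiTape) : CounterMem X V H :=
  ⟨a.raw.setTape x T, a.cnt⟩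

@[simp] theorem cnt_setCnt (a : CounterMem X V H) (v : V) (x : ℕ) : (a.setCnt v x).cnt v = x := by
  simp [setCnt]

theorem cnt_setCnt_of_ne (a : CounterMem X V H) {v v' : V} (h : v' ≠ v) (x : ℕ) :
    (a.setCnt v x).cnt v' = a.cnt v' := by
  simp [setCnt, h]

@[simp] theorem raw_setCnt (a : CounterMem X V H) (v : V) (x : ℕ) : (a.setCnt v x).raw = a.raw :=
  rfl

@[simp] theorem cnt_setRaw (a : CounterMem X V H) (x : X) (T : SemiTape) :
    (a.setRaw x T).cnt = a.cnt := rfl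

@[simp] theorem raw_setRaw (a : CounterMem X V H) (x : X) (T : SemiTape) :
    (a.setRaw x T).raw = a.raw.setTape x T := rfl

@[simp] theorem setCnt_setCnt (a : CounterMem X V H) (v : V) (x y : ℕ) :
    (a.setCnt v x).setCnt v y = a.setCnt v y := by
  simp [setCnt]

@[simp] theorem setCnt_self (a : CounterMem X V H) (v : V) : a.setCnt v (a.cnt v) = a := by
  simp [setCnt]

theorem setCnt_eq_self (a : CounterMem X V H) {v : V} {x : ℕ} (h : a.cnt v = x) :
    a.setCnt v x = a := by
  subst h; simp

theorem setCnt_comm (a : CounterMem X V H) {v v' : V} (h : v ≠ v') (x y : ℕ) :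
    (a.setCnt v x).setCnt v' y = (a.setCnt v' y).setCnt v x := by
  simp [setCnt, Function.update_comm h]

theorem Rep.setCnt (h : Rep K m a) {v : V} {x : ℕ} {T : SemiTape} (hT : IsCounter K T x) :
    Rep K (m.setTape (.inr v) T) (a.setCnt v x) := by
  refine ⟨?_, h.space, fun v' => ?_⟩
  · rw [raw_setCnt, ← h.raw]
    simp [TapeMem.setTape]
  · by_cases hv : v' = v
    · subst hv; simpa using hT
    · rw [TapeMem.tape_setTape_of_ne _ (by simpa using hv), cnt_setCnt_of_ne _ hv]
      exact h.cnt v'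

theorem Rep.setRaw (h : Rep K m a) {x : X} {T : SemiTape} (hT : T.head ≤ K) :
    Rep K (m.setTape (.inl x) T) (a.setRaw x T) := by
  refine ⟨?_, h.space.setTape hT, fun v => ?_⟩
  · rw [raw_setRaw, ← h.raw]
    simp only [TapeMem.setTape]
    congr 1
    funext x'
    by_cases hx : x' = x
    · subst hx; simp
    · simp [hx]
  · rw [TapeMem.tape_setTape_of_ne _ (by simp)]
    exact h.cnt v

end CounterMem

/-! ### Specifications of controls by their effect on counters. -/

namespace Ctrl

variable {ora : (X ⊕ V → ℕ) → (H → ℕ) → O} {K : ℕ}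

/-- On every memory that represents `a`, the control exits with the value `e` and a memory that
represents `a'`. -/
def Spec (ora : (X ⊕ V → ℕ) → (H → ℕ) → O) (K : ℕ) (P : Ctrl (X ⊕ V) H O E) (a : CounterMem X V H)
    (e : E) (a' : CounterMem X V H) : Prop :=
  ∀ m, CounterMem.Rep K m a → ∃ m', P.Runs ora K m e m' ∧ CounterMem.Rep K m' a'

theorem Spec.bind [Finite E] {P : Ctrl (X ⊕ V) H O E} {G : E → Ctrl (X ⊕ V) H O F} {e : E} {f : F}
    {a a' a'' : CounterMem X V H} (h : Spec ora K P a e a') (h' : Spec ora K (G e) a' f a'') :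
    Spec ora K (P.bind G) a f a'' := by
  intro m hm
  obtain ⟨m', h1, hm'⟩ := h m hm
  obtain ⟨m'', h2, hm''⟩ := h' m' hm'
  exact ⟨m'', h1.bind h2, hm''⟩

theorem Spec.iterate_done [Finite S] {B : S → Ctrl (X ⊕ V) H O (S ⊕ E)} {s : S}
    {a a' : CounterMem X V H} {e : E} (h : Spec ora K (B s) a (.inr e) a') :
    Spec ora K (iterate B s) a e a' := by
  intro m hm
  obtain ⟨m', h1, hm'⟩ := h m hm
  exact ⟨m', h1.iterate_done, hm'⟩

theorem Spec.iterate_next [Finite S] {B : S → Ctrl (X ⊕ V) H O (S ⊕ E)} {s s' : S}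
    {a a' a'' : CounterMem X V H} {e : E} (h : Spec ora K (B s) a (.inl s') a')
    (h' : Spec ora K (iterate B s') a' e a'') : Spec ora K (iterate B s) a e a'' := by
  intro m hm
  obtain ⟨m', h1, hm'⟩ := h m hm
  obtain ⟨m'', h2, hm''⟩ := h' m' hm'
  exact ⟨m'', h1.iterate_next h2, hm''⟩

/-- The existence of a representing memory already bounds counters and heads, so these bounds may be
assumed when a specification is proved. -/
theorem Spec.of_cnt_lt {P : Ctrl (X ⊕ V) H O E} {a a' : CounterMem X V H} {e : E}
    (h : (∀ v, a.cnt v < 2 ^ K) → a.raw.InSpace K → Spec ora K P a e a') : Spec ora K P a e a' :=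
  fun m hm => h hm.cnt_lt hm.space m hm

/-- One step that does not touch the counters. -/
def rawStep (f : TapeObs X H O → TapeAction X H × E) : Ctrl (X ⊕ V) H O E :=
  prim fun o =>
    let y := f ⟨fun x => o.sym (.inl x), fun x => o.atLeft (.inl x), o.posZero, o.ans⟩
    (⟨Sum.elim y.1.tape fun _ => (none, .stay), y.1.pos⟩, y.2)

/-- What is observed of the part without the counters. -/
noncomputable def rawObs (ora : (X ⊕ V → ℕ) → (H → ℕ) → O) (a : CounterMem X V H) :
    TapeObs X H O where
  sym x := (a.raw.tape x).read
  atLeft x := (a.raw.tape x).head == 0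
  posZero h := a.raw.pos h == 0
  ans := ora a.num a.raw.pos

/-- Such a step does not look at the counter tapes directly, but the oracle may depend on the
numbers they hold, through `CounterMem.num`. -/
theorem spec_rawStep {f : TapeObs X H O → TapeAction X H × E} {a : CounterMem X V H}
    {act : TapeAction X H} {e : E} (hf : f (rawObs ora a) = (act, e)) (ha : a.raw.Allowed act)
    (hK : (a.raw.act act).InSpace K) :
    Spec ora K (rawStep f) a e ⟨a.raw.act act, a.cnt⟩ := by
  intro m hm
  refine ⟨m.act ⟨Sum.elim act.tape fun _ => (none, .stay), act.pos⟩,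
    Runs.prim hm.inSpace ?_ ?_, ?_, hK, fun v => ?_⟩
  · have : (⟨fun x => (m.obs ora).sym (.inl x), fun x => (m.obs ora).atLeft (.inl x),
        (m.obs ora).posZero, (m.obs ora).ans⟩ : TapeObs X H O) = rawObs ora a := by
      simp only [TapeMem.obs, rawObs, hm.tape, hm.num, hm.pos]
    simp only [this, hf]
  · refine ⟨?_, fun h => by rw [hm.pos]; exact ha.2 h⟩
    rintro (x | v)
    · rw [hm.tape]; exact ha.1 x
    · simp
  · rw [← hm.raw]
    rfl
  · simpa [TapeMem.act] using hm.cnt v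

/-- Return a value. -/
def ret (e : E) : Ctrl (X ⊕ V) H O E :=
  rawStep fun _ => (⟨fun _ => (none, .stay), fun _ => .stay⟩, e)

theorem TapeMem.act_idle (m : TapeMem R H) :
    m.act ⟨fun _ => (none, .stay), fun _ => .stay⟩ = m := by
  simp [TapeMem.act, HeadMove.app]

theorem spec_test {f : TapeObs X H O → E} {a : CounterMem X V H} :
    Spec ora K (rawStep fun o => (⟨fun _ => (none, .stay), fun _ => .stay⟩, f o)) a
      (f (rawObs ora a)) a := by
  refine Spec.of_cnt_lt fun _ hK => ?_
  have := spec_rawStep (ora := ora) (K := K) (a := a)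
    (f := fun o => (⟨fun _ => (none, .stay), fun _ => .stay⟩, f o)) rfl
    ⟨by simp, by simp⟩ (by rwa [TapeMem.act_idle])
  rwa [TapeMem.act_idle] at this

theorem spec_ret {e : E} {a : CounterMem X V H} : Spec ora K (ret e) a e a :=
  spec_test (f := fun _ => e)

/-- Repeat the control `B` until the test `T` succeeds. -/
def untilLoop (T : Ctrl (X ⊕ V) H O Bool) (B : Ctrl (X ⊕ V) H O Unit) : Ctrl (X ⊕ V) H O Unit :=
  iterate (fun _ : Unit => T.bind fun b =>
    if b then ret (.inr ()) else B.bind fun _ => ret (.inl ())) ()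

theorem spec_untilLoop_done {T : Ctrl (X ⊕ V) H O Bool} {B : Ctrl (X ⊕ V) H O Unit}
    {a a' : CounterMem X V H} (h : Spec ora K T a true a') :
    Spec ora K (untilLoop T B) a () a' :=
  Spec.iterate_done (h.bind spec_ret)

theorem spec_untilLoop_next {T : Ctrl (X ⊕ V) H O Bool} {B : Ctrl (X ⊕ V) H O Unit}
    {a a₁ a₂ a' : CounterMem X V H} (h : Spec ora K T a false a₁) (hB : Spec ora K B a₁ () a₂)
    (h' : Spec ora K (untilLoop T B) a₂ () a') : Spec ora K (untilLoop T B) a () a' :=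
  Spec.iterate_next (h.bind (hB.bind spec_ret)) h'

/-- The sequence `s` lists the memories between the rounds; the induction is on the number of
remaining rounds. -/
theorem spec_untilLoop {T : Ctrl (X ⊕ V) H O Bool} {B : Ctrl (X ⊕ V) H O Unit}
    (s : ℕ → CounterMem X V H) (n : ℕ) (hT : ∀ i < n, Spec ora K T (s i) false (s i))
    (hB : ∀ i < n, Spec ora K B (s i) () (s (i + 1))) (hn : Spec ora K T (s n) true (s n)) :
    Spec ora K (untilLoop T B) (s 0) () (s n) := by
  have : ∀ k ≤ n, Spec ora K (untilLoop T B) (s (n - k)) () (s n) := by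
    intro k
    induction k with
    | zero => intro _; exact spec_untilLoop_done hn
    | succ k ih =>
      intro hk
      have h := hB (n - (k + 1)) (by omega)
      rw [show n - (k + 1) + 1 = n - k by omega] at h
      exact spec_untilLoop_next (hT _ (by omega)) h (ih (by omega))
  simpa using this n le_rfl

/-- Either test succeeds. -/
def orTest (T T' : Ctrl (X ⊕ V) H O Bool) : Ctrl (X ⊕ V) H O Bool :=
  T.bind fun b => if b then ret true else T'

theorem spec_orTest {T T' : Ctrl (X ⊕ V) H O Bool} {a : CounterMem X V H} {b b' : Bool}
    (h : Spec ora K T a b a) (h' : Spec ora K T' a b' a) :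
    Spec ora K (orTest T T') a (b || b') a := by
  refine h.bind ?_
  cases b
  · simpa using h'
  · simpa using spec_ret

/-- Both tests succeed. -/
def andTest (T T' : Ctrl (X ⊕ V) H O Bool) : Ctrl (X ⊕ V) H O Bool :=
  T.bind fun b => if b then T' else ret false

theorem spec_andTest {T T' : Ctrl (X ⊕ V) H O Bool} {a : CounterMem X V H} {b b' : Bool}
    (h : Spec ora K T a b a) (h' : Spec ora K T' a b' a) :
    Spec ora K (andTest T T') a (b && b') a := by
  refine h.bind ?_
  cases b
  · simpa using spec_ret
  · simpa using h'

/-- One control after another. -/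
def seq (P : Ctrl (X ⊕ V) H O Unit) (P' : Ctrl (X ⊕ V) H O E) : Ctrl (X ⊕ V) H O E :=
  P.bind fun _ => P'

theorem Spec.seq {P : Ctrl (X ⊕ V) H O Unit} {P' : Ctrl (X ⊕ V) H O E} {e : E}
    {a a' a'' : CounterMem X V H} (h : Spec ora K P a () a') (h' : Spec ora K P' a' e a'') :
    Spec ora K (P.seq P') a e a'' :=
  Spec.bind h h'

/-- The controls of a list, one after another. -/
def seqList (l : List (Ctrl (X ⊕ V) H O Unit)) : Ctrl (X ⊕ V) H O Unit :=
  l.foldr seq (ret ())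

variable [DecidableEq X] [DecidableEq V]

/-- Only the value of the resulting word is prescribed: the number of leading zeros is left open. -/
theorem OnTape.spec_cnt {P : Ctrl (X ⊕ V) H O E} {a : CounterMem X V H} {v : V} {e : E} {x : ℕ}
    (h : ∀ w, w ≠ [] → w.length ≤ K → wordVal w = a.cnt v → ∃ w', w' ≠ [] ∧ w'.length ≤ K ∧
      wordVal w' = x ∧ OnTape ora K P (.inr v) (.ofWord w) e (.ofWord w')) :
    Spec ora K P a e (a.setCnt v x) := by
  intro m hm
  obtain ⟨w, h0, hK, hw, hT⟩ := hm.cnt v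
  obtain ⟨w', h0', hK', hw', hO⟩ := h w h0 hK hw
  exact ⟨_, hO.2 m hm.inSpace hT, hm.setCnt ⟨w', h0', hK', hw', rfl⟩⟩

theorem OnTape.spec_raw {P : Ctrl (X ⊕ V) H O E} {a : CounterMem X V H} {x : X} {e : E}
    {T : SemiTape} (h : OnTape ora K P (.inl x) (a.raw.tape x) e T) :
    Spec ora K P a e (a.setRaw x T) :=
  fun m hm => ⟨_, h.2 m hm.inSpace (hm.tape x), hm.setRaw h.1⟩

theorem spec_inc {a : CounterMem X V H} {v : V} (h : a.cnt v + 1 < 2 ^ K) :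
    Spec ora K (inc (.inr v)) a () (a.setCnt v (a.cnt v + 1)) := by
  refine OnTape.spec_cnt fun w h0 hK hw => ?_
  obtain ⟨w', ⟨h1, h2⟩, hK', hO⟩ := exists_onTape_inc (ora := ora) (r := .inr v) h0 hK (by rwa [hw])
  refine ⟨w', ?_, hK', by rw [h1, hw], hO⟩
  rintro rfl
  simp at h1

theorem spec_dec {a : CounterMem X V H} {v : V} (h : a.cnt v ≠ 0) :
    Spec ora K (dec (.inr v)) a () (a.setCnt v (a.cnt v - 1)) := by
  refine OnTape.spec_cnt fun w h0 hK hw => ?_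
  obtain ⟨w', h1, h2, hO⟩ := exists_onTape_dec (ora := ora) (r := .inr v) hK (by rwa [hw])
  refine ⟨w', ?_, h2.trans_le hK, by omega, hO⟩
  rintro rfl
  exact h0 (List.length_eq_zero_iff.1 h2.symm)

theorem spec_isZero {a : CounterMem X V H} {v : V} :
    Spec ora K (isZero (.inr v)) a (a.cnt v == 0) a := by
  have : Spec ora K (isZero (.inr v)) a (a.cnt v == 0) (a.setCnt v (a.cnt v)) := by
    refine OnTape.spec_cnt fun w h0 hK hw => ⟨w, h0, hK, hw, ?_⟩
    have := onTape_isZero (ora := ora) (r := .inr v) hK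
    rw [hw] at this
    exact this
  simpa using this

/-- Set a counter to `0`. -/
def setZero (v : V) : Ctrl (X ⊕ V) H O Unit := untilLoop (isZero (.inr v)) (dec (.inr v))

/-- Counting down may take exponentially many steps in the number of digits, which is harmless as
only space is bounded. -/
theorem spec_setZero {a : CounterMem X V H} {v : V} :
    Spec ora K (setZero v) a () (a.setCnt v 0) := by
  have := spec_untilLoop (ora := ora) (K := K) (T := isZero (.inr v)) (B := dec (.inr v))
    (fun i => a.setCnt v (a.cnt v - i)) (a.cnt v) (fun i hi => ?_) (fun i hi => ?_) ?_
  · simp only [Nat.sub_self, Nat.sub_zero, CounterMem.setCnt_self] at this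
    exact this
  · have h := spec_isZero (ora := ora) (K := K) (a := a.setCnt v (a.cnt v - i)) (v := v)
    have e : ((a.setCnt v (a.cnt v - i)).cnt v == 0) = false := by simp; omega
    rwa [e] at h
  · have h := spec_dec (ora := ora) (K := K) (a := a.setCnt v (a.cnt v - i)) (v := v)
      (by simp; omega)
    simpa [Nat.sub_sub] using h
  · have h := spec_isZero (ora := ora) (K := K) (a := a.setCnt v (a.cnt v - a.cnt v)) (v := v)
    simpa using h

end Ctrl

end

/-! ### Comparison of counters, counted loops, saving numbers and head positions. -/

section

variable {R H O E F S X V : Type}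

namespace CounterMem

variable [DecidableEq X] [DecidableEq V]

@[simp] theorem setRaw_setRaw (a : CounterMem X V H) (x : X) (T T' : SemiTape) :
    (a.setRaw x T).setRaw x T' = a.setRaw x T' := by
  simp [setRaw]

theorem setRaw_comm (a : CounterMem X V H) {x x' : X} (h : x ≠ x') (T T' : SemiTape) :
    (a.setRaw x T).setRaw x' T' = (a.setRaw x' T').setRaw x T := by
  simp [setRaw, TapeMem.setTape_comm _ h]

theorem setRaw_eq_self (a : CounterMem X V H) {x : X} {T : SemiTape} (h : a.raw.tape x = T) :
    a.setRaw x T = a := by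
  simp [setRaw, TapeMem.setTape_eq_self _ h]

theorem setRaw_twice (a : CounterMem X V H) {x y : X} (hxy : x ≠ y) (T T' U U' : SemiTape) :
    (((a.setRaw x T).setRaw y U).setRaw x T').setRaw y U' = (a.setRaw x T').setRaw y U' := by
  rw [setRaw_comm _ hxy, setRaw_setRaw, setRaw_comm _ hxy.symm, setRaw_setRaw]

end CounterMem

namespace Ctrl

open CounterMem

variable {ora : (X ⊕ V → ℕ) → (H → ℕ) → O} {K : ℕ} [DecidableEq X] [DecidableEq V]

/-- Whether two counters are equal; the counter `z` is auxiliary. -/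
def eqTest (x y z : V) : Ctrl (X ⊕ V) H O Bool :=
  (untilLoop (orTest (isZero (.inr x)) (isZero (.inr y)))
    ((dec (.inr x)).seq ((dec (.inr y)).seq (inc (.inr z))))).seq
  ((andTest (isZero (.inr x)) (isZero (.inr y))).bind fun b =>
    (untilLoop (isZero (.inr z))
      ((inc (.inr x)).seq ((inc (.inr y)).seq (dec (.inr z))))).seq (ret b))

/-- Both counters are lowered together until one is `0`, while `z` counts the rounds. They were
equal iff both are then `0`. A second loop, counting `z` down, restores them. -/
theorem spec_eqTest {a : CounterMem X V H} {x y z : V} (hxy : x ≠ y) (hxz : x ≠ z) (hyz : y ≠ z)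
    (hz : a.cnt z = 0) : Spec ora K (eqTest x y z) a (decide (a.cnt x = a.cnt y)) a := by
  refine Spec.of_cnt_lt fun hlt _ => ?_
  set s : ℕ → CounterMem X V H := fun i =>
    ((a.setCnt x (a.cnt x - i)).setCnt y (a.cnt y - i)).setCnt z i with hs
  have sx : ∀ i, (s i).cnt x = a.cnt x - i := fun i => by
    simp [hs, CounterMem.setCnt, hxy, hxz]
  have sy : ∀ i, (s i).cnt y = a.cnt y - i := fun i => by
    simp [hs, CounterMem.setCnt, hyz]
  have sz : ∀ i, (s i).cnt z = i := fun i => by simp [hs]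
  have s0 : s 0 = a := by
    simp only [hs, Nat.sub_zero, CounterMem.setCnt_self]
    exact a.setCnt_eq_self hz
  -- All `s i` differ from `a` in these three counters only, so overwriting the three forgets `i`.
  have hset : ∀ i p q r, (((s i).setCnt x p).setCnt y q).setCnt z r =
      ((a.setCnt x p).setCnt y q).setCnt z r := fun i p q r => by
    rw [hs]
    simp only [CounterMem.setCnt]
    congr 1
    funext v
    by_cases h1 : v = z
    · subst h1; simp
    · by_cases h2 : v = y
      · subst h2; simp [h1]
      · by_cases h3 : v = x
        · subst h3; simp [h1, h2]
        · simp [h1, h2, h3]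
  set n := min (a.cnt x) (a.cnt y) with hn
  have htest : ∀ i, Spec ora K (orTest (isZero (.inr x)) (isZero (.inr y))) (s i)
      (((s i).cnt x == 0) || ((s i).cnt y == 0)) (s i) := fun i =>
    spec_orTest spec_isZero spec_isZero
  have h1 : Spec ora K _ (s 0) () (s n) := spec_untilLoop (ora := ora) (K := K)
    (T := orTest (isZero (.inr x)) (isZero (.inr y)))
    (B := (dec (.inr x)).seq ((dec (.inr y)).seq (inc (.inr z)))) s n
    (fun i hi => by
      have := htest i
      rw [sx, sy] at this
      have e : (a.cnt x - i == 0 || a.cnt y - i == 0) = false := by simp; omega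
      rwa [e] at this)
    (fun i hi => by
      have e : s (i + 1) = (((s i).setCnt x (a.cnt x - i - 1)).setCnt y (a.cnt y - i - 1)).setCnt z
          (i + 1) := by
        rw [hset]
        simp [hs, Nat.sub_sub]
      rw [e]
      have d1 := spec_dec (ora := ora) (K := K) (a := s i) (v := x) (by rw [sx]; omega)
      rw [sx] at d1
      refine d1.seq ?_
      have d2 := spec_dec (ora := ora) (K := K) (a := (s i).setCnt x (a.cnt x - i - 1)) (v := y)
        (by rw [cnt_setCnt_of_ne _ hxy.symm, sy]; omega)
      rw [cnt_setCnt_of_ne _ hxy.symm, sy] at d2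
      refine d2.seq ?_
      -- The auxiliary counter never exceeds the original value of `x`, so it fits.
      have d3 := spec_inc (ora := ora) (K := K) (v := z)
        (a := ((s i).setCnt x (a.cnt x - i - 1)).setCnt y (a.cnt y - i - 1))
        (by rw [cnt_setCnt_of_ne _ hyz.symm, cnt_setCnt_of_ne _ hxz.symm, sz]
            have := hlt x; omega)
      rwa [cnt_setCnt_of_ne _ hyz.symm, cnt_setCnt_of_ne _ hxz.symm, sz] at d3)
    (by
      have := htest n
      rw [sx, sy] at this
      have e : (a.cnt x - n == 0 || a.cnt y - n == 0) = true := by simp; omega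
      rwa [e] at this)
  -- The restoring loop passes through the same memories backwards.
  have h2 : Spec ora K _ (s (n - 0)) () (s (n - n)) := spec_untilLoop (ora := ora) (K := K)
    (T := isZero (.inr z))
    (B := (inc (.inr x)).seq ((inc (.inr y)).seq (dec (.inr z)))) (fun i => s (n - i)) n
    (fun i hi => by
      have := spec_isZero (ora := ora) (K := K) (a := s (n - i)) (v := z)
      have e : ((s (n - i)).cnt z == 0) = false := by rw [sz]; simp; omega
      rwa [e] at this)
    (fun i hi => by
      have e : s (n - (i + 1)) = (((s (n - i)).setCnt x (a.cnt x - (n - i) + 1)).setCnt y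
          (a.cnt y - (n - i) + 1)).setCnt z (n - i - 1) := by
        rw [hset]
        simp only [hs]
        rw [show a.cnt x - (n - (i + 1)) = a.cnt x - (n - i) + 1 by omega,
          show a.cnt y - (n - (i + 1)) = a.cnt y - (n - i) + 1 by omega,
          show n - (i + 1) = n - i - 1 by omega]
      rw [e]
      have d1 := spec_inc (ora := ora) (K := K) (a := s (n - i)) (v := x)
        (by rw [sx]; have := hlt x; omega)
      rw [sx] at d1
      refine d1.seq ?_
      have d2 := spec_inc (ora := ora) (K := K) (v := y)
        (a := (s (n - i)).setCnt x (a.cnt x - (n - i) + 1))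
        (by rw [cnt_setCnt_of_ne _ hxy.symm, sy]; have := hlt y; omega)
      rw [cnt_setCnt_of_ne _ hxy.symm, sy] at d2
      refine d2.seq ?_
      have d3 := spec_dec (ora := ora) (K := K) (v := z)
        (a := ((s (n - i)).setCnt x (a.cnt x - (n - i) + 1)).setCnt y (a.cnt y - (n - i) + 1))
        (by rw [cnt_setCnt_of_ne _ hyz.symm, cnt_setCnt_of_ne _ hxz.symm, sz]; omega)
      rwa [cnt_setCnt_of_ne _ hyz.symm, cnt_setCnt_of_ne _ hxz.symm, sz] at d3)
    (by
      have := spec_isZero (ora := ora) (K := K) (a := s (n - n)) (v := z)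
      have e : ((s (n - n)).cnt z == 0) = true := by rw [sz]; simp
      rwa [e] at this)
  simp only [Nat.sub_zero, Nat.sub_self] at h2
  rw [s0] at h1 h2
  refine h1.seq ((spec_andTest spec_isZero spec_isZero).bind (h2.seq ?_))
  -- After subtracting the minimum, both differences vanish iff the values agree.
  have e : ((s n).cnt x == 0 && (s n).cnt y == 0) = decide (a.cnt x = a.cnt y) := by
    rw [sx, sy, Bool.eq_iff_iff]
    simp
    omega
  rw [e]
  exact spec_ret

/-- Execute the control `B` for the values `0, 1, …` of the counter `t` below the counter `b`. -/
def forLoop (t b z : V) (B : Ctrl (X ⊕ V) H O Unit) : Ctrl (X ⊕ V) H O Unit :=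
  (untilLoop (eqTest t b z) (B.seq (inc (.inr t)))).seq (setZero t)

/-- The memories `s i` between the rounds are described with `t` equal to `0`, and the body is
specified with `t` set to `i`. Thus the caller need not mention the loop counter in its invariant.
-/
theorem spec_forLoop {t b z : V} (htb : t ≠ b) (htz : t ≠ z) (hbz : b ≠ z)
    {B : Ctrl (X ⊕ V) H O Unit} {n : ℕ} (s : ℕ → CounterMem X V H) (ht : ∀ i ≤ n, (s i).cnt t = 0)
    (hb : ∀ i ≤ n, (s i).cnt b = n) (hz : ∀ i ≤ n, (s i).cnt z = 0)
    (hB : ∀ i < n, Spec ora K B ((s i).setCnt t i) () ((s (i + 1)).setCnt t i)) :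
    Spec ora K (forLoop t b z B) (s 0) () (s n) := by
  refine Spec.of_cnt_lt fun hlt _ => ?_
  have hn : n < 2 ^ K := by have := hlt b; rwa [hb 0 (Nat.zero_le _)] at this
  have htest : ∀ i ≤ n, Spec ora K (eqTest t b z) ((s i).setCnt t i) (decide (i = n))
      ((s i).setCnt t i) := fun i hi => by
    have := spec_eqTest (ora := ora) (K := K) (a := (s i).setCnt t i) htb htz hbz
      (by rw [cnt_setCnt_of_ne _ htz.symm, hz i hi])
    rwa [cnt_setCnt, cnt_setCnt_of_ne _ htb.symm, hb i hi] at this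
  have h1 := spec_untilLoop (ora := ora) (K := K) (T := eqTest t b z)
    (B := B.seq (inc (.inr t))) (fun i => (s i).setCnt t i) n
    (fun i hi => by
      have := htest i hi.le
      rwa [decide_eq_false hi.ne] at this)
    (fun i hi => by
      refine (hB i hi).seq ?_
      have := spec_inc (ora := ora) (K := K) (a := (s (i + 1)).setCnt t i) (v := t)
        (by simp; omega)
      simpa using this)
    (by
      have := htest n le_rfl
      rwa [decide_eq_true rfl] at this)
  have h2 := spec_setZero (ora := ora) (K := K) (a := (s n).setCnt t n) (v := t)
  simp only [setCnt_setCnt] at h2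
  rw [setCnt_eq_self _ (ht 0 (Nat.zero_le _))] at h1
  rw [setCnt_eq_self _ (ht n le_rfl)] at h2
  exact h1.seq h2

theorem spec_rawTapes {x y : X} (hxy : x ≠ y) {p q : Option TapeSymbol × HeadMove}
    {a : CounterMem X V H} {T U : SemiTape} (hT : (a.raw.tape x).act p = T)
    (hU : (a.raw.tape y).act q = U)
    (hp : p.2 = .left → (a.raw.tape x).head ≠ 0) (hq : q.2 = .left → (a.raw.tape y).head ≠ 0)
    (hKT : T.head ≤ K) (hKU : U.head ≤ K) :
    Spec ora K (rawStep fun _ => (TapeAction.onTapes x y p q, ())) a ()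
      ((a.setRaw x T).setRaw y U) := by
  refine Spec.of_cnt_lt fun _ hs => ?_
  have := spec_rawStep (ora := ora) (K := K) (a := a)
    (f := fun _ => (TapeAction.onTapes x y p q, ())) rfl (TapeAction.allowed_onTapes hxy hp hq)
    (by rw [TapeAction.act_onTapes _ hxy, hT, hU]; exact (hs.setTape hKT).setTape hKU)
  rwa [TapeAction.act_onTapes _ hxy, hT, hU] at this

/-- Move the head of `x` to the left end and the head of `y` to the right by as many cells,
executing the control `B` in every step. -/
def shift (x y : X) (B : Ctrl (X ⊕ V) H O Unit) : Ctrl (X ⊕ V) H O Unit :=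
  untilLoop (rawStep fun o => (⟨fun _ => (none, .stay), fun _ => .stay⟩, o.atLeft x))
    ((rawStep fun _ => (TapeAction.onTapes x y (none, .left) (none, .right), ())).seq B)

/-- The sum of the two head positions is constant, so the head of `y` remembers where the head of
`x` has been. The same control with the tapes exchanged restores both. -/
theorem spec_shift {x y : X} (hxy : x ≠ y) {B : Ctrl (X ⊕ V) H O Unit} (s : ℕ → CounterMem X V H)
    {c d : ℕ → TapeSymbol} {h : ℕ} (hK : h ≤ K)
    (hB : ∀ i < h, Spec ora K B (((s i).setRaw x ⟨c, h - (i + 1)⟩).setRaw y ⟨d, i + 1⟩) ()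
      (((s (i + 1)).setRaw x ⟨c, h - (i + 1)⟩).setRaw y ⟨d, i + 1⟩)) :
    Spec ora K (shift x y B) (((s 0).setRaw x ⟨c, h⟩).setRaw y ⟨d, 0⟩) ()
      (((s h).setRaw x ⟨c, 0⟩).setRaw y ⟨d, h⟩) := by
  have hx : ∀ i j k, ((((s i).setRaw x ⟨c, j⟩).setRaw y ⟨d, k⟩).raw.tape x) = ⟨c, j⟩ := by
    intro i j k
    rw [raw_setRaw, TapeMem.tape_setTape_of_ne _ hxy, raw_setRaw, TapeMem.tape_setTape]
  have htest : ∀ i, Spec ora K (rawStep fun o =>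
      (⟨fun _ => (none, .stay), fun _ => .stay⟩, o.atLeft x))
      (((s i).setRaw x ⟨c, h - i⟩).setRaw y ⟨d, i⟩) (h - i == 0)
      (((s i).setRaw x ⟨c, h - i⟩).setRaw y ⟨d, i⟩) := by
    intro i
    have := spec_test (ora := ora) (K := K) (f := fun o => o.atLeft x)
      (a := ((s i).setRaw x ⟨c, h - i⟩).setRaw y ⟨d, i⟩)
    simp only [rawObs, hx] at this
    exact this
  have h1 := spec_untilLoop (ora := ora) (K := K)
    (T := rawStep fun o => (⟨fun _ => (none, .stay), fun _ => .stay⟩, o.atLeft x))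
    (B := (rawStep fun _ => (TapeAction.onTapes x y (none, .left) (none, .right), ())).seq B)
    (fun i => ((s i).setRaw x ⟨c, h - i⟩).setRaw y ⟨d, i⟩) h
    (fun i hi => by
      have := htest i
      have e : (h - i == 0) = false := by simp; omega
      rwa [e] at this)
    (fun i hi => by
      refine Spec.seq ?_ (hB i hi)
      have := spec_rawTapes (ora := ora) (K := K) hxy (p := (none, .left)) (q := (none, .right))
        (a := ((s i).setRaw x ⟨c, h - i⟩).setRaw y ⟨d, i⟩)
        (T := ⟨c, h - (i + 1)⟩) (U := ⟨d, i + 1⟩) (by rw [hx]; simp; omega) (by simp)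
        (by rw [hx]; simp; omega) (by simp) (by simp; omega) (by simp; omega)
      rwa [setRaw_twice _ hxy] at this)
    (by
      have := htest h
      have e : (h - h == 0) = true := by simp
      rwa [e] at this)
  simp only [Nat.sub_zero, Nat.sub_self] at h1
  exact h1

/-- A blank among the cells up to `K` ensures that the copied word has at most `K` digits, as
required of a counter. -/
theorem spec_copyWord {a : CounterMem X V H} {x : X} {d : V} {k : ℕ}
    (hx : (a.raw.tape x).head = 0) (hk : (a.raw.tape x).cells k = .blank) (hkK : k ≤ K) :
    Spec ora K (copyWord (.inl x) (.inr d)) a () (a.setCnt d (a.raw.tape x).number) := by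
  intro m hm
  obtain ⟨w, h0, hK, hw, hT⟩ := hm.cnt d
  have hne : (Sum.inl x : X ⊕ V) ≠ .inr d := by simp
  have hT0 : (⟨(a.raw.tape x).cells, 0⟩ : SemiTape) = a.raw.tape x := by rw [← hx]
  obtain ⟨u, hu0, huK, hu, hO⟩ := exists_onTapes_copyWord (ora := ora) hne hk hkK
    ((List.length_pos_iff.2 h0).trans_le hK) hK
  rw [hT0] at hu hO
  have hrun := hO.2.2 m hm.inSpace (hm.tape x) hT
  rw [TapeMem.setTape_eq_self m (hm.tape x)] at hrun
  exact ⟨_, hrun, hm.setCnt ⟨u, hu0, huK, hu, rfl⟩⟩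

/-- Copy the number on the tape `x` to the counter `d`; the tape `y` is auxiliary. -/
def copyNumber (x y : X) (d : V) : Ctrl (X ⊕ V) H O Unit :=
  (shift x y (ret ())).seq ((copyWord (.inl x) (.inr d)).seq (shift y x (ret ())))

/-- The number has to be read from the leftmost cell while the head may be anywhere. Its position is
kept on the auxiliary tape and restored afterwards. -/
theorem spec_copyNumber {a : CounterMem X V H} {x y : X} (hxy : x ≠ y) {d : V} {k : ℕ}
    (hy : (a.raw.tape y).head = 0) (hk : (a.raw.tape x).cells k = .blank) (hkK : k ≤ K) :
    Spec ora K (copyNumber x y d) a () (a.setCnt d (a.raw.tape x).number) := by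
  refine Spec.of_cnt_lt fun _ hs => ?_
  set h := (a.raw.tape x).head
  have hhK : h ≤ K := hs.1 x
  set c := (a.raw.tape x).cells
  set b := (a.raw.tape y).cells
  have e1 : ∀ n, (((a.setCnt d n).setRaw x ⟨c, h⟩).setRaw y ⟨b, 0⟩) = a.setCnt d n := by
    intro n
    rw [setRaw_eq_self (x := x), setRaw_eq_self (x := y)]
    · rw [raw_setCnt, ← hy]
    · rfl
  have s1 := spec_shift (ora := ora) (K := K) hxy (B := ret ()) (fun _ => a) (c := c) (d := b)
    hhK (fun _ _ => spec_ret)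
  have e2 := e1 (a.cnt d)
  rw [setCnt_self] at e2
  simp only [e2] at s1
  set a₁ := (a.setRaw x ⟨c, 0⟩).setRaw y ⟨b, h⟩ with ha₁
  have hx₁ : a₁.raw.tape x = ⟨c, 0⟩ := by
    rw [ha₁, raw_setRaw, TapeMem.tape_setTape_of_ne _ hxy, raw_setRaw, TapeMem.tape_setTape]
  have s2 := spec_copyWord (ora := ora) (K := K) (a := a₁) (x := x) (d := d) (k := k)
    (by rw [hx₁]) (by rw [hx₁]; exact hk) hkK
  have hnum : (a₁.raw.tape x).number = (a.raw.tape x).number := by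
    rw [hx₁]; rfl
  rw [hnum] at s2
  have s3 := spec_shift (ora := ora) (K := K) hxy.symm (B := ret ())
    (fun _ => a.setCnt d (a.raw.tape x).number) (c := b) (d := c)
    hhK (fun _ _ => spec_ret)
  simp only [setRaw_comm _ hxy.symm, e1] at s3
  exact s1.seq (s2.seq s3)

/-- Store the position of the head of the tape `x` in the counter `v`; the tape `y` is
auxiliary. -/
def readHead (x y : X) (v : V) : Ctrl (X ⊕ V) H O Unit :=
  (setZero v).seq ((shift x y (inc (.inr v))).seq (shift y x (ret ())))

theorem spec_readHead {a : CounterMem X V H} {x y : X} (hxy : x ≠ y) {v : V}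
    (hy : (a.raw.tape y).head = 0) :
    Spec ora K (readHead x y v) a () (a.setCnt v (a.raw.tape x).head) := by
  refine Spec.of_cnt_lt fun _ hs => ?_
  set h := (a.raw.tape x).head
  have hhK : h ≤ K := hs.1 x
  set c := (a.raw.tape x).cells
  set b := (a.raw.tape y).cells
  have e1 : ∀ n, (((a.setCnt v n).setRaw x ⟨c, h⟩).setRaw y ⟨b, 0⟩) = a.setCnt v n := by
    intro n
    rw [setRaw_eq_self (x := x), setRaw_eq_self (x := y)]
    · rw [raw_setCnt, ← hy]
    · rfl
  have s1 := spec_shift (ora := ora) (K := K) hxy (B := inc (.inr v)) (fun i => a.setCnt v i)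
    (c := c) (d := b) hhK (fun i hi => by
      -- The counter stays at most `h`, and `h ≤ K < 2 ^ K`.
      have := spec_inc (ora := ora) (K := K) (v := v)
        (a := ((a.setCnt v i).setRaw x ⟨c, h - (i + 1)⟩).setRaw y ⟨b, i + 1⟩) (by
          have := Nat.lt_two_pow_self (n := K)
          simp
          omega)
      simp only [cnt_setRaw, cnt_setCnt] at this
      have e : ((((a.setCnt v i).setRaw x ⟨c, h - (i + 1)⟩).setRaw y ⟨b, i + 1⟩).setCnt v (i + 1))
        = (((a.setCnt v (i + 1)).setRaw x ⟨c, h - (i + 1)⟩).setRaw y ⟨b, i + 1⟩) := by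
        simp [CounterMem.setCnt, CounterMem.setRaw]
      rwa [e] at this)
  rw [e1] at s1
  have s3 := spec_shift (ora := ora) (K := K) hxy.symm (B := ret ())
    (fun _ => a.setCnt v h) (c := b) (d := c)
    hhK (fun _ _ => spec_ret)
  simp only [setRaw_comm _ hxy.symm, e1] at s3
  exact spec_setZero.seq (s1.seq s3)

theorem spec_seqList {ι : Type} (l : List ι) (f : ι → Ctrl (X ⊕ V) H O Unit)
    (s : List ι → CounterMem X V H)
    (h : ∀ u i v, l = u ++ i :: v → Spec ora K (f i) (s u) () (s (u ++ [i]))) :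
    Spec ora K (seqList (l.map f)) (s []) () (s l) := by
  suffices ∀ v u, l = u ++ v → Spec ora K (seqList (v.map f)) (s u) () (s l) from this l [] rfl
  intro v
  induction v with
  | nil =>
    intro u hu
    rw [hu, List.append_nil]
    exact spec_ret
  | cons i v ih =>
    intro u hu
    exact (h u i v hu).seq (ih (u ++ [i]) (by simp [hu]))

end Ctrl

end

section

variable {R H O E F S X V ι : Type}

/-! ### Loops over tuples -/

namespace CounterMem

/-- Set the counters of a tuple. -/
noncomputable def setTuple {r : ℕ} (a : CounterMem X V H) (t : Fin r → V) (b : Fin r → ℕ) :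
    CounterMem X V H :=
  ⟨a.raw, Function.extend t b a.cnt⟩

variable {r : ℕ} {a : CounterMem X V H} {t : Fin r → V} {b : Fin r → ℕ}

theorem cnt_setTuple (ht : t.Injective) (j : Fin r) : (a.setTuple t b).cnt (t j) = b j :=
  ht.extend_apply b a.cnt j

theorem cnt_setTuple_of_ne {v : V} (h : ∀ j, t j ≠ v) : (a.setTuple t b).cnt v = a.cnt v :=
  Function.extend_apply' _ _ _ (by simpa using h)

variable [DecidableEq X] [DecidableEq V]

theorem setTuple_setCnt {v : V} (h : ∀ j, t j ≠ v) (x : ℕ) :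
    (a.setTuple t b).setCnt v x = (a.setCnt v x).setTuple t b := by
  simp only [setTuple, setCnt]
  congr 1
  funext v'
  by_cases hv : ∃ j, t j = v'
  · rw [Function.update_of_ne (by rintro rfl; exact hv.elim fun j hj => h j hj)]
    simp only [Function.extend_def, dif_pos hv]
  · rw [Function.extend_apply' _ _ _ hv]
    by_cases hv' : v' = v
    · subst hv'; simp
    · simp [hv', Function.extend_apply' _ _ _ hv]

theorem setTuple_setRaw (x : X) (T : SemiTape) :
    (a.setTuple t b).setRaw x T = (a.setRaw x T).setTuple t b := rfl

theorem setTuple_zero (t : Fin 0 → V) (b : Fin 0 → ℕ) : a.setTuple t b = a := by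
  simp only [setTuple]
  congr 1
  funext v
  exact Function.extend_apply' _ _ _ (by rintro ⟨j, -⟩; exact j.elim0)

/-- The outermost loop fixes the first coordinate, and the inner loops the remaining ones. -/
theorem setCnt_setTuple_succ {t : Fin (r + 1) → V} (ht : t.Injective) {b : Fin (r + 1) → ℕ} :
    (a.setCnt (t 0) (b 0)).setTuple (fun j => t j.succ) (fun j => b j.succ) = a.setTuple t b := by
  simp only [setTuple, setCnt]
  congr 1
  have ht' : Function.Injective fun j : Fin r => t j.succ :=
    fun i j h => Fin.succ_injective _ (ht h)
  funext v
  by_cases hv : ∃ j, t j = v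
  · obtain ⟨j, rfl⟩ := hv
    rw [ht.extend_apply]
    cases j using Fin.cases with
    | zero =>
      rw [Function.extend_apply' _ _ _ (by rintro ⟨j, hj⟩; exact Fin.succ_ne_zero _ (ht hj))]
      simp
    | succ j => exact ht'.extend_apply (fun j => b j.succ) _ j
  · rw [Function.extend_apply' _ _ _ hv, Function.extend_apply' _ _ _ (by
      rintro ⟨j, hj⟩; exact hv ⟨_, hj⟩), Function.update_of_ne (by rintro rfl; exact hv ⟨0, rfl⟩)]

end CounterMem

namespace Ctrl

open CounterMem

variable {ora : (X ⊕ V → ℕ) → (H → ℕ) → O} {K : ℕ} [DecidableEq X] [DecidableEq V]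

/-- Memories are indexed by the list of items visited so far, and round `i` appends `f i`. Because
of `total`, the body has to be correct only on initial segments of one fixed list; bounds on
addresses and the current input bit are derived from this. -/
theorem spec_forLoop_flatMap {n : ℕ} {total u : List ι} (f : ℕ → List ι)
    {s : List ι → CounterMem X V H} {t b z : V} {B : Ctrl (X ⊕ V) H O Unit}
    (htb : t ≠ b) (htz : t ≠ z) (hbz : b ≠ z) (ht : ∀ w, (s w).cnt t = 0)
    (hb : ∀ w, (s w).cnt b = n) (hz : ∀ w, (s w).cnt z = 0)
    (hu : u ++ (List.range n).flatMap f <+: total)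
    (hB : ∀ i < n, ∀ w, w ++ f i <+: total →
      Spec ora K B ((s w).setCnt t i) () ((s (w ++ f i)).setCnt t i)) :
    Spec ora K (forLoop t b z B) (s u) () (s (u ++ (List.range n).flatMap f)) := by
  have := spec_forLoop (ora := ora) (K := K) htb htz hbz (B := B) (n := n)
    (fun i => s (u ++ (List.range i).flatMap f)) (fun _ _ => ht _) (fun _ _ => hb _)
    (fun _ _ => hz _) (fun i hi => by
      have e : u ++ (List.range (i + 1)).flatMap f = (u ++ (List.range i).flatMap f) ++ f i := by
        simp [List.range_succ]
      rw [e]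
      refine hB i hi _ (List.IsPrefix.trans ?_ hu)
      rw [← e, List.prefix_append_right_inj]
      obtain ⟨k, rfl⟩ := Nat.exists_eq_add_of_le (Nat.succ_le_of_lt hi)
      rw [Nat.succ_eq_add_one, List.range_add (n := i + 1), List.flatMap_append]
      exact List.prefix_append _ _)
  simpa using this

/-- Execute a control for all tuples in lexicographic order. -/
def tupleLoop (b z : V) (B : Ctrl (X ⊕ V) H O Unit) :
    (r : ℕ) → (t : Fin r → V) → Ctrl (X ⊕ V) H O Unit
  | 0, _ => B
  | r + 1, t => forLoop (t 0) b z (tupleLoop b z B r fun j => t j.succ)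

theorem flatMap_finRange (n : ℕ) (f : Fin n → List ι) :
    (List.finRange n).flatMap f =
      (List.range n).flatMap fun i => if h : i < n then f ⟨i, h⟩ else [] := by
  rw [← List.map_coe_finRange_eq_range, List.flatMap_map]
  simp

/-- Nested loops with the first coordinate outermost produce exactly the recursion that defines
`lexTuples`. -/
theorem spec_tupleLoop {n r : ℕ} {total u : List ι} (mk : (Fin r → Fin n) → ι)
    {s : List ι → CounterMem X V H} {b z : V} {t : Fin r → V} {B : Ctrl (X ⊕ V) H O Unit}
    (hinj : t.Injective) (htb : ∀ j, t j ≠ b) (htz : ∀ j, t j ≠ z) (hbz : b ≠ z)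
    (ht : ∀ w j, (s w).cnt (t j) = 0) (hb : ∀ w, (s w).cnt b = n) (hz : ∀ w, (s w).cnt z = 0)
    (hu : u ++ (lexTuples n r).map mk <+: total)
    (hB : ∀ x w, w ++ [mk x] <+: total → Spec ora K B ((s w).setTuple t fun j => x j) ()
      ((s (w ++ [mk x])).setTuple t fun j => x j)) :
    Spec ora K (tupleLoop b z B r t) (s u) () (s (u ++ (lexTuples n r).map mk)) := by
  induction r generalizing u s with
  | zero =>
    have := hB Fin.elim0 u hu
    simp only [setTuple_zero] at this
    exact this
  | succ r ih =>
    have e : (lexTuples n (r + 1)).map mk = (List.range n).flatMap fun i => if h : i < n then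
        (lexTuples n r).map (fun x => mk (Fin.cons ⟨i, h⟩ x)) else [] := by
      rw [lexTuples, List.map_flatMap, flatMap_finRange]
      simp [Function.comp_def]
    rw [e] at hu ⊢
    refine spec_forLoop_flatMap _ (htb 0) (htz 0) hbz (fun w => ht w 0) hb hz hu
      fun i hi w hw => ?_
    simp only [dif_pos hi] at hw ⊢
    -- For the inner loops, the fixed first coordinate belongs to the invariant.
    refine ih (s := fun w => (s w).setCnt (t 0) i) (fun x => mk (Fin.cons ⟨i, hi⟩ x))
      (fun j k h => Fin.succ_injective _ (hinj h)) (fun j => htb _) (fun j => htz _)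
      (fun w j => ?_) (fun w => ?_) (fun w => ?_) hw fun x w' hw' => ?_
    · rw [cnt_setCnt_of_ne _ (hinj.ne (Fin.succ_ne_zero j)), ht]
    · rw [cnt_setCnt_of_ne _ (htb 0).symm, hb]
    · rw [cnt_setCnt_of_ne _ (htz 0).symm, hz]
    · have := hB (Fin.cons ⟨i, hi⟩ x) w' hw'
      rw [← setCnt_setTuple_succ hinj, ← setCnt_setTuple_succ hinj] at this
      simpa using this

theorem spec_seqList_flatMap {κ : Type} {total u : List ι} (l : List κ)
    (B : κ → Ctrl (X ⊕ V) H O Unit) (f : κ → List ι) {s : List ι → CounterMem X V H}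
    (hu : u ++ l.flatMap f <+: total)
    (hB : ∀ i w, w ++ f i <+: total → Spec ora K (B i) (s w) () (s (w ++ f i))) :
    Spec ora K (seqList (l.map B)) (s u) () (s (u ++ l.flatMap f)) := by
  have := spec_seqList (ora := ora) (K := K) l B (fun l' => s (u ++ l'.flatMap f))
    (fun l₁ i l₂ hl => by
      have e : u ++ (l₁ ++ [i]).flatMap f = (u ++ l₁.flatMap f) ++ f i := by simp
      rw [e]
      refine hB i _ (List.IsPrefix.trans ?_ hu)
      rw [hl, ← e, List.prefix_append_right_inj]
      simp)
  simpa using this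

end Ctrl

/-! ### The bits of the encoding -/

/-- A bit position of the encoding of a structure with domain `{0, …, n - 1}`. -/
inductive CodeItem (σ : FinVocabulary) (n : ℕ) where
  | rel (i : Fin σ.numRel) (x : Fin (σ.relArity i) → Fin n)
  | const (i : Fin σ.numConst) (m : ℕ)
  | func (i : Fin σ.numFun) (m : ℕ) (x : Fin (σ.funArity i) → Fin n)

variable {σ : FinVocabulary}

/-- All bit positions of the encoding in their order. -/
def codeItems (σ : FinVocabulary) (n l : ℕ) : List (CodeItem σ n) :=
  ((List.finRange σ.numRel).flatMap fun i => (lexTuples n (σ.relArity i)).map (.rel i)) ++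
  ((List.finRange σ.numConst).flatMap fun i => (List.range l).map (.const i)) ++
  ((List.finRange σ.numFun).flatMap fun i => (List.range l).flatMap fun m =>
    (lexTuples n (σ.funArity i)).map (.func i m))

namespace FinOrderedStructure

open Classical in
/-- The bit in a position of the encoding. -/
noncomputable def itemBit (A : FinOrderedStructure σ) : CodeItem σ A.size → Bool
  | .rel i x => decide (x ∈ A.rel i)
  | .const i m => binaryDigit A.logSize (A.const i) m
  | .func i m x => binaryDigit A.logSize (A.func i x) m

/-- This separates the order of the bits, which depends on the size only, from their values; all
later arguments on the encoding use it in this form. -/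
theorem encode_eq_map (A : FinOrderedStructure σ) :
    A.encode = (codeItems σ A.size A.logSize).map A.itemBit := by
  simp only [encode, codeItems, List.map_append, List.map_flatMap, List.map_map]
  rfl

end FinOrderedStructure

/-- The counters of the simulations. -/
inductive Reg (σ : FinVocabulary) where
  | rel (i : Fin σ.numRel) (j : Fin (σ.relArity i))
  | func (i : Fin σ.numFun) (j : Fin (σ.funArity i))
  | bit
  | size
  | log
  | pow
  | tmp
  | num
  | addr
  | relArg (i : Fin σ.numRel) (j : Fin (σ.relArity i))
  | funcArg (i : Fin σ.numFun) (j : Fin (σ.funArity i))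
  | head (l : ReadOnlyTape σ)

noncomputable instance : DecidableEq (Reg σ) := Classical.decEq _

instance : Finite (Reg σ) :=
  Finite.of_injective
    (β := ((Σ i, Fin (σ.relArity i)) × Bool) ⊕ ((Σ i, Fin (σ.funArity i)) × Bool) ⊕
      ReadOnlyTape σ ⊕ Fin 7)
    (fun
      | .rel i j => .inl (⟨i, j⟩, true)
      | .relArg i j => .inl (⟨i, j⟩, false)
      | .func i j => .inr (.inl (⟨i, j⟩, true))
      | .funcArg i j => .inr (.inl (⟨i, j⟩, false))
      | .head l => .inr (.inr (.inl l))
      | .bit => .inr (.inr (.inr 0))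
      | .size => .inr (.inr (.inr 1))
      | .log => .inr (.inr (.inr 2))
      | .pow => .inr (.inr (.inr 3))
      | .tmp => .inr (.inr (.inr 4))
      | .num => .inr (.inr (.inr 5))
      | .addr => .inr (.inr (.inr 6)))
    (by
      intro r r' h
      cases r <;> cases r' <;> simp_all)

theorem Reg.rel_injective (i : Fin σ.numRel) : Function.Injective (Reg.rel i) :=
  fun _ _ h => by simpa using h

theorem Reg.func_injective (i : Fin σ.numFun) : Function.Injective (Reg.func i) :=
  fun _ _ h => by simpa using h

/-- The loop counters are `0`, and the counters for the domain are set. -/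
structure CounterMem.Idle (n l : ℕ) (a : CounterMem X (Reg σ) H) : Prop where
  rel : ∀ i j, a.cnt (.rel i j) = 0
  func : ∀ i j, a.cnt (.func i j) = 0
  bit : a.cnt .bit = 0
  tmp : a.cnt .tmp = 0
  size : a.cnt .size = n
  log : a.cnt .log = l

/-! ### The walk over all bits of the encoding. -/

namespace Ctrl

open CounterMem

variable {ora : (X ⊕ Reg σ → ℕ) → (H → ℕ) → O} {K : ℕ} [DecidableEq X]

/-- Visit all bits of the encoding in their order. -/
noncomputable def walk (visitRel : Fin σ.numRel → Ctrl (X ⊕ Reg σ) H O Unit)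
    (visitConst : Fin σ.numConst → Ctrl (X ⊕ Reg σ) H O Unit)
    (visitFunc : Fin σ.numFun → Ctrl (X ⊕ Reg σ) H O Unit) : Ctrl (X ⊕ Reg σ) H O Unit :=
  (seqList ((List.finRange σ.numRel).map fun i =>
    tupleLoop .size .tmp (visitRel i) _ (Reg.rel i))).seq
  ((seqList ((List.finRange σ.numConst).map fun i =>
    forLoop .bit .log .tmp (visitConst i))).seq
  (seqList ((List.finRange σ.numFun).map fun i =>
    forLoop .bit .log .tmp (tupleLoop .size .tmp (visitFunc i) _ (Reg.func i)))))

/-- The order of the loops is the order of `codeItems`: relations, then constants, then functions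
with the bit position outside the tuples. It suffices to describe the effect of a single visit, with
the loop counters set to the item that is visited. -/
theorem spec_walk {n l : ℕ} {s : List (CodeItem σ n) → CounterMem X (Reg σ) H}
    (hs : ∀ w, (s w).Idle n l)
    {visitRel : Fin σ.numRel → Ctrl (X ⊕ Reg σ) H O Unit}
    {visitConst : Fin σ.numConst → Ctrl (X ⊕ Reg σ) H O Unit}
    {visitFunc : Fin σ.numFun → Ctrl (X ⊕ Reg σ) H O Unit}
    (hR : ∀ i x w, w ++ [.rel i x] <+: codeItems σ n l → Spec ora K (visitRel i)
      ((s w).setTuple (.rel i) fun j => x j) ()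
      ((s (w ++ [.rel i x])).setTuple (.rel i) fun j => x j))
    (hC : ∀ i m, m < l → ∀ w, w ++ [.const i m] <+: codeItems σ n l → Spec ora K (visitConst i)
      ((s w).setCnt .bit m) () ((s (w ++ [.const i m])).setCnt .bit m))
    (hF : ∀ i m, m < l → ∀ x w, w ++ [.func i m x] <+: codeItems σ n l → Spec ora K (visitFunc i)
      (((s w).setCnt .bit m).setTuple (.func i) fun j => x j) ()
      (((s (w ++ [.func i m x])).setCnt .bit m).setTuple (.func i) fun j => x j)) :
    Spec ora K (walk visitRel visitConst visitFunc) (s []) () (s (codeItems σ n l)) := by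
  have h1 := spec_seqList_flatMap (ora := ora) (K := K) (total := codeItems σ n l) (u := [])
    (List.finRange σ.numRel) (fun i => tupleLoop .size .tmp (visitRel i) _ (Reg.rel i))
    (fun i => (lexTuples n (σ.relArity i)).map (.rel i)) (s := s)
    (by simp only [codeItems, List.nil_append, List.append_assoc]; exact List.prefix_append _ _)
    (fun i w hw => spec_tupleLoop _ (Reg.rel_injective i) (by simp) (by simp) (by simp)
      (fun w j => (hs w).rel i j) (fun w => (hs w).size) (fun w => (hs w).tmp) hw
      (fun x w hw => hR i x w hw))
  have h2 := spec_seqList_flatMap (ora := ora) (K := K) (total := codeItems σ n l)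
    (u := [] ++ (List.finRange σ.numRel).flatMap fun i =>
      (lexTuples n (σ.relArity i)).map (CodeItem.rel i))
    (List.finRange σ.numConst) (fun i => forLoop .bit .log .tmp (visitConst i))
    (fun i => (List.range l).map (.const i)) (s := s)
    (by rw [codeItems, List.nil_append]; exact List.prefix_append _ _)
    (fun i w hw => by
      have e : (List.range l).map (CodeItem.const (σ := σ) (n := n) i) =
        (List.range l).flatMap fun m => [CodeItem.const i m] :=
        List.map_eq_flatMap
      rw [e] at hw ⊢
      exact spec_forLoop_flatMap _ (by simp) (by simp) (by simp) (fun w => (hs w).bit)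
        (fun w => (hs w).log) (fun w => (hs w).tmp) hw (fun m hm w hw => hC i m hm w hw))
  have h3 := spec_seqList_flatMap (ora := ora) (K := K) (total := codeItems σ n l)
    (u := ([] ++ (List.finRange σ.numRel).flatMap fun i =>
      (lexTuples n (σ.relArity i)).map (CodeItem.rel i)) ++
      (List.finRange σ.numConst).flatMap fun i => (List.range l).map (CodeItem.const i))
    (List.finRange σ.numFun)
    (fun i => forLoop .bit .log .tmp (tupleLoop .size .tmp (visitFunc i) _ (Reg.func i)))
    (fun i => (List.range l).flatMap fun m => (lexTuples n (σ.funArity i)).map (.func i m)) (s := s)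
    (by rw [codeItems, List.nil_append])
    (fun i w hw => by
      refine spec_forLoop_flatMap _ (by simp) (by simp) (by simp) (fun w => (hs w).bit)
        (fun w => (hs w).log) (fun w => (hs w).tmp) hw (fun m hm w hw => ?_)
      refine spec_tupleLoop (s := fun w => (s w).setCnt .bit m) _ (Reg.func_injective i) (by simp)
        (by simp) (by simp) (fun w j => ?_) (fun w => ?_) (fun w => ?_) hw
        (fun x w hw => hF i m hm x w hw)
      · rw [cnt_setCnt_of_ne _ (by simp)]; exact (hs w).func i j
      · rw [cnt_setCnt_of_ne _ (by simp)]; exact (hs w).size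
      · rw [cnt_setCnt_of_ne _ (by simp)]; exact (hs w).tmp)
  refine h1.seq (h2.seq ?_)
  simpa only [codeItems, List.nil_append] using h3

end Ctrl

/-! ### Counting the domain -/

namespace CounterMem

/-- Set the counters for a domain of `n` elements. -/
noncomputable def setSize (a : CounterMem X (Reg σ) H) (n : ℕ) : CounterMem X (Reg σ) H :=
  ((a.setCnt .size n).setCnt .log (Nat.clog 2 n)).setCnt .pow (2 ^ Nat.clog 2 n)

end CounterMem

/-- The rounded logarithm grows exactly after a power of `2`, so it can be updated by comparing `n`
with a stored `2 ^ Nat.clog 2 n`. -/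
theorem Nat.clog_two_succ {n : ℕ} (hn : 0 < n) :
    Nat.clog 2 (n + 1) = if n = 2 ^ Nat.clog 2 n then Nat.clog 2 n + 1 else Nat.clog 2 n := by
  have h1 : n ≤ 2 ^ Nat.clog 2 n := Nat.le_pow_clog (by norm_num) n
  split_ifs with h
  · apply le_antisymm
    · rw [Nat.clog_le_iff_le_pow (by norm_num), pow_succ]
      omega
    · by_contra hlt
      have : Nat.clog 2 (n + 1) ≤ Nat.clog 2 n := by omega
      rw [Nat.clog_le_iff_le_pow (by norm_num)] at this
      omega
  · apply le_antisymm
    · rw [Nat.clog_le_iff_le_pow (by norm_num)]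
      omega
    · exact Nat.clog_mono_right 2 (by omega)

namespace Ctrl

open CounterMem

variable {ora : (X ⊕ Reg σ → ℕ) → (H → ℕ) → O} {K : ℕ} [DecidableEq X]

/-- Increase the size of the domain by `1`. -/
noncomputable def nextSize : Ctrl (X ⊕ Reg σ) H O Unit :=
  (eqTest (.size) (.pow) (.tmp)).bind fun b =>
    (if b then (forLoop .bit .size .tmp (inc (.inr .pow))).seq (inc (.inr .log))
      else ret ()).seq (inc (.inr .size))

/-- If the size equals the stored power, the logarithm grows by `1` and the power is doubled. The
bound `2 * n + 1 < 2 ^ K` makes room for the doubled power. -/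
theorem spec_nextSize {a : CounterMem X (Reg σ) H} (hbit : a.cnt .bit = 0) (htmp : a.cnt .tmp = 0)
    {n : ℕ} (hn : 0 < n) (hK : 2 * n + 1 < 2 ^ K) :
    Spec ora K nextSize (a.setSize n) () (a.setSize (n + 1)) := by
  have h1 := spec_eqTest (ora := ora) (K := K) (a := a.setSize n) (x := .size) (y := .pow)
    (z := .tmp) (by simp) (by simp) (by simp) (by simp [setSize, CounterMem.setCnt, htmp])
  have e : decide ((a.setSize n).cnt .size = (a.setSize n).cnt .pow) =
      decide (n = 2 ^ Nat.clog 2 n) := by simp [setSize, CounterMem.setCnt]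
  rw [e] at h1
  have hlog := Nat.clog_two_succ hn
  have hinc : ∀ b : CounterMem X (Reg σ) H, b.cnt .size = n →
      Spec ora K (inc (.inr .size)) b () (b.setCnt .size (n + 1)) := fun b hb => by
    have := spec_inc (ora := ora) (K := K) (a := b) (v := .size) (by rw [hb]; omega)
    rwa [hb] at this
  refine h1.bind ?_
  by_cases h : n = 2 ^ Nat.clog 2 n
  · rw [if_pos h] at hlog
    rw [decide_eq_true h, if_pos rfl]
    -- As the power equals `n` here, `n` increments double it.
    have h2 := spec_forLoop (ora := ora) (K := K) (t := .bit) (b := .size) (z := .tmp) (n := n)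
      (B := inc (.inr .pow)) (by simp) (by simp) (by simp)
      (fun i => (a.setSize n).setCnt .pow (n + i))
      (fun i _ => by simp [setSize, CounterMem.setCnt, hbit])
      (fun i _ => by simp [setSize, CounterMem.setCnt])
      (fun i _ => by simp [setSize, CounterMem.setCnt, htmp])
      (fun i hi => by
        have := spec_inc (ora := ora) (K := K) (v := .pow)
          (a := ((a.setSize n).setCnt .pow (n + i)).setCnt .bit i)
          (by simp [CounterMem.setCnt]; omega)
        rw [cnt_setCnt_of_ne _ (by simp), cnt_setCnt, setCnt_comm _ (by simp),
          setCnt_setCnt] at this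
        rw [setCnt_comm (v := Reg.pow) (v' := Reg.bit) _ (by simp),
          setCnt_comm (v := Reg.pow) (v' := Reg.bit) _ (by simp)]
        exact this)
    rw [setCnt_eq_self (x := n + 0) _ (by simp [setSize, ← h])] at h2
    have h3 := spec_inc (ora := ora) (K := K) (a := (a.setSize n).setCnt .pow (n + n)) (v := .log)
      (by
        have : Nat.clog 2 n < 2 ^ Nat.clog 2 n := Nat.lt_two_pow_self
        simp [setSize, CounterMem.setCnt]
        omega)
    have e2 : ((a.setSize n).setCnt .pow (n + n)).cnt .log = Nat.clog 2 n := by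
      simp [setSize, CounterMem.setCnt]
    rw [e2] at h3
    refine (h2.seq h3).seq ?_
    have h4 := hinc (((a.setSize n).setCnt .pow (n + n)).setCnt .log (Nat.clog 2 n + 1))
      (by simp [setSize, CounterMem.setCnt])
    have e3 : (((a.setSize n).setCnt .pow (n + n)).setCnt .log (Nat.clog 2 n + 1)).setCnt .size
        (n + 1) = a.setSize (n + 1) := by
      rw [setSize, setSize, hlog, pow_succ, ← h, mul_two]
      simp only [CounterMem.setCnt]
      congr 1
      funext v
      cases v <;> simp
    rwa [e3] at h4
  · rw [if_neg h] at hlog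
    rw [decide_eq_false h]
    refine spec_ret.seq ?_
    have h4 := hinc (a.setSize n) (by simp [setSize, CounterMem.setCnt])
    have e3 : (a.setSize n).setCnt .size (n + 1) = a.setSize (n + 1) := by
      rw [setSize, setSize, hlog]
      simp only [CounterMem.setCnt]
      congr 1
      funext v
      cases v <;> simp
    rwa [e3] at h4

end Ctrl

end

section

variable {H O E F S X V ι : Type} {σ : FinVocabulary}

/-! ### Further controls -/

/-- The tape that holds a single symbol. -/
def symbolTape (y : TapeSymbol) : SemiTape := ⟨fun j => if j = 0 then y else .blank, 0⟩

theorem symbolTape_read (y : TapeSymbol) : (symbolTape y).read = y := rfl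

theorem update_symbolTape (y z : TapeSymbol) :
    Function.update (symbolTape y).cells 0 z = (symbolTape z).cells := by
  funext j
  by_cases hj : j = 0 <;> simp [symbolTape, hj]

theorem ofWord_false : SemiTape.ofWord [false] = symbolTape .zero := by
  simp only [SemiTape.ofWord, symbolTape]
  congr 1
  funext j
  cases j <;> simp [wordCells, TapeSymbol.ofBool]

theorem ofWord_nil : SemiTape.ofWord [] = symbolTape .blank := by
  simp only [SemiTape.ofWord, symbolTape]
  congr 1
  funext j
  simp [wordCells]

namespace CounterMem

variable [DecidableEq H]

/-- Set the position of a further head. -/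
def setPos (a : CounterMem X V H) (h : H) (p : ℕ) : CounterMem X V H :=
  ⟨⟨a.raw.tape, Function.update a.raw.pos h p⟩, a.cnt⟩

@[simp] theorem pos_setPos (a : CounterMem X V H) (h : H) (p : ℕ) :
    (a.setPos h p).raw.pos h = p := by
  simp [setPos]

@[simp] theorem cnt_setPos (a : CounterMem X V H) (h : H) (p : ℕ) :
    (a.setPos h p).cnt = a.cnt := rfl

@[simp] theorem tape_setPos (a : CounterMem X V H) (h : H) (p : ℕ) :
    (a.setPos h p).raw.tape = a.raw.tape := rfl

@[simp] theorem setPos_setPos (a : CounterMem X V H) (h : H) (p p' : ℕ) :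
    (a.setPos h p).setPos h p' = a.setPos h p' := by
  simp [setPos]

theorem setPos_eq_self (a : CounterMem X V H) {h : H} {p : ℕ} (hp : a.raw.pos h = p) :
    a.setPos h p = a := by
  subst hp
  simp [setPos]

theorem setPos_setCnt [DecidableEq V] (a : CounterMem X V H) (h : H) (p : ℕ) (v : V) (x : ℕ) :
    (a.setPos h p).setCnt v x = (a.setCnt v x).setPos h p := rfl

theorem setPos_setRaw [DecidableEq X] (a : CounterMem X V H) (h : H) (p : ℕ) (x : X)
    (T : SemiTape) : (a.setPos h p).setRaw x T = (a.setRaw x T).setPos h p := rfl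

theorem setCnt_setRaw [DecidableEq X] [DecidableEq V] (a : CounterMem X V H) (v : V) (n : ℕ)
    (x : X) (T : SemiTape) : (a.setRaw x T).setCnt v n = (a.setCnt v n).setRaw x T := rfl

end CounterMem

namespace Ctrl

open CounterMem

variable {ora : (X ⊕ V → ℕ) → (H → ℕ) → O} {K : ℕ} [DecidableEq X] [DecidableEq V] [DecidableEq H]

/-- One step on one tape and one further head. -/
def tapePosStep (x : X) (h : H)
    (f : TapeObs X H O → (Option TapeSymbol × HeadMove) × HeadMove) : Ctrl (X ⊕ V) H O Unit :=
  rawStep fun o => (⟨Function.update (fun _ => (none, .stay)) x (f o).1,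
    Function.update (fun _ => .stay) h (f o).2⟩, ())

theorem spec_tapePosStep {x : X} {h : H}
    {f : TapeObs X H O → (Option TapeSymbol × HeadMove) × HeadMove} {a : CounterMem X V H}
    {p : Option TapeSymbol × HeadMove} {d : HeadMove} {T : SemiTape} {n : ℕ}
    (hf : f (rawObs ora a) = (p, d)) (hp : p.2 = .left → (a.raw.tape x).head ≠ 0)
    (hd : d = .left → a.raw.pos h ≠ 0) (hT : (a.raw.tape x).act p = T)
    (hn : d.app (a.raw.pos h) = n) (hK : T.head ≤ K) (hnK : n ≤ K) :
    Spec ora K (tapePosStep x h f) a () ((a.setRaw x T).setPos h n) := by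
  refine Spec.of_cnt_lt fun _ hs => ?_
  have e : a.raw.act ⟨Function.update (fun _ => (none, .stay)) x p,
      Function.update (fun _ => .stay) h d⟩ = ((a.setRaw x T).setPos h n).raw := by
    simp only [TapeMem.act, CounterMem.setPos, CounterMem.setRaw, TapeMem.setTape]
    congr 1
    · funext x'
      by_cases hx : x' = x
      · subst hx; simpa using hT
      · simp [hx]
    · funext h'
      by_cases hh : h' = h
      · subst hh; simpa using hn
      · simp [hh, HeadMove.app]
  have := spec_rawStep (ora := ora) (K := K) (a := a)
    (f := fun o => (⟨Function.update (fun _ => (none, .stay)) x (f o).1,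
      Function.update (fun _ => .stay) h (f o).2⟩, ()))
    (act := ⟨Function.update (fun _ => (none, .stay)) x p, Function.update (fun _ => .stay) h d⟩)
    (e := ()) (by simp only [hf])
    (⟨fun x' => by
        by_cases hx : x' = x
        · subst hx; simpa using hp
        · simp [hx],
      fun h' => by
        by_cases hh : h' = h
        · subst hh; simpa using hd
        · simp [hh]⟩) (by
      rw [e]
      refine ⟨(hs.setTape hK).1, fun h' => ?_⟩
      by_cases hh : h' = h
      · subst hh; simpa using hnK
      · simpa [CounterMem.setPos, hh, CounterMem.setRaw, TapeMem.setTape] using hs.2 h')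
  rw [e] at this
  exact this

/-- Move a further head. -/
def movePos (h : H) (d : HeadMove) : Ctrl (X ⊕ V) H O Unit :=
  rawStep fun _ => (⟨fun _ => (none, .stay), Function.update (fun _ => .stay) h d⟩, ())

theorem spec_movePos {h : H} {a : CounterMem X V H} {d : HeadMove} {n : ℕ}
    (hd : d = .left → a.raw.pos h ≠ 0) (hn : d.app (a.raw.pos h) = n) (hnK : n ≤ K) :
    Spec ora K (movePos h d) a () (a.setPos h n) := by
  refine Spec.of_cnt_lt fun _ hs => ?_
  have e : a.raw.act ⟨fun _ => (none, .stay), Function.update (fun _ => .stay) h d⟩ =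
      (a.setPos h n).raw := by
    simp only [TapeMem.act, CounterMem.setPos]
    congr 1
    · funext x'
      simp
    · funext h'
      by_cases hh : h' = h
      · subst hh; simpa using hn
      · simp [hh, HeadMove.app]
  have := spec_rawStep (ora := ora) (K := K) (a := a)
    (f := fun _ => (⟨fun _ => (none, .stay), Function.update (fun _ => .stay) h d⟩, ())) rfl
    (⟨by simp, fun h' => by
        by_cases hh : h' = h
        · subst hh; simpa using hd
        · simp [hh]⟩) (by
      rw [e]
      refine ⟨hs.1, fun h' => ?_⟩
      by_cases hh : h' = h
      · subst hh; simpa using hnK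
      · simpa [CounterMem.setPos, hh] using hs.2 h')
  rw [e] at this
  exact this

/-- Execute the control `B` with the head `h` in the position given by the counter `v`. -/
def atPosition (h : H) (v : V) (B : Ctrl (X ⊕ V) H O Unit) : Ctrl (X ⊕ V) H O Unit :=
  (untilLoop (isZero (.inr v)) ((dec (.inr v)).seq (movePos h .right))).seq
  (B.seq (untilLoop (rawStep fun o => (⟨fun _ => (none, .stay), fun _ => .stay⟩, o.posZero h))
    ((movePos h .left).seq (inc (.inr v)))))

/-- The head position and the counter always add up to `m`. While `B` runs, the counter is `0`; the
way back to the left end restores it. -/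
theorem spec_atPosition {h : H} {v : V} {B : Ctrl (X ⊕ V) H O Unit} {a a' : CounterMem X V H}
    {m : ℕ} (hm : m ≤ K) (hv : a.cnt v = m) (hh : a.raw.pos h = 0) (hv' : a'.cnt v = m)
    (hh' : a'.raw.pos h = 0)
    (hB : Spec ora K B ((a.setCnt v 0).setPos h m) () ((a'.setCnt v 0).setPos h m)) :
    Spec ora K (atPosition h v B) a () a' := by
  have h1 := spec_untilLoop (ora := ora) (K := K) (T := isZero (.inr v))
    (B := (dec (.inr v)).seq (movePos h .right)) (fun i => (a.setCnt v (m - i)).setPos h i) m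
    (fun i hi => by
      have := spec_isZero (ora := ora) (K := K) (a := (a.setCnt v (m - i)).setPos h i) (v := v)
      have e : (((a.setCnt v (m - i)).setPos h i).cnt v == 0) = false := by simp; omega
      rwa [e] at this)
    (fun i hi => by
      have h1 := spec_dec (ora := ora) (K := K) (a := (a.setCnt v (m - i)).setPos h i) (v := v)
        (by simp; omega)
      refine h1.seq ?_
      have h2 := spec_movePos (ora := ora) (K := K) (h := h) (d := .right) (n := i + 1)
        (a := ((a.setCnt v (m - i)).setPos h i).setCnt v
          (((a.setCnt v (m - i)).setPos h i).cnt v - 1))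
        (by simp) (by simp [setPos_setCnt, HeadMove.app]) (by omega)
      simpa [setPos_setCnt, Nat.sub_sub] using h2)
    (by
      have := spec_isZero (ora := ora) (K := K) (a := (a.setCnt v (m - m)).setPos h m) (v := v)
      simpa using this)
  simp only [Nat.sub_zero, Nat.sub_self] at h1
  rw [setCnt_eq_self _ hv, setPos_eq_self _ hh] at h1
  have h2 := spec_untilLoop (ora := ora) (K := K)
    (T := rawStep fun o => (⟨fun _ => (none, .stay), fun _ => .stay⟩, o.posZero h))
    (B := (movePos h .left).seq (inc (.inr v))) (fun i => (a'.setCnt v i).setPos h (m - i)) m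
    (fun i hi => by
      have := spec_test (ora := ora) (K := K) (f := fun o => o.posZero h)
        (a := (a'.setCnt v i).setPos h (m - i))
      have e : (rawObs ora ((a'.setCnt v i).setPos h (m - i))).posZero h = false := by
        simp [rawObs]; omega
      rwa [e] at this)
    (fun i hi => by
      have h2 := spec_movePos (ora := ora) (K := K) (h := h) (d := .left) (n := m - (i + 1))
        (a := (a'.setCnt v i).setPos h (m - i)) (by simp; omega) (by simp [HeadMove.app]; omega)
        (by omega)
      refine h2.seq ?_
      have h1 := spec_inc (ora := ora) (K := K) (v := v)
        (a := ((a'.setCnt v i).setPos h (m - i)).setPos h (m - (i + 1)))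
        (by have := Nat.lt_two_pow_self (n := K); simp; omega)
      simpa [setPos_setCnt] using h1)
    (by
      have := spec_test (ora := ora) (K := K) (f := fun o => o.posZero h)
        (a := (a'.setCnt v m).setPos h (m - m))
      have e : (rawObs ora ((a'.setCnt v m).setPos h (m - m))).posZero h = true := by
        simp [rawObs]
      rwa [e] at this)
  simp only [Nat.sub_zero, Nat.sub_self] at h2
  rw [setCnt_eq_self _ hv', setPos_eq_self _ hh'] at h2
  exact h1.seq (hB.seq h2)

/-- Replace the symbol on the tape `x`, that holds a single symbol. -/
def record (x : X) (g : TapeSymbol → O → TapeSymbol) : Ctrl (X ⊕ V) H O Unit :=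
  rawStep fun o => (TapeAction.onTape x (some (g (o.sym x) o.ans), .stay), ())

theorem spec_record {x : X} {g : TapeSymbol → O → TapeSymbol} {a : CounterMem X V H}
    {y z : TapeSymbol} (hx : a.raw.tape x = symbolTape y) (hz : g y (ora a.num a.raw.pos) = z) :
    Spec ora K (record x g) a () (a.setRaw x (symbolTape z)) := by
  refine Spec.of_cnt_lt fun _ hs => ?_
  have := spec_rawStep (ora := ora) (K := K) (a := a)
    (f := fun o => (TapeAction.onTape x (some (g (o.sym x) o.ans), .stay), ())) rfl
    (TapeAction.allowed_onTape (by simp)) (by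
      rw [TapeAction.act_onTape]
      exact hs.setTape (by simpa using hs.1 x))
  rw [TapeAction.act_onTape] at this
  have e : (a.raw.tape x).act (some (g ((rawObs ora a).sym x) (rawObs ora a).ans), .stay) =
      symbolTape z := by
    simp only [rawObs, hx, symbolTape_read, hz, SemiTape.act_some_stay]
    change (⟨Function.update _ 0 z, 0⟩ : SemiTape) = _
    rw [update_symbolTape]
    rfl
  rw [e] at this
  exact this

end Ctrl

/-! ### Facts on encodings -/

theorem CounterMem.Idle.of_eq {X' H' : Type} {n l : ℕ} {a : CounterMem X (Reg σ) H}
    {a' : CounterMem X' (Reg σ) H'} (h : a.Idle n l) (hrel : ∀ i j,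
      a'.cnt (.rel i j) = a.cnt (.rel i j))
    (hfunc : ∀ i j, a'.cnt (.func i j) = a.cnt (.func i j)) (hbit : a'.cnt .bit = a.cnt .bit)
    (htmp : a'.cnt .tmp = a.cnt .tmp) (hsize : a'.cnt .size = a.cnt .size)
    (hlog : a'.cnt .log = a.cnt .log) : a'.Idle n l :=
  ⟨fun i j => (hrel i j).trans (h.rel i j), fun i j => (hfunc i j).trans (h.func i j),
    hbit.trans h.bit, htmp.trans h.tmp, hsize.trans h.size, hlog.trans h.log⟩

theorem wordCells_binaryWord {w x m : ℕ} (h : m < w) :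
    wordCells (binaryWord w x) m = .ofBool (binaryDigit w x m) := by
  rw [wordCells_of_lt (by rwa [length_binaryWord])]
  simp [binaryWord]

theorem FinOrderedStructure.logSize_le {A : FinOrderedStructure σ} {K : ℕ} (h : A.size ≤ 2 ^ K) :
    A.logSize ≤ K :=
  Nat.clog_le_of_le_pow h

end

section

variable {σ : FinVocabulary}

/-! ### A direct-access machine that simulates a random-access machine -/

/-- The tapes besides the counters: the tapes of the simulated machine, and auxiliary tapes. -/
inductive SimTape (k : ℕ) where
  | sim (l : Fin (k + 1))
  | aux
  | buf
  | ans
  deriving DecidableEq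

instance (k : ℕ) : Finite (SimTape k) :=
  Finite.of_injective (β := Fin (k + 1) ⊕ Fin 3)
    (fun | .sim l => .inl l | .aux => .inr 0 | .buf => .inr 1 | .ans => .inr 2)
    (by intro x y h; cases x <;> cases y <;> simp_all)

noncomputable instance : DecidableEq (ReadOnlyTape σ) := Classical.decEq _

namespace RandomAccessSim

open CounterMem Ctrl

abbrev Mem (σ : FinVocabulary) (k : ℕ) : Type := CounterMem (SimTape k) (Reg σ) (ReadOnlyTape σ)

abbrev Control (σ : FinVocabulary) (k : ℕ) (E : Type) : Type 1 :=
  Ctrl (SimTape k ⊕ Reg σ) (ReadOnlyTape σ) (DirectAccessTM.Answer σ) E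

/-- The oracle: the loop counters are the address-tapes. -/
noncomputable abbrev ora (A : FinOrderedStructure σ) {k : ℕ} :
    (SimTape k ⊕ Reg σ → ℕ) → (ReadOnlyTape σ → ℕ) → DirectAccessTM.Answer σ :=
  DirectAccessTM.oracle A (fun i j => .inr (.rel i j)) (fun i j => .inr (.func i j))

variable {A : FinOrderedStructure σ} {K k : ℕ}

/-- The memory represents the tapes `T` of the simulated machine. -/
structure Ready (A : FinOrderedStructure σ) (T : Fin (k + 1) → SemiTape) (a : Mem σ k) : Prop where
  idle : a.Idle A.size A.logSize
  sim : ∀ l, a.raw.tape (.sim l) = T l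
  aux : (a.raw.tape .aux).head = 0
  ans : ∃ y, a.raw.tape .ans = symbolTape y
  pos : ∀ h, a.raw.pos h = 0

/-- Record the answer, unless a bit has been recorded before. -/
def recordBit (g : DirectAccessTM.Answer σ → TapeSymbol) : Control σ k Unit :=
  record .ans fun y o => if y = .blank then g o else y

/-- Count down, or execute a control if the counter is `0`. -/
noncomputable def visit (B : Control σ k Unit) : Control σ k Unit :=
  (isZero (.inr .num)).bind fun z => if z then B else dec (.inr .num)

/-- Find the bit of the encoding in the position given by the simulated address-tape. -/
noncomputable def askInput : Control σ k Unit :=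
  (copyNumber (.sim 0) .aux .num).seq ((put (.inl .ans) .blank).seq
    (walk (fun i => visit (recordBit fun o => .ofBool (o.2 i)))
      (fun i => visit (atPosition (.const i) .bit (recordBit fun o => o.1 (.const i))))
      (fun i => visit (atPosition (.value i) .bit (recordBit fun o => o.1 (.value i))))))

/-- The memory when the bits `w` have been visited in the search for the position `p`. -/
noncomputable def stage (a : Mem σ k) (p : ℕ) (w : List Bool) : Mem σ k :=
  (a.setCnt .num (p - w.length)).setRaw .ans (symbolTape (wordCells w p))

/-- The recorded symbol is always `wordCells w p`: blank until position `p` has been passed, and the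
bit at `p` from then on. The truncated difference `p - w.length` is `0` from the decisive visit
onwards. -/
theorem spec_visit {B : Control σ k Unit} {b : Mem σ k} {p : ℕ} {w : List Bool} {x : Bool}
    (hnum : b.cnt .num = p - w.length) (hans : b.raw.tape .ans = symbolTape (wordCells w p))
    (hB : ∀ y z, b.raw.tape .ans = symbolTape y → (if y = .blank then .ofBool x else y) = z →
      Spec (ora A) K B b () (b.setRaw .ans (symbolTape z))) :
    Spec (ora A) K (visit B) b () (stage b p (w ++ [x])) := by
  refine spec_isZero.bind ?_
  by_cases h : p ≤ w.length
  · have e : (b.cnt .num == 0) = true := by simp [hnum, h]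
    rw [e, if_pos rfl, stage, setCnt_eq_self]
    · refine hB _ _ hans ?_
      -- At `p = w.length` the answer is still blank and the new bit is taken; at later visits it is
      -- not blank and is kept.
      rcases h.eq_or_lt with rfl | h
      · simp
      · rw [if_neg (by rw [wordCells_eq_blank_iff]; omega)]
        simp [wordCells, List.getElem?_append_left h]
    · rw [hnum, List.length_append]
      omega
  · have e : (b.cnt .num == 0) = false := by simp [hnum]; omega
    rw [e, if_neg (by simp), stage, setRaw_eq_self]
    · have := spec_dec (ora := ora A) (K := K) (a := b) (v := .num) (by omega)
      rw [hnum, Nat.sub_sub] at this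
      simpa using this
    · rw [raw_setCnt, hans, wordCells_of_le (by omega), wordCells_of_le (by simp; omega)]

theorem stage_stage (a : Mem σ k) (p : ℕ) (w w' : List Bool) :
    stage (stage a p w) p w' = stage a p w' := by
  simp [stage, setCnt_setRaw]

theorem stage_setCnt (a : Mem σ k) (p : ℕ) (w : List Bool) {v : Reg σ} (hv : v ≠ .num) (x : ℕ) :
    stage (a.setCnt v x) p w = (stage a p w).setCnt v x := by
  simp only [stage, setCnt_setRaw]
  rw [setCnt_comm _ hv]

theorem stage_setTuple (a : Mem σ k) (p : ℕ) (w : List Bool) {r : ℕ} {t : Fin r → Reg σ}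
    (ht : ∀ j, t j ≠ .num) (x : Fin r → ℕ) :
    stage (a.setTuple t x) p w = (stage a p w).setTuple t x := by
  simp only [stage, setTuple_setCnt ht, setTuple_setRaw]

theorem Ready.stage {T : Fin (k + 1) → SemiTape} {a : Mem σ k} (h : Ready A T a) (p : ℕ)
    (w : List Bool) : Ready A T (stage a p w) := by
  refine ⟨h.idle.of_eq ?_ ?_ ?_ ?_ ?_ ?_, fun l => ?_, ?_, ⟨_, TapeMem.tape_setTape _ _ _⟩, h.pos⟩
  all_goals first
    | (simp [RandomAccessSim.stage, CounterMem.setCnt]; done)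
    | skip
  · rw [RandomAccessSim.stage, raw_setRaw, TapeMem.tape_setTape_of_ne _ (by simp)]
    exact h.sim l
  · rw [RandomAccessSim.stage, raw_setRaw, TapeMem.tape_setTape_of_ne _ (by simp)]
    exact h.aux

theorem spec_recordBit {b : Mem σ k} {g : DirectAccessTM.Answer σ → TapeSymbol} {y z : TapeSymbol}
    {x : Bool} (hb : b.raw.tape .ans = symbolTape y)
    (hz : (if y = .blank then .ofBool x else y) = z)
    (hg : g (ora A b.num b.raw.pos) = .ofBool x) :
    Spec (ora A) K (recordBit g) b () (b.setRaw .ans (symbolTape z)) :=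
  spec_record hb (by rw [hg, hz])

/-- The bit position is the place where the head of the read-only tape has to stand. During the
recording the counter of the bit position is `0`, which is harmless as it is not an address-tape. -/
theorem spec_recordBit_atPosition {b : Mem σ k} {h : ReadOnlyTape σ} {y z : TapeSymbol}
    {x : Bool} {m : ℕ} (hb : b.raw.tape .ans = symbolTape y)
    (hz : (if y = .blank then .ofBool x else y) = z) (hm : m ≤ K) (hbit : b.cnt .bit = m)
    (hpos : b.raw.pos h = 0)
    (hg : (ora A ((b.setCnt .bit 0).setPos h m).num ((b.setCnt .bit 0).setPos h m).raw.pos).1 h =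
      .ofBool x) :
    Spec (ora A) K (atPosition h .bit (recordBit fun o => o.1 h)) b ()
      (b.setRaw .ans (symbolTape z)) :=
  spec_atPosition hm hbit hpos hbit hpos
    (spec_recordBit (b := (b.setCnt .bit 0).setPos h m) hb hz hg)

/-- The walk applied to the memories `stage`. The loop counters are the address-tapes, so at each
item the oracle supplies exactly its bit. -/
theorem spec_askInput {T : Fin (k + 1) → SemiTape} {a : Mem σ k} (ha : Ready A T a) {j : ℕ}
    (hj : (T 0).cells j = .blank) (hjK : j ≤ K) (hK : A.size ≤ 2 ^ K) :
    Spec (ora A) K askInput a () (stage a (T 0).number A.encode) := by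
  have h1 := spec_copyNumber (ora := ora A) (K := K) (a := a) (x := .sim 0) (y := .aux)
    (by simp) (d := .num) ha.aux (by rw [ha.sim]; exact hj) hjK
  rw [ha.sim] at h1
  set p := (T 0).number with hp
  obtain ⟨y, hy⟩ := ha.ans
  have h2 : Spec (ora A) K (put (.inl .ans) .blank) (a.setCnt .num p) () (stage a p []) := by
    refine OnTape.spec_raw (a := a.setCnt .num p) ?_
    rw [raw_setCnt, hy]
    have := onTape_put (ora := ora (k := k) A) (K := K) (r := .inl .ans) (a := .blank)
      (T := symbolTape y)
      (Nat.zero_le _)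
    change OnTape _ _ _ _ _ _ ⟨Function.update (symbolTape y).cells 0 .blank, 0⟩ at this
    rwa [update_symbolTape] at this
  refine h1.seq (h2.seq ?_)
  set s : List (CodeItem σ A.size) → Mem σ k := fun u => stage a p (u.map A.itemBit) with hs
  have hready : ∀ u, Ready A T (s u) := fun u => ha.stage p _
  have hans : ∀ u, (s u).raw.tape .ans = symbolTape (wordCells (u.map A.itemBit) p) := fun u => by
    simp [hs, RandomAccessSim.stage]
  have hnum : ∀ u, (s u).cnt .num = p - (u.map A.itemBit).length := fun u => by
    simp [hs, RandomAccessSim.stage]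
  have hnext : ∀ u i, s (u ++ [i]) = stage (s u) p (u.map A.itemBit ++ [A.itemBit i]) :=
    fun u i => by simp [hs, stage_stage]
  rw [A.encode_eq_map]
  -- The heads of the read-only tapes stay within the space, as they go only to positions of digits.
  have hlog : ∀ m < A.logSize, m ≤ K := fun m hm => hm.le.trans (A.logSize_le hK)
  refine spec_walk (s := s) (fun u => (hready u).idle) (fun i x u _ => ?_) (fun i m hm u _ => ?_)
    (fun i m hm x u _ => ?_)
  · rw [hnext, ← stage_setTuple (s u) _ _ (by simp)]
    refine spec_visit ?_ (hans u) fun y z hy hz => spec_recordBit hy hz ?_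
    · rw [cnt_setTuple_of_ne (by simp)]
      exact hnum u
    · congr 1
      refine decide_eq_decide.2 ?_
      have e : ∀ j, (((s u).setTuple (Reg.rel i) fun j => (x j : ℕ)).num (.inr (.rel i j))) =
          x j := fun j => cnt_setTuple (Reg.rel_injective i) j
      simp only [e]
      constructor
      · rintro ⟨t, ht, h⟩
        rwa [← funext fun j => Fin.ext (h j)]
      · exact fun h => ⟨x, h, fun _ => rfl⟩
  · rw [hnext, ← stage_setCnt (s u) _ _ (by simp)]
    refine spec_visit ?_ (hans u) fun y z hy hz =>
      spec_recordBit_atPosition hy hz (hlog m hm) (by simp) ((hready u).pos _) ?_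
    · rw [cnt_setCnt_of_ne _ (by simp)]
      exact hnum u
    · simp only [DirectAccessTM.oracle, DirectAccessTM.readOnlyCells, pos_setPos]
      exact wordCells_binaryWord hm
  · rw [hnext, ← stage_setCnt (s u) _ _ (by simp), ← stage_setTuple ((s u).setCnt _ _)
      _ _ (by simp)]
    refine spec_visit ?_ (hans u) fun y z hy hz =>
      spec_recordBit_atPosition (m := m) hy hz (hlog m hm) ?_ ((hready u).pos _) ?_
    · rw [cnt_setTuple_of_ne (by simp), cnt_setCnt_of_ne _ (by simp)]
      exact hnum u
    · rw [cnt_setTuple_of_ne (by simp), cnt_setCnt]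
    · simp only [ora, DirectAccessTM.oracle, DirectAccessTM.readOnlyCells, pos_setPos]
      -- The addresses are coordinates of a tuple over the domain, so the value-tape is not blank.
      have e : ∀ j, (((((s u).setCnt Reg.bit m).setTuple (Reg.func i) fun j =>
          (x j : ℕ)).setCnt Reg.bit 0).setPos (.value i) m).num (.inr (.func i j)) = x j :=
        fun j => by
          change ((((s u).setCnt Reg.bit m).setTuple (Reg.func i) fun j =>
            (x j : ℕ)).setCnt Reg.bit 0).cnt (.func i j) = x j
          rw [cnt_setCnt_of_ne _ (by simp)]
          exact cnt_setTuple (Reg.func_injective i) j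
      simp only [e, DirectAccessTM.valueWordAt]
      rw [dif_pos (fun j => (x j).2)]
      exact wordCells_binaryWord hm

end RandomAccessSim

end

/-! ### Simulating the steps of a random-access machine. -/

section

variable {σ : FinVocabulary}

namespace CounterMem

/-- The memory at the start of a computation. -/
def initial (X V H : Type) : CounterMem X V H := ⟨TapeMem.initial X H, fun _ => 0⟩

theorem rep_initial {X V H : Type} {K : ℕ} (hK : 0 < K) :
    Rep K (TapeMem.initial (X ⊕ V) H) (initial X V H) where
  raw := rfl
  space := ⟨fun _ => Nat.zero_le _, fun _ => Nat.zero_le _⟩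
  cnt _ := ⟨[false], by simp, by simpa using Nat.succ_le_of_lt hK, by simp [wordVal, initial], rfl⟩

end CounterMem

/-- The input symbol that is represented by a tape symbol. -/
def TapeSymbol.toInput : TapeSymbol → InputSymbol
  | .blank => .endMarker
  | y => .sym y

/-- If the walk has recorded nothing, the address is beyond the encoding, where the simulated
machine scans the end-marker. -/
theorem toInput_wordCells (w : List Bool) (p : ℕ) :
    (wordCells w p).toInput = inputSymbolAt w p := by
  unfold wordCells inputSymbolAt
  cases w[p]? with
  | none => rfl
  | some b => cases b <;> rfl

/-- A head before cell `K` writes only there, so the simulated tapes stay blank from `K` on. Hence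
there is always a blank within the space when the number on the address-tape is copied. -/
theorem blank_move_write {T : SemiTape} {K j : ℕ} (hT : ∀ j, K ≤ j → T.cells j = .blank)
    (hh : T.head < K) (hj : K ≤ j) (y : TapeSymbol) (d : HeadMove) :
    ((T.write y).move d).cells j = .blank := by
  rw [SemiTape.cells_move]
  simp only [SemiTape.write]
  rw [Function.update_of_ne (by omega), hT j hj]

theorem StepPath.mono {α : Type} {step : α → Option α} {N N' : α → Prop} {c d : α}
    (h : StepPath step N c d) (hN : ∀ b, N b → N' b) : StepPath step N' c d := by
  induction h with
  | refl c => exact .refl c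
  | head h1 h2 _ ih => exact .head (hN _ h1) h2 ih

namespace RandomAccessSim

open CounterMem Ctrl

variable {A : FinOrderedStructure σ} {K k : ℕ}

/-- Copy the size of the domain to a writable tape. -/
noncomputable def copySize : Control σ k Unit :=
  (untilLoop (rawStep fun o => (⟨fun _ => (none, .stay), fun _ => .stay⟩,
      decide (o.ans.1 .size = .blank)))
    (tapePosStep .buf .size fun o => ((some (o.ans.1 .size), .right), .right))).seq
  (untilLoop (rawStep fun o => (⟨fun _ => (none, .stay), fun _ => .stay⟩, o.posZero .size))
    (tapePosStep .buf .size fun _ => ((none, .left), .left)))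

/-- The tape with the size is read-only, and its symbols are seen only through the oracle. Its word
is therefore moved to an ordinary tape, from which `copyWord` can make a counter. -/
theorem spec_copySize {a : Mem σ k} (ha : a.raw.tape .buf = .ofWord [false])
    (hpos : a.raw.pos .size = 0) (hK : Nat.size A.size ≤ K) :
    Spec (ora A) K copySize a ()
      (a.setRaw .buf (.ofWord (binaryWord (Nat.size A.size) A.size))) := by
  set w := binaryWord (Nat.size A.size) A.size with hw
  have hlen : w.length = Nat.size A.size := length_binaryWord _ _
  have hlen1 : 0 < w.length := by rw [hlen]; exact Nat.size_pos.2 A.size_pos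
  -- After `i` rounds the first `i` digits are copied; behind them the initial contents `0` of the
  -- tape persist.
  set s : ℕ → Mem σ k := fun i =>
    (a.setRaw .buf ⟨fun j => if j < i then wordCells w j else wordCells [false] j, i⟩).setPos
      .size i with hs
  have hans : ∀ b : Mem σ k, (rawObs (ora A) b).ans.1 .size = wordCells w (b.raw.pos .size) :=
    fun b => rfl
  have hbuf : ∀ i, (s i).raw.tape .buf =
      ⟨fun j => if j < i then wordCells w j else wordCells [false] j, i⟩ := fun i => by simp [hs]
  have h1 := spec_untilLoop (ora := ora A) (K := K)
    (T := rawStep fun o => (⟨fun _ => (none, .stay), fun _ => .stay⟩,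
      decide (o.ans.1 .size = .blank)))
    (B := tapePosStep .buf .size fun o => ((some (o.ans.1 .size), .right), .right))
    s w.length
    (fun i hi => by
      have := spec_test (ora := ora A) (K := K) (f := fun o => decide (o.ans.1 .size = .blank))
        (a := s i)
      rw [hans, decide_eq_false (by simpa [hs, wordCells_eq_blank_iff] using hi)] at this
      exact this)
    (fun i hi => by
      have := spec_tapePosStep (ora := ora A) (K := K) (x := .buf) (h := .size)
        (f := fun o => ((some (o.ans.1 .size), .right), .right)) (a := s i) rfl (by simp) (by simp)
        (T := ⟨fun j => if j < i + 1 then wordCells w j else wordCells [false] j, i + 1⟩)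
        (by
          rw [hbuf, hans, SemiTape.act_some_right]
          congr 1
          funext j
          by_cases hj : j = i
          · subst hj
            simp [hs]
          · rw [Function.update_of_ne hj]
            simp only [show j < i + 1 ↔ j < i by omega])
        (n := i + 1) (by simp [hs, HeadMove.app]) (by simp only; omega) (by omega)
      simpa [hs, setPos_setRaw] using this)
    (by
      have := spec_test (ora := ora A) (K := K) (f := fun o => decide (o.ans.1 .size = .blank))
        (a := s w.length)
      rw [hans, decide_eq_true (by simp [hs])] at this
      exact this)
  have h2 := spec_untilLoop (ora := ora A) (K := K)
    (T := rawStep fun o => (⟨fun _ => (none, .stay), fun _ => .stay⟩, o.posZero .size))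
    (B := tapePosStep .buf .size fun _ => ((none, .left), .left))
    (fun i => (a.setRaw .buf ⟨wordCells w, w.length - i⟩).setPos .size (w.length - i)) w.length
    (fun i hi => by
      have := spec_test (ora := ora A) (K := K) (f := fun o => o.posZero .size)
        (a := (a.setRaw .buf ⟨wordCells w, w.length - i⟩).setPos .size (w.length - i))
      have e : (rawObs (ora A) ((a.setRaw .buf ⟨wordCells w, w.length - i⟩).setPos .size
          (w.length - i))).posZero .size = false := by
        simp [rawObs]; omega
      rwa [e] at this)
    (fun i hi => by
      have := spec_tapePosStep (ora := ora A) (K := K) (x := .buf) (h := .size)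
        (f := fun _ => ((none, .left), .left))
        (a := (a.setRaw .buf ⟨wordCells w, w.length - i⟩).setPos .size (w.length - i)) rfl
        (by simp; omega) (by simp; omega) (T := ⟨wordCells w, w.length - (i + 1)⟩)
        (by simp [Nat.sub_sub]) (n := w.length - (i + 1)) (by simp [HeadMove.app]; omega)
        (by simp only; omega) (by omega)
      simpa [setPos_setRaw] using this)
    (by
      have := spec_test (ora := ora A) (K := K) (f := fun o => o.posZero .size)
        (a := (a.setRaw .buf ⟨wordCells w, w.length - w.length⟩).setPos .size (w.length - w.length))
      have e : (rawObs (ora A) ((a.setRaw .buf ⟨wordCells w, w.length - w.length⟩).setPos .size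
          (w.length - w.length))).posZero .size = true := by
        simp [rawObs]
      rwa [e] at this)
  have e0 : s 0 = a := by
    simp only [hs, Nat.not_lt_zero, if_false]
    rw [setRaw_eq_self, setPos_eq_self _ hpos]
    exact ha
  -- The initial `0` in the leftmost cell has been overwritten, because the size is positive and its
  -- word nonempty.
  have e1 : s w.length = (a.setRaw .buf ⟨wordCells w, w.length - 0⟩).setPos .size
      (w.length - 0) := by
    simp only [hs, Nat.sub_zero]
    congr 3
    funext j
    split_ifs with h
    · rfl
    · have : [false].length = 1 := rfl
      rw [wordCells_of_le (by omega), wordCells_of_le (by omega)]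
  rw [e0, e1] at h1
  refine h1.seq ?_
  have e2 : (a.setRaw .buf ⟨wordCells w, w.length - w.length⟩).setPos .size
      (w.length - w.length) = a.setRaw .buf (.ofWord w) := by
    rw [Nat.sub_self, setPos_eq_self]
    · rfl
    · exact hpos
  rw [← e2]
  exact h2

/-- Blank all simulated tapes but the first one. -/
def blankTapes : Control σ k Unit :=
  rawStep fun _ => (⟨fun
    | .sim l => (if l = 0 then none else some .blank, .stay)
    | _ => (none, .stay), fun _ => .stay⟩, ())

/-- Prepare the memory for the simulation. -/
noncomputable def setup : Control σ k Unit :=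
  copySize.seq ((copyWord (.inl .buf) (.inr .num)).seq ((inc (.inr .size)).seq
    ((inc (.inr .pow)).seq ((untilLoop (eqTest .size .num .tmp) nextSize).seq blankTapes))))

/-- The size is counted up from `1` to the copied number, and its logarithm is maintained on the
way. All tapes of the memory start with `0`, whereas the simulated work-tapes have to be blank. -/
theorem exists_spec_setup (hK : 2 * A.size + 1 < 2 ^ K) :
    ∃ a : Mem σ k, Spec (ora A) K setup (initial _ _ _) () a ∧
      Ready A (fun l => if l = 0 then .ofWord [false] else .ofWord []) a := by
  set n := A.size with hn
  have hn0 : 0 < n := A.size_pos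
  have hsize : Nat.size n ≤ K := Nat.size_le.2 (by omega)
  have hK0 : K ≠ 0 := by
    rintro rfl
    omega
  set w := binaryWord (Nat.size n) n with hw
  set a₁ : Mem σ k := (initial _ _ _).setRaw .buf (.ofWord w) with ha₁
  set a₂ : Mem σ k := a₁.setCnt .num n with ha₂
  have h1 : Spec (ora A) K copySize (initial _ _ _) () a₁ := spec_copySize rfl rfl hsize
  have hbuf : a₁.raw.tape .buf = .ofWord w := by simp [ha₁]
  have h2 := spec_copyWord (ora := ora A) (K := K) (a := a₁) (x := .buf) (d := .num)
    (k := w.length) (by rw [hbuf]; rfl) (by rw [hbuf]; exact wordCells_length w)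
    (by rwa [hw, length_binaryWord])
  rw [hbuf, SemiTape.number_ofWord, wordVal_binaryWord (Nat.lt_size_self n)] at h2
  have h3 := spec_inc (ora := ora A) (K := K) (a := a₂) (v := .size)
    (by
      simp [ha₂, ha₁, initial, CounterMem.setCnt]
      omega)
  have h4 := spec_inc (ora := ora A) (K := K) (a := a₂.setCnt .size (a₂.cnt .size + 1)) (v := .pow)
    (by
      simp [ha₂, ha₁, initial, CounterMem.setCnt]
      omega)
  -- For size `1` the logarithm is `0` and the power is `1`, so two increments suffice.
  have e : (a₂.setCnt .size (a₂.cnt .size + 1)).setCnt .pow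
      ((a₂.setCnt .size (a₂.cnt .size + 1)).cnt .pow + 1) = a₂.setSize (0 + 1) := by
    simp only [CounterMem.setCnt, CounterMem.setSize, ha₂, ha₁, initial, cnt_setRaw]
    congr 1
    funext v
    cases v <;> simp
  rw [e] at h4
  have htest : ∀ i, Spec (ora A) K (eqTest .size .num .tmp) (a₂.setSize (i + 1))
      (decide (i + 1 = n)) (a₂.setSize (i + 1)) := fun i => by
    have := spec_eqTest (ora := ora A) (K := K) (a := a₂.setSize (i + 1)) (x := .size) (y := .num)
      (z := .tmp) (by simp) (by simp) (by simp)
      (by simp [CounterMem.setSize, ha₂, ha₁, initial, CounterMem.setCnt])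
    have e : decide ((a₂.setSize (i + 1)).cnt .size = (a₂.setSize (i + 1)).cnt .num) =
        decide (i + 1 = n) := by
      simp [CounterMem.setSize, ha₂, CounterMem.setCnt]
    rwa [e] at this
  have h5 := spec_untilLoop (ora := ora A) (K := K) (T := eqTest .size .num .tmp) (B := nextSize)
    (fun i => a₂.setSize (i + 1)) (n - 1)
    (fun i hi => by
      have := htest i
      rwa [decide_eq_false (by omega)] at this)
    (fun i hi => spec_nextSize (by simp [ha₂, ha₁, initial, CounterMem.setCnt])
      (by simp [ha₂, ha₁, initial, CounterMem.setCnt]) (by omega) (by omega))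
    (by
      have := htest (n - 1)
      rwa [decide_eq_true (by omega)] at this)
  rw [Nat.sub_add_cancel hn0] at h5
  have hraw : (a₂.setSize n).raw = a₁.raw := rfl
  refine ⟨_, h1.seq (h2.seq (h3.seq (h4.seq (h5.seq (spec_rawStep rfl ⟨?_, by simp⟩ ?_))))), ?_⟩
  · intro x
    cases x <;> simp
  · refine ⟨fun x => ?_, fun h => by simp [TapeMem.act, hraw, HeadMove.app, ha₁, initial,
      TapeMem.setTape, TapeMem.initial]⟩
    have : (a₁.raw.tape x).head = 0 := by
      cases x <;> simp [ha₁, initial, TapeMem.setTape, TapeMem.initial, SemiTape.ofWord]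
    rw [hraw]
    cases x <;> simp [TapeMem.act, SemiTape.act, this, HeadMove.app]
  · refine ⟨⟨?_, ?_, ?_, ?_, ?_, ?_⟩, fun l => ?_, ?_, ⟨.zero, ?_⟩, fun h => ?_⟩
    iterate 6
      simp [CounterMem.setSize, ha₂, ha₁, initial, CounterMem.setCnt,
        FinOrderedStructure.logSize, hn]
    · simp only [TapeMem.act, hraw, ha₁, raw_setRaw]
      rw [TapeMem.tape_setTape_of_ne _ (by simp)]
      change SemiTape.act (.ofWord [false]) _ = _
      split_ifs with h
      · simp
      · rw [SemiTape.act_some_stay, ofWord_false, ofWord_nil]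
        change (⟨Function.update _ 0 _, 0⟩ : SemiTape) = _
        rw [update_symbolTape]
        rfl
    · simp [TapeMem.act, hraw, ha₁, initial, TapeMem.setTape, TapeMem.initial, SemiTape.ofWord]
    · simp [TapeMem.act, hraw, ha₁, initial, TapeMem.setTape, TapeMem.initial, ofWord_false]
    · simp [TapeMem.act, hraw, ha₁, initial, TapeMem.setTape, TapeMem.initial, HeadMove.app]

instance (M : RandomAccessTM) : Finite M.State := M.finite_state

variable (M : RandomAccessTM)

open Classical in
/-- One step of the simulated machine, when the input symbol is known. -/
noncomputable def advance (q : M.State)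
    (o : TapeObs (SimTape M.numWork) (ReadOnlyTape σ) (DirectAccessTM.Answer σ)) :
    TapeAction (SimTape M.numWork) (ReadOnlyTape σ) × (M.State ⊕ Bool) :=
  match M.trans q (o.sym .ans).toInput (fun l => o.sym (.sim l)) with
  | none => (⟨fun _ => (none, .stay), fun _ => .stay⟩, .inr false)
  | some (q', act) =>
      if ∃ l, (act l).2 = .left ∧ o.atLeft (.sim l) = true then
        (⟨fun _ => (none, .stay), fun _ => .stay⟩, .inr false)
      else (⟨fun
        | .sim l => (some (act l).1, (act l).2)
        | _ => (none, .stay), fun _ => .stay⟩, .inl q')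

open Classical in
/-- Simulate one step. -/
noncomputable def simulateStep (q : M.State) : Control σ M.numWork (M.State ⊕ Bool) :=
  if q ∈ M.final then ret (.inr true) else askInput.seq (rawStep (advance M q))

variable {M}

/-- After `askInput` the transition function receives the arguments that it has in `M`. A missing
transition and a blocked move both stop `M`; the second is recognised by the observable left ends,
and either leads to the exit with `false`. -/
theorem spec_simulateStep {c : M.Config} {a : Mem σ M.numWork} (ha : Ready A c.tape a)
    (hc : c.state ∉ M.final) (hblank : ∀ l j, K ≤ j → (c.tape l).cells j = .blank)
    (hK : A.size ≤ 2 ^ K) :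
    (∀ d, M.step A.encode c = some d → (∀ l, (d.tape l).head ≤ K) →
      ∃ a', Spec (ora A) K (simulateStep M c.state) a (.inl d.state) a' ∧ Ready A d.tape a') ∧
    (M.step A.encode c = none →
      ∃ a', Spec (ora A) K (simulateStep M c.state) a (.inr false) a') := by
  have h1 := spec_askInput ha (hblank 0 K le_rfl) le_rfl hK
  set b := stage a (c.tape 0).number A.encode with hb
  have hready : Ready A c.tape b := ha.stage _ _
  have hans : b.raw.tape .ans = symbolTape (wordCells A.encode (c.tape 0).number) := by
    simp [hb, stage]
  have hobs : M.trans c.state ((rawObs (ora A) b).sym .ans).toInput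
      (fun l => (rawObs (ora A) b).sym (.sim l)) =
      M.trans c.state (inputSymbolAt A.encode (c.tape 0).number) fun l => (c.tape l).read := by
    simp only [rawObs, hans, symbolTape_read, toInput_wordCells, hready.sim]
  have hleft : ∀ l, (rawObs (ora A) b).atLeft (.sim l) = ((c.tape l).head == 0) := fun l => by
    simp only [rawObs, hready.sim]
  rw [simulateStep, if_neg hc]
  cases htr : M.trans c.state (inputSymbolAt A.encode (c.tape 0).number)
      fun l => (c.tape l).read with
  | none =>
    refine ⟨fun d hd => by simp [RandomAccessTM.step, htr] at hd, fun _ => ⟨b, h1.seq ?_⟩⟩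
    refine Spec.of_cnt_lt fun _ hs => ?_
    have := spec_rawStep (ora := ora A) (K := K) (a := b) (f := advance M c.state)
      (act := ⟨fun _ => (none, .stay), fun _ => .stay⟩) (e := .inr false)
      (by simp only [advance, hobs, htr]) ⟨by simp, by simp⟩ (by rwa [TapeMem.act_idle])
    rwa [TapeMem.act_idle] at this
  | some y =>
    obtain ⟨q, act⟩ := y
    by_cases hbl : ∃ l, (c.tape l).Blocked (act l).2
    · refine ⟨fun d hd => by simp [RandomAccessTM.step, htr, hbl] at hd, fun _ => ⟨b, h1.seq ?_⟩⟩
      refine Spec.of_cnt_lt fun _ hs => ?_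
      have := spec_rawStep (ora := ora A) (K := K) (a := b) (f := advance M c.state)
        (act := ⟨fun _ => (none, .stay), fun _ => .stay⟩) (e := .inr false)
        (by
          simp only [advance, hobs, htr, hleft]
          rw [if_pos (by simpa [SemiTape.Blocked] using hbl)])
        ⟨by simp, by simp⟩ (by rwa [TapeMem.act_idle])
      rwa [TapeMem.act_idle] at this
    · refine ⟨fun d hd hdK => ?_, fun hn => by simp [RandomAccessTM.step, htr, hbl] at hn⟩
      have hd' : (⟨q, fun l => ((c.tape l).write (act l).1).move (act l).2⟩ : M.Config) = d := by
        simpa [RandomAccessTM.step, htr, hbl] using hd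
      subst hd'
      -- The auxiliary tapes are known to be within the space only through a representing memory,
      -- which `Spec.of_cnt_lt` supplies.
      have key : ∀ hs : b.raw.InSpace K, _ := fun hs =>
        spec_rawStep (ora := ora A) (K := K) (a := b) (f := advance M c.state)
        (act := ⟨fun
          | .sim l => (some (act l).1, (act l).2)
          | _ => (none, .stay), fun _ => .stay⟩) (e := .inl q)
        (by
          simp only [advance, hobs, htr, hleft]
          rw [if_neg (by simpa [SemiTape.Blocked] using hbl)])
        ⟨fun x => by
          cases x with
          | sim l =>
            intro h h0
            rw [hready.sim] at h0
            exact hbl ⟨l, h, h0⟩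
          | _ => simp, by simp⟩ ⟨fun x => by
          cases x with
          | sim l =>
            simp only [TapeMem.act, hready.sim]
            exact hdK l
          | _ => simpa [TapeMem.act] using hs.1 _, fun h => by
            simpa [TapeMem.act, HeadMove.app] using hs.2 h⟩
      refine ⟨_, h1.seq (Spec.of_cnt_lt fun _ hs => key hs), ?_⟩
      refine ⟨hready.idle.of_eq (fun _ _ => rfl) (fun _ _ => rfl) rfl rfl rfl rfl, fun l => ?_, ?_,
        ⟨wordCells A.encode (c.tape 0).number, ?_⟩, fun h => hready.pos h⟩
      · simp only [TapeMem.act, hready.sim]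
        rfl
      · simpa [TapeMem.act] using hready.aux
      · simpa [TapeMem.act] using hans

/-- Strict bounds before each step give positions at most `K` after it, and keep all cells from `K`
on blank. Both are needed to simulate the next step. -/
theorem exists_spec_simulate {c d : M.Config} (h : StepPath (M.step A.encode)
      (fun b => b.state ∉ M.final ∧ ∀ l, (b.tape l).head < K) c d)
    {a : Mem σ M.numWork} (ha : Ready A c.tape a)
    (hblank : ∀ l j, K ≤ j → (c.tape l).cells j = .blank) (hK : A.size ≤ 2 ^ K) {x : Bool}
    (hd : d.state ∈ M.final ∧ x = true ∨
      d.state ∉ M.final ∧ M.step A.encode d = none ∧ x = false) :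
    ∃ a', Spec (ora A) K (iterate (simulateStep M) c.state) a x a' := by
  induction h generalizing a with
  | refl c =>
    rcases hd with ⟨hd, rfl⟩ | ⟨hd, hs, rfl⟩
    · refine ⟨a, Spec.iterate_done ?_⟩
      rw [simulateStep, if_pos hd]
      exact spec_ret
    · obtain ⟨a', ha'⟩ := (spec_simulateStep ha hd hblank hK).2 hs
      exact ⟨a', ha'.iterate_done⟩
  | @head c c' d hc hs _ ih =>
    have hform : ∃ act : Fin (M.numWork + 1) → TapeSymbol × HeadMove,
        ∀ l, c'.tape l = ((c.tape l).write (act l).1).move (act l).2 := by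
      unfold RandomAccessTM.step at hs
      split at hs
      · cases hs
      · split_ifs at hs
        cases hs
        exact ⟨_, fun l => rfl⟩
    obtain ⟨act, hact⟩ := hform
    obtain ⟨a', ha', hr⟩ := (spec_simulateStep ha hc.1 hblank hK).1 c' hs (fun l => by
      rw [hact, SemiTape.head_move]
      exact (HeadMove.app_le _ _).trans (hc.2 l))
    obtain ⟨a'', ha''⟩ := ih hr (fun l j hj => by
      rw [hact]
      exact blank_move_write (hblank l) (hc.2 l) hj _ _) hd
    exact ⟨a'', ha'.iterate_next ha''⟩

end RandomAccessSim

open RandomAccessSim Ctrl in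
/-- Every random-access machine is simulated by a direct-access machine, where the space `K` has to
suffice for the numbers up to twice the size of the domain. -/
theorem RandomAccessTM.exists_directAccessTM (M : RandomAccessTM) :
    ∃ M' : DirectAccessTM σ, ∀ (A : FinOrderedStructure σ) (K : ℕ), 2 * A.size + 1 < 2 ^ K →
      (M.Accepts A.encode ∨ M.Rejects A.encode) →
      (∀ l, (M.visited A.encode l).encard ≤ (K : ℕ)) →
      (M.Accepts A.encode → M'.Accepts A) ∧ (M.Rejects A.encode → M'.Rejects A) ∧
        (∀ l, (M'.visited A l).encard ≤ (K + 1 : ℕ)) ∧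
        ∀ l, (M'.visitedReadOnly A l).encard ≤ (K + 1 : ℕ) := by
  refine ⟨DirectAccessTM.ofCtrl (fun i j => .inr (.rel i j)) (fun i j => .inr (.func i j))
    (setup.seq (iterate (simulateStep M) M.start)), fun A K hK hdec hvis => ?_⟩
  have hK0 : 0 < K := by
    by_contra h
    obtain rfl : K = 0 := by omega
    omega
  -- A head starts at the left end and moves by at most one cell, so at most `K` visited cells mean
  -- positions below `K`.
  have hlt : ∀ (l : Fin (M.numWork + 1)) (x : ℕ), x ∈ M.visited A.encode l → x < K :=
    fun l x hx => lt_of_mem_visitedCells (c := M.initial) (head := fun c => (c.tape l).head)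
      (by simp only [initial]; split_ifs <;> rfl)
      (fun b d hbd => by
        unfold step at hbd
        split at hbd
        · cases hbd
        · split_ifs at hbd
          cases hbd
          simp only [SemiTape.head_move, SemiTape.head_write]
          exact HeadMove.app_le _ _) (hvis l) hx
  obtain ⟨d, hp, -, hd⟩ := exists_stepPath hdec
    (ι := Fin (M.numWork + 1)) fun l c => (c.tape l).head
  have hp' : StepPath (M.step A.encode) (fun b => b.state ∉ M.final ∧
      ∀ l, (b.tape l).head < K) M.initial d := hp.mono fun b hb => ⟨hb.1, fun l => hlt l _ (hb.2 l)⟩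
  obtain ⟨a, ha, hr⟩ := exists_spec_setup (A := A) (k := M.numWork) hK
  have hblank : ∀ l j, K ≤ j → (M.initial.tape l).cells j = .blank := fun l j hj => by
    simp only [initial]
    have : [false].length = 1 := rfl
    split_ifs
    · exact wordCells_of_le (by omega)
    · exact wordCells_of_le (w := []) (j := j) (by simp)
  have hrun : ∀ x, (d.state ∈ M.final ∧ x = true ∨
      d.state ∉ M.final ∧ M.step A.encode d = none ∧ x = false) →
      ∃ m : TapeMem (SimTape M.numWork ⊕ Reg σ) (ReadOnlyTape σ),
        (setup.seq (iterate (simulateStep M) M.start)).Runs (ora A) K (TapeMem.initial _ _) x m ∧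
          m.InSpace K := fun x hx => by
    obtain ⟨a', ha'⟩ := exists_spec_simulate hp' hr hblank (by omega) hx
    obtain ⟨m, hm, hrep⟩ := ha.seq ha' _ (CounterMem.rep_initial hK0)
    exact ⟨m, hm, hrep.inSpace⟩
  rcases hd with ⟨hacc, hd⟩ | ⟨hrej, hd, hs⟩
  · obtain ⟨m, hm, hmK⟩ := hrun true (.inl ⟨hd, rfl⟩)
    have := DirectAccessTM.ofCtrl_spec _ _ _ hm hmK
    exact ⟨fun _ => this.1 rfl, fun h => absurd hacc h.2, this.2.2⟩
  · obtain ⟨m, hm, hmK⟩ := hrun false (.inr ⟨hd, hs, rfl⟩)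
    have := DirectAccessTM.ofCtrl_spec _ _ _ hm hmK
    exact ⟨fun h => absurd h hrej.2, fun _ => this.2.1 rfl, this.2.2⟩

end

section

variable {X V H O E ι : Type} {σ : FinVocabulary}

/-! ### A random-access machine that simulates a direct-access machine -/

/-- A question on the structure: to a relation, or for a symbol on a read-only tape. -/
abbrev Query (σ : FinVocabulary) : Type := Fin σ.numRel ⊕ ReadOnlyTape σ

/-- The tapes besides the counters: the tapes of the simulated machine, of which the read-only ones
(except for the size of the domain) serve for the head positions only, an auxiliary tape, and the
answers. -/
inductive DirectTape (σ : FinVocabulary) (k : ℕ) where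
  | sim (t : WritableTape σ k)
  | ro (l : ReadOnlyTape σ)
  | aux
  | ans (q : Query σ)

instance (k : ℕ) : Finite (DirectTape σ k) :=
  Finite.of_injective
    (β := WritableTape σ k ⊕ ReadOnlyTape σ ⊕ Query σ ⊕ Unit)
    (fun | .sim t => .inl t | .ro l => .inr (.inl l) | .ans q => .inr (.inr (.inl q))
         | .aux => .inr (.inr (.inr ())))
    (by intro x y h; cases x <;> cases y <;> simp_all)

noncomputable instance (k : ℕ) : DecidableEq (DirectTape σ k) := Classical.decEq _

/-- The elements of a finite type. -/
noncomputable def elements (α : Type) [Finite α] : List α :=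
  (@Finset.univ α (Fintype.ofFinite α)).toList

theorem mem_elements {α : Type} [Finite α] (x : α) : x ∈ elements α := by
  simp [elements]

namespace Ctrl

open CounterMem

variable {ora : (X ⊕ V → ℕ) → (H → ℕ) → O} {K : ℕ}

/-- The version of `spec_seqList` with an invariant, for the case that the resulting memories are
not given explicitly. -/
theorem exists_spec_seqList (l : List ι) (f : ι → Ctrl (X ⊕ V) H O Unit)
    (I : List ι → CounterMem X V H → Prop)
    (h : ∀ u i a, I u a → ∃ a', Spec ora K (f i) a () a' ∧ I (u ++ [i]) a')
    {a : CounterMem X V H} (ha : I [] a) :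
    ∃ a', Spec ora K (seqList (l.map f)) a () a' ∧ I l a' := by
  suffices ∀ v u a, I u a → ∃ a', Spec ora K (seqList (v.map f)) a () a' ∧ I (u ++ v) a' from
    this l [] a ha
  intro v
  induction v with
  | nil => exact fun u a hu => ⟨a, spec_ret, by simpa using hu⟩
  | cons i v ih =>
    intro u a hu
    obtain ⟨a₁, h1, h1'⟩ := h u i a hu
    obtain ⟨a₂, h2, h2'⟩ := ih _ a₁ h1'
    exact ⟨a₂, h1.seq h2, by simpa using h2'⟩

/-- All tests succeed. -/
def allTest (l : List (Ctrl (X ⊕ V) H O Bool)) : Ctrl (X ⊕ V) H O Bool :=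
  l.foldr andTest (ret true)

theorem spec_allTest (l : List ι) (f : ι → Ctrl (X ⊕ V) H O Bool) (g : ι → Bool)
    {a : CounterMem X V H} (h : ∀ i, Spec ora K (f i) a (g i) a) :
    Spec ora K (allTest (l.map f)) a (l.all g) a := by
  induction l with
  | nil => exact spec_ret
  | cons i l ih => exact spec_andTest (h i) ih

end Ctrl

namespace DirectAccessSim

open CounterMem Ctrl

abbrev Mem (σ : FinVocabulary) (k : ℕ) : Type := CounterMem (DirectTape σ k) (Reg σ) Empty

abbrev Control (σ : FinVocabulary) (k : ℕ) (E : Type) : Type 1 :=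
  Ctrl (DirectTape σ k ⊕ Reg σ) Empty InputSymbol E

/-- The oracle: a counter is the address-tape. -/
noncomputable abbrev ora (w : List Bool) {k : ℕ} :
    (DirectTape σ k ⊕ Reg σ → ℕ) → (Empty → ℕ) → InputSymbol :=
  RandomAccessTM.oracle w (.inr .addr)

variable {w : List Bool} {A : FinOrderedStructure σ} {K k : ℕ}

/-- Store the number on the tape `t`, or the size of the domain if that is smaller, in the
counter `v`. -/
noncomputable def loadNumber (t : WritableTape σ k) (v : Reg σ) : Control σ k Unit :=
  (copyNumber (.sim t) .aux .num).seq ((setZero v).seq (forLoop .bit .size .tmp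
    ((isZero (.inr .num)).bind fun z =>
      if z then ret () else (dec (.inr .num)).seq (inc (.inr v)))))

/-- In each of `n` rounds one unit is moved from the copy to `v`, as long as there is one; this
yields the minimum. -/
theorem spec_loadNumber {n l : ℕ} {a : Mem σ k} (ha : a.Idle n l) {t : WritableTape σ k} {v : Reg σ}
    (hbit : v ≠ .bit) (hsize : v ≠ .size) (htmp : v ≠ .tmp) (hnum : v ≠ .num)
    (haux : (a.raw.tape .aux).head = 0) (hblank : (a.raw.tape (.sim t)).cells K = .blank) :
    ∃ y, Spec (ora w) K (loadNumber t v) a ()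
      ((a.setCnt .num y).setCnt v (min (a.raw.tape (.sim t)).number n)) := by
  set x := (a.raw.tape (.sim t)).number with hx
  -- What is left of the copy after `n` rounds, with truncated subtraction.
  refine ⟨x - n, Spec.of_cnt_lt fun hlt _ => ?_⟩
  have hn : n < 2 ^ K := ha.size ▸ hlt .size
  have h1 := spec_copyNumber (ora := ora w) (K := K) (a := a) (x := .sim t) (y := .aux) (by simp)
    (d := .num) haux hblank le_rfl
  rw [← hx] at h1
  have h2 := spec_setZero (ora := ora w) (K := K) (a := a.setCnt .num x) (v := v)
  set s : ℕ → Mem σ k := fun i => (a.setCnt .num (x - i)).setCnt v (min x i) with hs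
  have h3 := spec_forLoop (ora := ora w) (K := K) (t := .bit) (b := .size) (z := .tmp)
    (by simp) (by simp) (by simp) (n := n) s
    (B := (isZero (.inr .num)).bind fun z =>
      if z then ret () else (dec (.inr .num)).seq (inc (.inr v)))
    (fun i _ => by simp [hs, CounterMem.setCnt, hbit.symm, ha.bit])
    (fun i _ => by simp [hs, CounterMem.setCnt, hsize.symm, ha.size])
    (fun i _ => by simp [hs, CounterMem.setCnt, htmp.symm, ha.tmp])
    (fun i hi => by
      have hnum' : ((s i).setCnt .bit i).cnt .num = x - i := by
        simp [hs, CounterMem.setCnt, hnum.symm]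
      have hv' : ((s i).setCnt .bit i).cnt v = min x i := by
        simp [hs, CounterMem.setCnt, hbit]
      refine spec_isZero.bind ?_
      rw [hnum']
      by_cases h : x ≤ i
      · have e : (x - i == 0) = true := by simpa [Nat.sub_eq_zero_iff_le] using h
        rw [e, if_pos rfl]
        have e' : s i = s (i + 1) := by
          simp only [hs]
          rw [show x - i = x - (i + 1) by omega, show min x i = min x (i + 1) by omega]
        rw [e']
        exact spec_ret
      · have e : (x - i == 0) = false := by simp; omega
        rw [e, if_neg (by simp)]
        have d1 := spec_dec (ora := ora w) (K := K) (a := (s i).setCnt .bit i) (v := .num)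
          (by rw [hnum']; omega)
        refine d1.seq ?_
        rw [hnum']
        have d2 := spec_inc (ora := ora w) (K := K) (v := v)
          (a := ((s i).setCnt .bit i).setCnt .num (x - i - 1))
          (by rw [cnt_setCnt_of_ne _ hnum, hv']; omega)
        rw [cnt_setCnt_of_ne _ hnum, hv'] at d2
        have e' : (((s i).setCnt .bit i).setCnt .num (x - i - 1)).setCnt v (min x i + 1) =
            (s (i + 1)).setCnt .bit i := by
          simp only [hs, CounterMem.setCnt]
          congr 1
          funext v'
          by_cases h1 : v' = v
          · subst h1
            simp [hbit]
            omega
          · by_cases h2 : v' = .num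
            · subst h2
              simp [h1]
              omega
            · by_cases h3 : v' = .bit
              · subst h3; simp [h1]
              · simp [h1, h2, h3]
        rwa [e'] at d2)
  refine h1.seq (h2.seq ?_)
  simpa [hs] using h3

/-- Store the number on an address-tape. -/
noncomputable def load : WritableTape σ k → Control σ k Unit
  | .relAddr i j => loadNumber (.relAddr i j) (.relArg i j)
  | .funAddr i j => loadNumber (.funAddr i j) (.funcArg i j)
  | .work _ => ret ()

/-- The memory represents the tapes `T` and `U` of the simulated machine; of `U`, the contents of
the value- and constant-tapes are not represented. -/
structure Ready (A : FinOrderedStructure σ) (T : WritableTape σ k → SemiTape)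
    (U : ReadOnlyTape σ → SemiTape) (a : Mem σ k) : Prop where
  idle : a.Idle A.size A.logSize
  sim : ∀ t, a.raw.tape (.sim t) = T t
  ro : a.raw.tape (.ro .size) = U .size
  roHead : ∀ l, (a.raw.tape (.ro l)).head = (U l).head
  aux : (a.raw.tape .aux).head = 0
  ans : ∀ q, ∃ y, a.raw.tape (.ans q) = symbolTape y
  addr : a.cnt .addr = 0

/-- The memory is prepared for a walk. -/
structure Loaded (A : FinOrderedStructure σ) (T : WritableTape σ k → SemiTape)
    (U : ReadOnlyTape σ → SemiTape) (a : Mem σ k) : Prop extends Ready A T U a where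
  blank : ∀ q, a.raw.tape (.ans q) = symbolTape .blank
  relArg : ∀ i j, a.cnt (.relArg i j) = min (T (.relAddr i j)).number A.size
  funcArg : ∀ i j, a.cnt (.funcArg i j) = min (T (.funAddr i j)).number A.size
  head : ∀ l, a.cnt (.head l) = (U l).head

/-- Store the arguments and head positions, and erase the answers. -/
noncomputable def loadAll : Control σ k Unit :=
  (seqList ((elements (WritableTape σ k)).map load)).seq
  ((seqList ((elements (ReadOnlyTape σ)).map fun l => readHead (.ro l) .aux (.head l))).seq
  (seqList ((elements (Query σ)).map fun q => put (.inl (.ans q)) .blank)))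

/-- Each of the three lists is treated with an invariant on the entries processed so far. Saving a
value does not disturb the representation of the simulated tapes, and every tape and query occurs in
its list. -/
theorem exists_spec_loadAll {T : WritableTape σ k → SemiTape} {U : ReadOnlyTape σ → SemiTape}
    {a : Mem σ k} (ha : Ready A T U a) (hblank : ∀ t, (T t).cells K = .blank) :
    ∃ a', Spec (ora w) K loadAll a () a' ∧ Loaded A T U a' := by
  obtain ⟨a₁, h1, hr₁, hrel₁, hfunc₁⟩ := exists_spec_seqList (ora := ora w) (K := K)
    (elements (WritableTape σ k)) load
    (fun u b => Ready A T U b ∧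
      (∀ i j, .relAddr i j ∈ u → b.cnt (.relArg i j) = min (T (.relAddr i j)).number A.size) ∧
      (∀ i j, .funAddr i j ∈ u → b.cnt (.funcArg i j) = min (T (.funAddr i j)).number A.size))
    (fun u t b ⟨hb, hrel, hfunc⟩ => by
      cases t with
      | work t => exact ⟨b, spec_ret, hb, by simpa using hrel, by simpa using hfunc⟩
      | relAddr i j =>
        obtain ⟨y, h⟩ := spec_loadNumber (w := w) (K := K) hb.idle (t := .relAddr i j)
          (v := .relArg i j) (by simp) (by simp) (by simp) (by simp) hb.aux
          (by rw [hb.sim]; exact hblank _)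
        rw [hb.sim] at h
        refine ⟨_, h, ⟨hb.idle.of_eq ?_ ?_ ?_ ?_ ?_ ?_, hb.sim, hb.ro, hb.roHead, hb.aux, hb.ans,
          ?_⟩, fun i' j' h => ?_, fun i' j' h => ?_⟩
        iterate 6 simp [CounterMem.setCnt]
        · simpa [CounterMem.setCnt] using hb.addr
        · by_cases e : (Reg.relArg i' j' : Reg σ) = .relArg i j
          · cases e
            simp
          · rw [cnt_setCnt_of_ne _ e, cnt_setCnt_of_ne _ (by simp)]
            refine hrel _ _ ((List.mem_append.1 h).resolve_right fun h' => e ?_)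
            cases List.mem_singleton.1 h'
            rfl
        · rw [cnt_setCnt_of_ne _ (by simp), cnt_setCnt_of_ne _ (by simp)]
          exact hfunc _ _ (by simpa using h)
      | funAddr i j =>
        obtain ⟨y, h⟩ := spec_loadNumber (w := w) (K := K) hb.idle (t := .funAddr i j)
          (v := .funcArg i j) (by simp) (by simp) (by simp) (by simp) hb.aux
          (by rw [hb.sim]; exact hblank _)
        rw [hb.sim] at h
        refine ⟨_, h, ⟨hb.idle.of_eq ?_ ?_ ?_ ?_ ?_ ?_, hb.sim, hb.ro, hb.roHead, hb.aux, hb.ans,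
          ?_⟩, fun i' j' h => ?_, fun i' j' h => ?_⟩
        iterate 6 simp [CounterMem.setCnt]
        · simpa [CounterMem.setCnt] using hb.addr
        · rw [cnt_setCnt_of_ne _ (by simp), cnt_setCnt_of_ne _ (by simp)]
          exact hrel _ _ (by simpa using h)
        · by_cases e : (Reg.funcArg i' j' : Reg σ) = .funcArg i j
          · cases e
            simp
          · rw [cnt_setCnt_of_ne _ e, cnt_setCnt_of_ne _ (by simp)]
            refine hfunc _ _ ((List.mem_append.1 h).resolve_right fun h' => e ?_)
            cases List.mem_singleton.1 h'
            rfl)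
    ⟨ha, by simp, by simp⟩
  obtain ⟨a₂, h2, hr₂, hrel₂, hfunc₂, hhead₂⟩ := exists_spec_seqList (ora := ora w) (K := K)
    (elements (ReadOnlyTape σ)) (fun l => readHead (.ro l) .aux (.head l))
    (fun u b => Ready A T U b ∧
      (∀ i j, b.cnt (.relArg i j) = min (T (.relAddr i j)).number A.size) ∧
      (∀ i j, b.cnt (.funcArg i j) = min (T (.funAddr i j)).number A.size) ∧
      (∀ l ∈ u, b.cnt (.head l) = (U l).head))
    (fun u l b ⟨hb, hrel, hfunc, hhead⟩ => by
      have h := spec_readHead (ora := ora w) (K := K) (a := b) (x := .ro l) (y := .aux)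
        (v := .head l) (by simp) hb.aux
      rw [hb.roHead] at h
      refine ⟨_, h, ⟨hb.idle.of_eq ?_ ?_ ?_ ?_ ?_ ?_, hb.sim, hb.ro, hb.roHead, hb.aux, hb.ans,
        ?_⟩, fun i j => ?_, fun i j => ?_, fun l' hl' => ?_⟩
      iterate 6 simp [CounterMem.setCnt]
      · simpa [CounterMem.setCnt] using hb.addr
      · simpa [CounterMem.setCnt] using hrel i j
      · simpa [CounterMem.setCnt] using hfunc i j
      · by_cases e : l' = l
        · subst e
          simp
        · rw [cnt_setCnt_of_ne _ (by simpa using e)]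
          exact hhead _ (by simpa [e] using hl'))
    ⟨hr₁, fun i j => hrel₁ i j (mem_elements _), fun i j => hfunc₁ i j (mem_elements _), by simp⟩
  obtain ⟨a₃, h3, hr₃, hans₃, hcnt₃⟩ := exists_spec_seqList (ora := ora w) (K := K)
    (elements (Query σ)) (fun q => put (.inl (.ans q)) .blank)
    (fun u b => Ready A T U b ∧ (∀ q ∈ u, b.raw.tape (.ans q) = symbolTape .blank) ∧
      b.cnt = a₂.cnt)
    (fun u q b ⟨hb, hans, hcnt⟩ => by
      obtain ⟨y, hy⟩ := hb.ans q
      have h : Spec (ora w) K (put (.inl (.ans q)) .blank) b ()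
          (b.setRaw (.ans q) (symbolTape .blank)) := by
        refine OnTape.spec_raw ?_
        rw [hy]
        have := onTape_put (ora := ora (k := k) (σ := σ) w) (K := K) (r := .inl (.ans q))
          (a := .blank) (T := symbolTape y) (Nat.zero_le _)
        change OnTape _ _ _ _ _ _ ⟨Function.update (symbolTape y).cells 0 .blank, 0⟩ at this
        rwa [update_symbolTape] at this
      refine ⟨_, h, ⟨hb.idle.of_eq (fun _ _ => rfl) (fun _ _ => rfl) rfl rfl rfl rfl, fun t => ?_,
        ?_, fun l => ?_, ?_, fun q' => ?_, hb.addr⟩, fun q' hq' => ?_, hcnt⟩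
      · rw [raw_setRaw, TapeMem.tape_setTape_of_ne _ (by simp)]
        exact hb.sim t
      · rw [raw_setRaw, TapeMem.tape_setTape_of_ne _ (by simp)]
        exact hb.ro
      · rw [raw_setRaw, TapeMem.tape_setTape_of_ne _ (by simp)]
        exact hb.roHead l
      · rw [raw_setRaw, TapeMem.tape_setTape_of_ne _ (by simp)]
        exact hb.aux
      · by_cases e : q' = q
        · subst e
          exact ⟨_, TapeMem.tape_setTape _ _ _⟩
        · rw [raw_setRaw, TapeMem.tape_setTape_of_ne _ (by simpa using e)]
          exact hb.ans q'
      · by_cases e : q' = q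
        · subst e
          exact TapeMem.tape_setTape _ _ _
        · rw [raw_setRaw, TapeMem.tape_setTape_of_ne _ (by simpa using e)]
          exact hans q' (by simpa [e] using hq'))
    ⟨hr₂, by simp, rfl⟩
  exact ⟨a₃, h1.seq (h2.seq h3), ⟨hr₃, fun q => hans₃ q (mem_elements q),
    fun i j => by rw [hcnt₃]; exact hrel₂ i j, fun i j => by rw [hcnt₃]; exact hfunc₂ i j,
    fun l => by rw [hcnt₃]; exact hhead₂ l (mem_elements l)⟩⟩

end DirectAccessSim

end

/-! ### Answering all queries in one walk over the input. -/

section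

variable {σ : FinVocabulary}

/-- The tape symbol that is represented by an input symbol. -/
def InputSymbol.toTape : InputSymbol → TapeSymbol
  | .sym y => y
  | .endMarker => .blank

theorem mem_lexTuples {n r : ℕ} (x : Fin r → Fin n) : x ∈ lexTuples n r := by
  induction r with
  | zero => simpa [lexTuples] using Subsingleton.elim _ _
  | succ r ih =>
    simp only [lexTuples, List.mem_flatMap, List.mem_map]
    exact ⟨x 0, List.mem_finRange _, Fin.tail x, ih _, Fin.cons_self_tail x⟩

theorem rel_mem_codeItems {n l : ℕ} (i : Fin σ.numRel) (x : Fin (σ.relArity i) → Fin n) :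
    .rel i x ∈ codeItems σ n l := by
  simp [codeItems, mem_lexTuples]

theorem const_mem_codeItems {n l m : ℕ} (i : Fin σ.numConst) :
    .const i m ∈ codeItems σ n l ↔ m < l := by
  simp [codeItems]

theorem func_mem_codeItems {n l m : ℕ} (i : Fin σ.numFun) (x : Fin (σ.funArity i) → Fin n) :
    .func i m x ∈ codeItems σ n l ↔ m < l := by
  simp [codeItems, mem_lexTuples]

/-- The query to which a bit of the encoding belongs. -/
def CodeItem.query {n : ℕ} : CodeItem σ n → Query σ
  | .rel i _ => .inl i
  | .const i _ => .inr (.const i)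
  | .func i _ _ => .inr (.value i)

namespace DirectAccessSim

open CounterMem Ctrl

variable {A : FinOrderedStructure σ} {K k : ℕ} {T : WritableTape σ k → SemiTape}
  {U : ReadOnlyTape σ → SemiTape}

/-- The bit of the encoding is asked for by the address-tapes and head positions. -/
def Asked (T : WritableTape σ k → SemiTape) (U : ReadOnlyTape σ → SemiTape) {n : ℕ} :
    CodeItem σ n → Prop
  | .rel i x => ∀ j, (x j : ℕ) = (T (.relAddr i j)).number
  | .const i m => m = (U (.const i)).head
  | .func i m x => m = (U (.value i)).head ∧ ∀ j, (x j : ℕ) = (T (.funAddr i j)).number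

open Classical in
/-- The answer to a query from the bits of a list. -/
noncomputable def found (A : FinOrderedStructure σ) (T : WritableTape σ k → SemiTape)
    (U : ReadOnlyTape σ → SemiTape) (u : List (CodeItem σ A.size)) (q : Query σ) : TapeSymbol :=
  u.foldl (fun y x => if x.query = q ∧ Asked T U x then .ofBool (A.itemBit x) else y) .blank

open Classical in
theorem found_append (u : List (CodeItem σ A.size)) (x : CodeItem σ A.size) (q : Query σ) :
    found A T U (u ++ [x]) q =
      if x.query = q ∧ Asked T U x then .ofBool (A.itemBit x) else found A T U u q := by
  simp [found]

theorem found_eq_blank {u : List (CodeItem σ A.size)} {q : Query σ}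
    (h : ∀ x ∈ u, x.query = q → ¬ Asked T U x) : found A T U u q = .blank := by
  induction u using List.reverseRecOn with
  | nil => rfl
  | append_singleton u x ih =>
    rw [found_append, if_neg (fun hx => h x (by simp) hx.1 hx.2)]
    exact ih fun y hy => h y (by simp [hy])

/-- A later item could replace the recorded answer only if it were asked for as well. -/
theorem found_eq_of_unique {u : List (CodeItem σ A.size)} {q : Query σ} {x : CodeItem σ A.size}
    (hx : x ∈ u) (hq : x.query = q) (ha : Asked T U x)
    (h : ∀ y ∈ u, y.query = q → Asked T U y → y = x) :
    found A T U u q = .ofBool (A.itemBit x) := by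
  induction u using List.reverseRecOn with
  | nil => simp at hx
  | append_singleton u y ih =>
    rw [found_append]
    split_ifs with hy
    · rw [h y (by simp) hy.1 hy.2]
    · refine ih ?_ fun z hz => h z (by simp [hz])
      refine (List.mem_append.1 hx).resolve_right fun hxy => hy ?_
      rw [← List.mem_singleton.1 hxy]
      exact ⟨hq, ha⟩

/-- The addresses determine the tuple. If some address is outside the domain, nothing is recorded,
and the query is answered negatively as it should be. -/
theorem found_rel (i : Fin σ.numRel) :
    found A T U (codeItems σ A.size A.logSize) (.inl i) = .one ↔
      ∃ t ∈ A.rel i, ∀ j, (t j : ℕ) = (T (.relAddr i j)).number := by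
  by_cases h : ∃ t : Fin (σ.relArity i) → Fin A.size, ∀ j, (t j : ℕ) = (T (.relAddr i j)).number
  · obtain ⟨t, ht⟩ := h
    have huniq : ∀ t' : Fin (σ.relArity i) → Fin A.size,
        (∀ j, (t' j : ℕ) = (T (.relAddr i j)).number) → t' = t :=
      fun t' ht' => funext fun j => Fin.ext ((ht' j).trans (ht j).symm)
    rw [found_eq_of_unique (q := .inl i) (x := .rel i t) (rel_mem_codeItems i t) rfl ht
      fun y _ hq hy => by
      cases y with
      | rel i' x =>
        obtain rfl : i' = i := by simpa [CodeItem.query] using hq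
        rw [huniq x hy]
      | const => simp [CodeItem.query] at hq
      | func => simp [CodeItem.query] at hq]
    have : TapeSymbol.ofBool (A.itemBit (.rel i t)) = .one ↔ t ∈ A.rel i := by
      by_cases h : t ∈ A.rel i <;> simp [FinOrderedStructure.itemBit, h, TapeSymbol.ofBool]
    rw [this]
    exact ⟨fun h => ⟨t, h, ht⟩, fun ⟨t', h, ht'⟩ => huniq t' ht' ▸ h⟩
  · rw [found_eq_blank fun x _ hq hx => ?_]
    · simp only [reduceCtorEq, false_iff]
      exact fun ⟨t, _, ht⟩ => h ⟨t, ht⟩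
    · cases x with
      | rel i' x =>
        obtain rfl : i' = i := by simpa [CodeItem.query] using hq
        exact h ⟨x, hx⟩
      | const => simp [CodeItem.query] at hq
      | func => simp [CodeItem.query] at hq

/-- The head selects one digit; beyond the last digit nothing is recorded, and the simulated tape is
blank there too. -/
theorem found_const (i : Fin σ.numConst) :
    found A T U (codeItems σ A.size A.logSize) (.inr (.const i)) =
      wordCells (A.encodeConst i) (U (.const i)).head := by
  by_cases h : (U (.const i)).head < A.logSize
  · rw [found_eq_of_unique (q := .inr (.const i)) (x := .const i (U (.const i)).head)
    ((const_mem_codeItems i).2 h) rfl rfl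
      fun y _ hq hy => by
        cases y with
        | const i' x =>
          obtain rfl : i' = i := by simpa [CodeItem.query] using hq
          rw [show x = _ from hy]
        | rel => simp [CodeItem.query] at hq
        | func => simp [CodeItem.query] at hq]
    rw [FinOrderedStructure.encodeConst, wordCells_binaryWord h]
    rfl
  · rw [found_eq_blank fun x hmem hq hx => ?_, FinOrderedStructure.encodeConst,
      wordCells_of_le (by rw [length_binaryWord]; omega)]
    cases x with
    | const i' x =>
      obtain rfl : i' = i := by simpa [CodeItem.query] using hq
      rw [show x = _ from hx, const_mem_codeItems] at hmem
      exact h hmem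
    | rel => simp [CodeItem.query] at hq
    | func => simp [CodeItem.query] at hq

/-- Nothing is recorded if an address is outside the domain or the head is beyond the last digit,
and in precisely these cases the simulated value-tape shows a blank. -/
theorem found_value (i : Fin σ.numFun) :
    found A T U (codeItems σ A.size A.logSize) (.inr (.value i)) =
      wordCells (DirectAccessTM.valueWordAt A i fun j => (T (.funAddr i j)).number)
        (U (.value i)).head := by
  by_cases h : (∀ j, (T (.funAddr i j)).number < A.size) ∧ (U (.value i)).head < A.logSize
  · obtain ⟨h, hlog⟩ := h
    rw [found_eq_of_unique (q := .inr (.value i)) (x := .func i (U (.value i)).head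
      fun j => ⟨_, h j⟩)
      ((func_mem_codeItems i _).2 hlog) rfl ⟨rfl, fun j => rfl⟩
      fun y _ hq hy => by
        cases y with
        | func i' m x =>
          obtain rfl : i' = i := by simpa [CodeItem.query] using hq
          obtain ⟨rfl, hx⟩ := hy
          rw [show x = fun j => ⟨_, h j⟩ from funext fun j => Fin.ext (hx j)]
        | rel => simp [CodeItem.query] at hq
        | const => simp [CodeItem.query] at hq]
    rw [DirectAccessTM.valueWordAt, dif_pos h, wordCells_binaryWord hlog]
    rfl
  · rw [found_eq_blank fun x hmem hq hx => ?_]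
    · rw [DirectAccessTM.valueWordAt]
      split_ifs with h'
      · rw [wordCells_of_le (by rw [length_binaryWord]; exact not_lt.1 fun hl => h ⟨h', hl⟩)]
      · rw [wordCells_of_le (by simp)]
    · cases x with
      | func i' m x =>
        obtain rfl : i' = i := by simpa [CodeItem.query] using hq
        obtain ⟨rfl, hx⟩ := hx
        exact h ⟨fun j => hx j ▸ (x j).2, (func_mem_codeItems _ x).1 hmem⟩
      | rel => simp [CodeItem.query] at hq
      | const => simp [CodeItem.query] at hq

/-- The memory with other answers and another address. -/
noncomputable def withAnswers (a : Mem σ k) (f : Query σ → TapeSymbol) (p : ℕ) : Mem σ k :=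
  ⟨⟨fun
    | .ans q => symbolTape (f q)
    | x => a.raw.tape x, a.raw.pos⟩, Function.update a.cnt .addr p⟩

theorem withAnswers_withAnswers (a : Mem σ k) (f g : Query σ → TapeSymbol) (p r : ℕ) :
    withAnswers (withAnswers a f p) g r = withAnswers a g r := by
  simp only [withAnswers, Function.update_idem]
  congr 2
  funext x
  cases x <;> rfl

theorem withAnswers_setCnt (a : Mem σ k) (f : Query σ → TapeSymbol) (p : ℕ) {v : Reg σ}
    (hv : v ≠ .addr) (x : ℕ) :
    withAnswers (a.setCnt v x) f p = (withAnswers a f p).setCnt v x := by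
  simp only [withAnswers, CounterMem.setCnt]
  rw [Function.update_comm hv]

theorem withAnswers_setTuple (a : Mem σ k) (f : Query σ → TapeSymbol) (p : ℕ) {r : ℕ}
    {t : Fin r → Reg σ} (ht : ∀ j, t j ≠ .addr) (x : Fin r → ℕ) :
    withAnswers (a.setTuple t x) f p = (withAnswers a f p).setTuple t x := by
  have := setTuple_setCnt (a := a) (t := t) (b := x) ht p
  simp only [withAnswers, CounterMem.setCnt, CounterMem.setTuple, CounterMem.mk.injEq] at this ⊢
  exact ⟨trivial, this.2⟩

theorem Ready.withAnswers {a : Mem σ k} (h : Ready A T U a) (f : Query σ → TapeSymbol) (p : ℕ) :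
    (withAnswers a f p).Idle A.size A.logSize := by
  refine h.idle.of_eq ?_ ?_ ?_ ?_ ?_ ?_
  all_goals simp [DirectAccessSim.withAnswers]

/-- Record the current input symbol as the answer to the query `q` if the test succeeds, and go to
the next input symbol. -/
noncomputable def visit (q : Query σ) (P : Control σ k Bool) : Control σ k Unit :=
  P.bind fun b => (if b then record (.ans q) fun _ o => o.toTape else ret ()).seq (inc (.inr .addr))

open Classical in
-- The address equals the number of items visited, so the scanned input symbol is the bit of the
-- current item. It is recorded if the item is asked for, and the address moves on in any case.
theorem spec_visit {w : List Bool} {P : Control σ k Bool} {b : Mem σ k} {x : CodeItem σ A.size}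
    {u : List (CodeItem σ A.size)} (hP : Spec (ora w) K P b (decide (Asked T U x)) b)
    (hans : ∀ q, b.raw.tape (.ans q) = symbolTape (found A T U u q))
    (haddr : b.cnt .addr = u.length) (hlt : u.length + 1 < 2 ^ K)
    (hx : inputSymbolAt w u.length = .sym (.ofBool (A.itemBit x))) :
    Spec (ora w) K (visit x.query P) b ()
      (withAnswers b (found A T U (u ++ [x])) (u ++ [x]).length) := by
  refine hP.bind ?_
  by_cases h : Asked T U x
  · rw [decide_eq_true h, if_pos rfl]
    have h1 := spec_record (ora := ora w) (K := K) (g := fun _ o => o.toTape) (hans x.query)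
      (z := .ofBool (A.itemBit x)) (by
        change (inputSymbolAt w (b.cnt .addr)).toTape = _
        rw [haddr, hx]
        rfl)
    have h2 := spec_inc (ora := ora w) (K := K) (v := .addr)
      (a := b.setRaw (.ans x.query) (symbolTape (.ofBool (A.itemBit x))))
      (by rw [cnt_setRaw, haddr]; exact hlt)
    rw [cnt_setRaw, haddr] at h2
    refine h1.seq ?_
    convert h2 using 1
    simp only [withAnswers, CounterMem.setCnt, CounterMem.setRaw, TapeMem.setTape,
      List.length_append, List.length_singleton]
    congr 2
    funext y
    cases y with
    | ans q =>
      simp only [found_append, h, and_true]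
      by_cases hq : x.query = q
      · subst hq; simp
      · rw [if_neg hq, Function.update_of_ne (by simpa using Ne.symm hq), hans]
    | _ => rw [Function.update_of_ne (by simp)]
  · rw [decide_eq_false h, if_neg (by simp)]
    have h2 := spec_inc (ora := ora w) (K := K) (v := .addr) (a := b) (by rw [haddr]; exact hlt)
    rw [haddr] at h2
    refine spec_ret.seq ?_
    convert h2 using 1
    simp only [withAnswers, CounterMem.setCnt, List.length_append, List.length_singleton]
    congr 2
    funext y
    cases y with
    | ans q => simp only [found_append, h, and_false, if_false, hans]
    | _ => rfl

/-- Find the answers to all queries. -/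
noncomputable def askAll : Control σ k Unit :=
  (walk
    (fun i => visit (.inl i) (allTest ((List.finRange _).map fun j =>
      eqTest (.rel i j) (.relArg i j) .tmp)))
    (fun i => visit (.inr (.const i)) (eqTest .bit (.head (.const i)) .tmp))
    (fun i => visit (.inr (.value i)) (andTest (eqTest .bit (.head (.value i)) .tmp)
      (allTest ((List.finRange _).map fun j => eqTest (.func i j) (.funcArg i j) .tmp))))).seq
  (setZero .addr)

/-- The loop counters run below `n`, so truncating the saved addresses at `n` does not affect the
comparison. -/
theorem eq_min_iff {x y n : ℕ} (h : x < n) : x = min y n ↔ x = y := by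
  omega

/-- The walk with the invariant that the answers are those found among the visited items, and that
the address is their number. -/
theorem spec_askAll {a : Mem σ k} (ha : Loaded A T U a) (hK : A.encode.length < 2 ^ K) :
    Spec (ora A.encode) K askAll a ()
      (withAnswers a (found A T U (codeItems σ A.size A.logSize)) 0) := by
  classical
  set s : List (CodeItem σ A.size) → Mem σ k := fun u => withAnswers a (found A T U u) u.length
    with hs
  have hidle : ∀ u, (s u).Idle A.size A.logSize := fun u => ha.toReady.withAnswers _ _
  have hnext : ∀ u x, s (u ++ [x]) = withAnswers (s u) (found A T U (u ++ [x])) (u ++ [x]).length :=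
    fun u x => by simp only [hs, withAnswers_withAnswers]
  have hans : ∀ u q, (s u).raw.tape (.ans q) = symbolTape (found A T U u q) := fun u q => rfl
  have haddr : ∀ u, (s u).cnt .addr = u.length := fun u => by simp [hs, withAnswers]
  have hcnt : ∀ u v, v ≠ .addr → (s u).cnt v = a.cnt v := fun u v hv => by
    simp [hs, withAnswers, hv]
  -- From the prefix condition of the walk: the address still fits into its counter, and the input
  -- symbol there is the bit of `x`.
  have hpre : ∀ {u x}, u ++ [x] <+: codeItems σ A.size A.logSize → u.length + 1 < 2 ^ K ∧
      inputSymbolAt A.encode u.length = .sym (.ofBool (A.itemBit x)) := by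
    rintro u x ⟨v, hv⟩
    have hlen : A.encode.length = u.length + 1 + v.length := by
      rw [A.encode_eq_map, List.length_map, ← hv]
      simp
      omega
    refine ⟨by omega, ?_⟩
    have : A.encode[u.length]? = some (A.itemBit x) := by
      rw [A.encode_eq_map, ← hv]
      simp
    simp [inputSymbolAt, this]
  have hwalk := spec_walk (ora := ora A.encode) (K := K) (s := s) hidle
    (visitRel := fun i => visit (.inl i) (allTest ((List.finRange _).map fun j =>
      eqTest (.rel i j) (.relArg i j) .tmp)))
    (visitConst := fun i => visit (.inr (.const i)) (eqTest .bit (.head (.const i)) .tmp))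
    (visitFunc := fun i => visit (.inr (.value i)) (andTest (eqTest .bit (.head (.value i)) .tmp)
      (allTest ((List.finRange _).map fun j => eqTest (.func i j) (.funcArg i j) .tmp))))
    (fun i x u hu => by
      rw [hnext, ← withAnswers_setTuple (s u) _ _ (by simp)]
      refine spec_visit (x := .rel i x) ?_ (hans u) ?_ (hpre hu).1 (hpre hu).2
      · have := spec_allTest (ora := ora A.encode) (K := K) (List.finRange (σ.relArity i))
          (fun j => eqTest (.rel i j) (.relArg i j) .tmp)
          (fun j => decide ((x j : ℕ) = (T (.relAddr i j)).number))
          (a := (s u).setTuple (Reg.rel i) fun j => (x j : ℕ)) (fun j => by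
            have := spec_eqTest (ora := ora A.encode) (K := K) (x := .rel i j) (y := .relArg i j)
              (z := .tmp) (a := (s u).setTuple (Reg.rel i) fun j => (x j : ℕ)) (by simp) (by simp)
              (by simp) (by rw [cnt_setTuple_of_ne (by simp)]; exact (hidle u).tmp)
            have e1 : ((s u).setTuple (Reg.rel i) fun j => (x j : ℕ)).cnt (.rel i j) = x j :=
              cnt_setTuple (Reg.rel_injective i) j
            have e2 : ((s u).setTuple (Reg.rel i) fun j => (x j : ℕ)).cnt (.relArg i j) =
                min (T (.relAddr i j)).number A.size := by
              rw [cnt_setTuple_of_ne (by simp), hcnt _ _ (by simp), ha.relArg]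
            rw [e1, e2, decide_eq_decide.2 (eq_min_iff (x j).2)] at this
            exact this)
        convert this using 1
        rw [Bool.eq_iff_iff, decide_eq_true_iff]
        simp [Asked]
      · rw [cnt_setTuple_of_ne (by simp), haddr])
    (fun i m hm u hu => by
      rw [hnext, ← withAnswers_setCnt (s u) _ _ (by simp)]
      refine spec_visit (x := .const i m) ?_ (hans u) ?_ (hpre hu).1 (hpre hu).2
      · have := spec_eqTest (ora := ora A.encode) (K := K) (x := .bit) (y := .head (.const i))
          (z := .tmp) (a := (s u).setCnt .bit m) (by simp) (by simp) (by simp)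
          (by rw [cnt_setCnt_of_ne _ (by simp)]; exact (hidle u).tmp)
        rw [cnt_setCnt, cnt_setCnt_of_ne _ (by simp), hcnt _ _ (by simp), ha.head] at this
        convert this using 2
        exact Iff.rfl
      · rw [cnt_setCnt_of_ne _ (by simp), haddr])
    (fun i m hm x u hu => by
      rw [hnext, ← withAnswers_setCnt (s u) _ _ (by simp),
        ← withAnswers_setTuple ((s u).setCnt _ _) _ _ (by simp)]
      set b := ((s u).setCnt .bit m).setTuple (Reg.func i) fun j => (x j : ℕ) with hb
      have htmp : b.cnt .tmp = 0 := by
        rw [hb, cnt_setTuple_of_ne (by simp), cnt_setCnt_of_ne _ (by simp)]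
        exact (hidle u).tmp
      refine spec_visit (x := .func i m x) ?_ (hans u) ?_ (hpre hu).1 (hpre hu).2
      · have h1 := spec_eqTest (ora := ora A.encode) (K := K) (x := .bit) (y := .head (.value i))
          (z := .tmp) (a := b) (by simp) (by simp) (by simp) htmp
        have e1 : b.cnt .bit = m := by
          rw [hb, cnt_setTuple_of_ne (by simp), cnt_setCnt]
        have e2 : b.cnt (.head (.value i)) = (U (.value i)).head := by
          rw [hb, cnt_setTuple_of_ne (by simp), cnt_setCnt_of_ne _ (by simp), hcnt _ _ (by simp),
            ha.head]
        rw [e1, e2] at h1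
        have h2 := spec_allTest (ora := ora A.encode) (K := K) (List.finRange (σ.funArity i))
          (fun j => eqTest (.func i j) (.funcArg i j) .tmp)
          (fun j => decide ((x j : ℕ) = (T (.funAddr i j)).number)) (a := b) (fun j => by
            have := spec_eqTest (ora := ora A.encode) (K := K) (x := .func i j)
              (y := .funcArg i j) (z := .tmp) (a := b) (by simp) (by simp) (by simp) htmp
            have e1 : b.cnt (.func i j) = x j := cnt_setTuple (Reg.func_injective i) j
            have e2 : b.cnt (.funcArg i j) = min (T (.funAddr i j)).number A.size := by
              rw [hb, cnt_setTuple_of_ne (by simp), cnt_setCnt_of_ne _ (by simp),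
                hcnt _ _ (by simp), ha.funcArg]
            rw [e1, e2, decide_eq_decide.2 (eq_min_iff (x j).2)] at this
            exact this)
        convert spec_andTest h1 h2 using 1
        rw [Bool.eq_iff_iff, decide_eq_true_iff]
        simp [Asked]
      · rw [hb, cnt_setTuple_of_ne (by simp), cnt_setCnt_of_ne _ (by simp), haddr])
  -- A loaded memory has blank answers and address `0`.
  have e0 : s [] = a := by
    obtain ⟨⟨tp, ps⟩, ct⟩ := a
    simp only [hs, withAnswers, List.length_nil]
    congr 2
    · funext x
      cases x with
      | ans q => exact (ha.blank q).symm
      | _ => rfl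
    · rw [Function.update_eq_self_iff]
      exact ha.addr.symm
  rw [e0] at hwalk
  refine hwalk.seq ?_
  have := spec_setZero (ora := ora A.encode) (K := K) (v := .addr)
    (a := s (codeItems σ A.size A.logSize))
  convert this using 1
  simp [hs, withAnswers, CounterMem.setCnt]

end DirectAccessSim

end

/-! ### Recovering the size of the domain from the length of the input. -/

section

variable {σ : FinVocabulary}

theorem length_lexTuples (n r : ℕ) : (lexTuples n r).length = n ^ r := by
  induction r with
  | zero => rfl
  | succ r ih => simp [lexTuples, List.length_flatMap, ih, pow_succ, mul_comm]

theorem length_codeItems (n l : ℕ) : (codeItems σ n l).length =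
    ∑ i, n ^ σ.relArity i + σ.numConst * l + ∑ i, l * n ^ σ.funArity i := by
  simp [codeItems, List.length_flatMap, length_lexTuples, Fin.sum_univ_def, add_assoc]

/-- All summands are monotone, and the one of a symbol of positive arity is strictly so. For a
function symbol this also uses that the larger size is at least `2`, so that its logarithm is
positive. -/
theorem length_codeItems_lt (hσ : (∃ i, 0 < σ.relArity i) ∨ (∃ i, 0 < σ.funArity i)) {m n : ℕ}
    (hm : 0 < m) (hmn : m < n) :
    (codeItems σ m (Nat.clog 2 m)).length < (codeItems σ n (Nat.clog 2 n)).length := by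
  rw [length_codeItems, length_codeItems]
  have hlog : Nat.clog 2 m ≤ Nat.clog 2 n := Nat.clog_mono_right 2 hmn.le
  have hlog0 : 0 < Nat.clog 2 n := Nat.clog_pos (by norm_num) (by omega)
  have hrel : ∑ i, m ^ σ.relArity i ≤ ∑ i, n ^ σ.relArity i :=
    Finset.sum_le_sum fun i _ => Nat.pow_le_pow_left hmn.le _
  have hfun' : ∀ i, Nat.clog 2 m * m ^ σ.funArity i ≤ Nat.clog 2 n * n ^ σ.funArity i :=
    fun i => Nat.mul_le_mul hlog (Nat.pow_le_pow_left hmn.le _)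
  have hfun : ∑ i, Nat.clog 2 m * m ^ σ.funArity i ≤ ∑ i, Nat.clog 2 n * n ^ σ.funArity i :=
    Finset.sum_le_sum fun i _ => hfun' i
  have hconst : σ.numConst * Nat.clog 2 m ≤ σ.numConst * Nat.clog 2 n := Nat.mul_le_mul_left _ hlog
  rcases hσ with ⟨i, hi⟩ | ⟨i, hi⟩
  · have : ∑ i, m ^ σ.relArity i < ∑ i, n ^ σ.relArity i :=
      Finset.sum_lt_sum (fun i _ => Nat.pow_le_pow_left hmn.le _)
        ⟨i, Finset.mem_univ _, Nat.pow_lt_pow_left hmn hi.ne'⟩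
    omega
  · have : ∑ i, Nat.clog 2 m * m ^ σ.funArity i < ∑ i, Nat.clog 2 n * n ^ σ.funArity i :=
      Finset.sum_lt_sum (fun i _ => hfun' i) ⟨i, Finset.mem_univ _,
        (Nat.mul_le_mul_right _ hlog).trans_lt
          (Nat.mul_lt_mul_of_pos_left (Nat.pow_lt_pow_left hmn hi.ne') hlog0)⟩
    omega

/-- The simulated machine can see the word of the size digit by digit, so its length matters here,
not only its value. The maximum covers the initial word `0`, which has one digit although `Nat.size
0 = 0`. -/
theorem Ctrl.IncWord.eq_binaryWord {m : ℕ} {w : List Bool}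
    (h : IncWord (binaryWord (max 1 (Nat.size m)) m) w) :
    w = binaryWord (Nat.size (m + 1)) (m + 1) := by
  obtain ⟨hval, hlen⟩ := h
  have hm : m < 2 ^ max 1 (Nat.size m) :=
    (Nat.lt_size_self m).trans_le (Nat.pow_le_pow_right (by norm_num) (le_max_right _ _))
  rw [wordVal_binaryWord hm] at hval hlen
  rw [length_binaryWord] at hlen
  set L := max 1 (Nat.size m) with hL
  -- The successor needs at least `L` digits, so no leading zero arises.
  have hlow : 2 ^ (L - 1) ≤ m + 1 := by
    by_cases h0 : Nat.size m ≤ 1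
    · rw [show L = 1 by omega]
      simp
    · have : Nat.size m - 1 < Nat.size m := by omega
      rw [Nat.lt_size] at this
      rw [show L = Nat.size m by omega]
      omega
  have hsize : Nat.size (m + 1) = if m + 1 = 2 ^ L then L + 1 else L := by
    split_ifs with h
    · rw [h, Nat.size_pow]
    · apply le_antisymm
      · rw [Nat.size_le]
        omega
      · have : L - 1 < Nat.size (m + 1) := Nat.lt_size.2 hlow
        omega
  refine eq_of_wordVal_eq ?_ ?_
  · rw [hlen, length_binaryWord, hsize]
  · rw [hval, wordVal_binaryWord (Nat.lt_size_self _)]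

theorem inputSymbolAt_eq_endMarker {w : List Bool} {p : ℕ} :
    inputSymbolAt w p = .endMarker ↔ w.length ≤ p := by
  unfold inputSymbolAt
  rw [← List.getElem?_eq_none_iff]
  cases w[p]? <;> simp

namespace DirectAccessSim

open CounterMem Ctrl

variable {w : List Bool} {A : FinOrderedStructure σ} {K k : ℕ}

/-- Whether the input is not longer than the encodings of the structures with a domain of the
current size. -/
noncomputable def lengthTest : Control σ k Bool :=
  (walk (fun _ => inc (.inr .addr)) (fun _ => inc (.inr .addr)) (fun _ => inc (.inr .addr))).seq
  ((rawStep fun o => (⟨fun _ => (none, .stay), fun _ => .stay⟩, decide (o.ans = .endMarker))).bind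
    fun b => (setZero .addr).seq (ret b))

/-- The walk only counts: afterwards the address is the length of a code for size `n`, and the
end-marker is scanned there iff the input is not longer. -/
theorem spec_lengthTest {n l : ℕ} {a : Mem σ k} (ha : a.Idle n l) (haddr : a.cnt .addr = 0)
    (hK : (codeItems σ n l).length < 2 ^ K) :
    Spec (ora w) K lengthTest a (decide (w.length ≤ (codeItems σ n l).length)) a := by
  set s : List (CodeItem σ n) → Mem σ k := fun u => a.setCnt .addr u.length with hs
  have hinc : ∀ u x, u ++ [x] <+: codeItems σ n l → ∀ b : Mem σ k, b.cnt .addr = u.length →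
      Spec (ora w) K (inc (.inr .addr)) b () (b.setCnt .addr (u ++ [x]).length) :=
    fun u x hu b hb => by
      have h1 := hu.length_le
      rw [List.length_append, List.length_singleton] at h1 ⊢
      have := spec_inc (ora := ora w) (K := K) (a := b) (v := .addr) (by omega)
      rwa [hb] at this
  have hcomm : ∀ p m, (a.setCnt .addr p).setCnt .bit m = (a.setCnt .bit m).setCnt .addr p :=
    fun p m => setCnt_comm _ (by simp) _ _
  have hwalk := spec_walk (ora := ora w) (K := K) (s := s)
    (visitRel := fun _ => inc (.inr .addr)) (visitConst := fun _ => inc (.inr .addr))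
    (visitFunc := fun _ => inc (.inr .addr))
    (fun u => ha.of_eq (by simp [hs, CounterMem.setCnt]) (by simp [hs, CounterMem.setCnt])
      (by simp [hs, CounterMem.setCnt]) (by simp [hs, CounterMem.setCnt])
      (by simp [hs, CounterMem.setCnt]) (by simp [hs, CounterMem.setCnt]))
    (fun i x u hu => by
      have := hinc u _ hu ((s u).setTuple (Reg.rel i) fun j => (x j : ℕ))
        (by rw [cnt_setTuple_of_ne (by simp)]; simp [hs])
      rw [setTuple_setCnt (by simp)] at this
      simpa only [hs, setCnt_setCnt] using this)
    (fun i m _ u hu => by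
      have := hinc u _ hu ((s u).setCnt .bit m)
        (by rw [cnt_setCnt_of_ne _ (by simp)]; simp [hs])
      simpa only [hs, hcomm, setCnt_setCnt] using this)
    (fun i m _ x u hu => by
      have := hinc u _ hu (((s u).setCnt .bit m).setTuple (Reg.func i) fun j => (x j : ℕ))
        (by rw [cnt_setTuple_of_ne (by simp), cnt_setCnt_of_ne _ (by simp)]; simp [hs])
      rw [setTuple_setCnt (by simp)] at this
      simpa only [hs, hcomm, setCnt_setCnt] using this)
  have e0 : s [] = a := setCnt_eq_self _ haddr
  rw [e0] at hwalk
  refine hwalk.seq ?_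
  have h1 := spec_test (ora := ora w) (K := K) (f := fun o => decide (o.ans = .endMarker))
    (a := s (codeItems σ n l))
  have e1 : (rawObs (ora w) (s (codeItems σ n l))).ans =
      inputSymbolAt w (codeItems σ n l).length := by
    change inputSymbolAt w ((s (codeItems σ n l)).cnt .addr) = _
    simp [hs]
  rw [e1, decide_eq_decide.2 inputSymbolAt_eq_endMarker] at h1
  have h2 := spec_setZero (ora := ora w) (K := K) (v := .addr) (a := s (codeItems σ n l))
  rw [show (s (codeItems σ n l)).setCnt .addr 0 = a by
    simp only [hs, setCnt_setCnt]
    exact setCnt_eq_self _ haddr] at h2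
  exact h1.bind (h2.seq spec_ret)

/-- The tape with the size is not treated as a counter, because its exact word is needed; hence the
tape-level form of the increment. -/
theorem spec_incSize {a : Mem σ k} {m : ℕ}
    (ha : a.raw.tape (.ro .size) = .ofWord (binaryWord (max 1 (Nat.size m)) m))
    (hK : m + 1 < 2 ^ K) :
    Spec (ora w) K (inc (.inl (.ro .size))) a ()
      (a.setRaw (.ro .size) (.ofWord (binaryWord (Nat.size (m + 1)) (m + 1)))) := by
  have hm : m < 2 ^ max 1 (Nat.size m) :=
    (Nat.lt_size_self m).trans_le (Nat.pow_le_pow_right (by norm_num) (le_max_right _ _))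
  have hlen : (binaryWord (max 1 (Nat.size m)) m).length = max 1 (Nat.size m) :=
    length_binaryWord _ _
  have hK0 : K ≠ 0 := by
    rintro rfl
    simp at hK
  have hsize : Nat.size m ≤ K := Nat.size_le.2 (by omega)
  obtain ⟨w', h1, -, h2⟩ := exists_onTape_inc (ora := ora w (k := k) (σ := σ)) (K := K)
    (r := .inl (.ro .size)) (w := binaryWord (max 1 (Nat.size m)) m)
    (by
      rw [← List.length_pos_iff, hlen]
      omega)
    (by rw [hlen]; omega) (by rwa [wordVal_binaryWord hm])
  rw [← h1.eq_binaryWord]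
  refine OnTape.spec_raw ?_
  rw [ha]
  exact h2

/-- Blank all simulated tapes. -/
def blankTapes : Control σ k Unit :=
  rawStep fun _ => (⟨fun
    | .sim _ => (some .blank, .stay)
    | _ => (none, .stay), fun _ => .stay⟩, ())

/-- Prepare the memory for the simulation. -/
noncomputable def setup : Control σ k Unit :=
  (inc (.inl (.ro .size))).seq ((inc (.inr .size)).seq ((inc (.inr .pow)).seq
    ((untilLoop lengthTest (nextSize.seq (inc (.inl (.ro .size))))).seq blankTapes)))

/-- The candidate size grows from `1` until the input is no longer than its code. By strict
monotonicity of the code length the loop stops exactly at the size of the domain. No tested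
candidate has a code longer than the input, so the address always fits. -/
theorem exists_spec_setup (hσ : (∃ i, 0 < σ.relArity i) ∨ (∃ i, 0 < σ.funArity i))
    (hK : 2 * A.size + 1 < 2 ^ K) (hK' : A.encode.length < 2 ^ K) {U : ReadOnlyTape σ → SemiTape}
    (hU : ∀ l, (U l).head = 0) (hU' : U .size = .ofWord (binaryWord (Nat.size A.size) A.size)) :
    ∃ a : Mem σ k, Spec (ora A.encode) K setup (initial _ _ _) () a ∧
      Ready A (fun _ => .ofWord []) U a := by
  have hn0 : 0 < A.size := A.size_pos
  have hK0 : K ≠ 0 := by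
    rintro rfl
    omega
  set i₀ : Mem σ k := initial _ _ _ with hi₀
  have hi₀cnt : ∀ v, i₀.cnt v = 0 := fun _ => rfl
  have hi₀raw : ∀ x, i₀.raw.tape x = .ofWord [false] := fun _ => rfl
  set tape : ℕ → SemiTape := fun m => .ofWord (binaryWord (Nat.size m) m) with htape
  set s : ℕ → Mem σ k := fun m => (i₀.setRaw (.ro .size) (tape m)).setSize m with hs
  have hlen : A.encode.length = (codeItems σ A.size A.logSize).length := by
    rw [A.encode_eq_map, List.length_map]
  -- The initial word `0` is the one-digit word of `m = 0`.
  have h1 := spec_incSize (w := A.encode) (K := K) (a := i₀) (m := 0) rfl (by omega)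
  have h2 := spec_inc (ora := ora A.encode) (K := K) (a := i₀.setRaw (.ro .size) (tape 1))
    (v := .size) (by rw [cnt_setRaw, hi₀cnt]; omega)
  rw [cnt_setRaw, hi₀cnt] at h2
  have h3 := spec_inc (ora := ora A.encode) (K := K) (v := .pow)
    (a := (i₀.setRaw (.ro .size) (tape 1)).setCnt .size (0 + 1))
    (by rw [cnt_setCnt_of_ne _ (by simp), cnt_setRaw, hi₀cnt]; omega)
  rw [cnt_setCnt_of_ne _ (by simp), cnt_setRaw, hi₀cnt] at h3
  have e : ((i₀.setRaw (.ro .size) (tape 1)).setCnt .size (0 + 1)).setCnt .pow (0 + 1) = s 1 := by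
    simp only [hs, CounterMem.setCnt, CounterMem.setSize]
    congr 1
    funext v
    cases v <;> simp [hi₀cnt]
  rw [e] at h3
  have hcntv : ∀ m v, v ≠ .size → v ≠ .log → v ≠ .pow → (s m).cnt v = 0 := fun m v h1 h2 h3 => by
    simp [hs, CounterMem.setSize, CounterMem.setCnt, h1, h2, h3, hi₀cnt]
  have hidle : ∀ m, (s m).Idle m (Nat.clog 2 m) := fun m =>
    ⟨fun _ _ => hcntv _ _ (by simp) (by simp) (by simp),
      fun _ _ => hcntv _ _ (by simp) (by simp) (by simp), hcntv _ _ (by simp) (by simp) (by simp),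
      hcntv _ _ (by simp) (by simp) (by simp), by simp [hs, CounterMem.setSize, CounterMem.setCnt],
      by simp [hs, CounterMem.setSize, CounterMem.setCnt]⟩
  have htest : ∀ m, (codeItems σ m (Nat.clog 2 m)).length ≤ A.encode.length →
      Spec (ora A.encode) K lengthTest (s m)
        (decide (A.encode.length ≤ (codeItems σ m (Nat.clog 2 m)).length)) (s m) := fun m hm =>
    spec_lengthTest (hidle m) (hcntv _ _ (by simp) (by simp) (by simp)) (by omega)
  have h4 := spec_untilLoop (ora := ora A.encode) (K := K) (T := lengthTest)
    (B := nextSize.seq (inc (.inl (.ro .size)))) (fun i => s (i + 1)) (A.size - 1)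
    (fun i hi => by
      -- A smaller candidate has a strictly shorter code, so the test fails.
      have hlt := length_codeItems_lt hσ (Nat.succ_pos i) (show i + 1 < A.size by omega)
      have hle : (codeItems σ (i + 1) (Nat.clog 2 (i + 1))).length < A.encode.length := by
        rw [hlen]
        exact hlt
      have := htest (i + 1) hle.le
      rwa [decide_eq_false (by omega)] at this)
    (fun i hi => by
      have d1 := spec_nextSize (ora := ora A.encode) (K := K)
        (a := i₀.setRaw (.ro .size) (tape (i + 1))) (hi₀cnt .bit) (hi₀cnt .tmp) (Nat.succ_pos i)
        (by omega)
      refine d1.seq ?_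
      have hmax : max 1 (Nat.size (i + 1)) = Nat.size (i + 1) :=
        max_eq_right (Nat.size_pos.2 (Nat.succ_pos i))
      have d2 := spec_incSize (w := A.encode) (K := K) (m := i + 1)
        (a := (i₀.setRaw (.ro .size) (tape (i + 1))).setSize (i + 1 + 1))
        (by
          rw [hmax]
          exact TapeMem.tape_setTape _ _ _) (by omega)
      convert d2 using 1
      simp only [hs, CounterMem.setSize, setCnt_setRaw, setRaw_setRaw, htape])
    (by
      rw [Nat.sub_add_cancel hn0]
      have := htest A.size hlen.ge
      rwa [decide_eq_true (by exact hlen.le)] at this)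
  rw [Nat.sub_add_cancel hn0] at h4
  have hraw : (s A.size).raw = i₀.raw.setTape (.ro .size) (tape A.size) := rfl
  have hhead : ∀ x, ((s A.size).raw.tape x).head = 0 := fun x => by
    by_cases hx : x = .ro .size
    · subst hx
      rw [hraw, TapeMem.tape_setTape]
      rfl
    · rw [hraw, TapeMem.tape_setTape_of_ne _ hx]
      rfl
  refine ⟨_, h1.seq (h2.seq (h3.seq (h4.seq (spec_rawStep rfl ⟨?_, fun h => h.elim⟩
    ⟨fun x => ?_, fun h => h.elim⟩)))), ?_⟩
  · intro x
    cases x <;> simp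
  · cases x <;> simp [TapeMem.act, SemiTape.act, hhead, HeadMove.app]
  · refine ⟨(hidle A.size).of_eq (fun _ _ => rfl) (fun _ _ => rfl) rfl rfl rfl rfl, fun t => ?_,
      ?_, fun l => ?_, ?_, fun q => ⟨.zero, ?_⟩, hcntv _ _ (by simp) (by simp) (by simp)⟩
    · simp only [TapeMem.act, hraw]
      rw [TapeMem.tape_setTape_of_ne _ (by simp), hi₀raw, SemiTape.act_some_stay, ofWord_false,
        ofWord_nil]
      change (⟨Function.update _ 0 _, 0⟩ : SemiTape) = _
      rw [update_symbolTape]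
      rfl
    · simp [TapeMem.act, hraw, hU', htape]
    · simp [TapeMem.act, hhead, hU]
    · simp [TapeMem.act, hhead]
    · simp only [TapeMem.act, hraw]
      rw [TapeMem.tape_setTape_of_ne _ (by simp), hi₀raw, ofWord_false, SemiTape.act_none_stay]

end DirectAccessSim

end

/-! ### Simulating the steps of a direct-access machine. -/

section

variable {σ : FinVocabulary}

instance (M : DirectAccessTM σ) : Finite M.State := M.finite_state

namespace DirectAccessTM

variable {M : DirectAccessTM σ} {A : FinOrderedStructure σ} {c d : M.Config}

theorem of_step_eq_some (h : M.step A c = some d) :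
    ∃ act ract, M.trans c.state (fun l => (c.tape l).read) (fun l => (c.rotape l).read)
        (M.answer A c.tape) = some (d.state, act, ract) ∧
      (¬ ((∃ l, (c.tape l).Blocked (act l).2) ∨ ∃ l, (c.rotape l).Blocked (ract l))) ∧
      (∀ l, d.tape l = ((c.tape l).write (act l).1).move (act l).2) ∧
      (∀ i, d.rotape (.value i) =
        ⟨wordCells (valueWordAt A i fun j => (d.tape (.funAddr i j)).number),
          ((c.rotape (.value i)).move (ract (.value i))).head⟩) ∧
      (∀ i, d.rotape (.const i) = (c.rotape (.const i)).move (ract (.const i))) ∧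
      d.rotape .size = (c.rotape .size).move (ract .size) := by
  unfold step at h
  split at h
  · cases h
  · split_ifs at h with hb
    cases h
    exact ⟨_, _, by assumption, hb, fun l => rfl, fun i => rfl, fun i => rfl, rfl⟩

theorem of_step_eq_none (h : M.step A c = none) :
    M.trans c.state (fun l => (c.tape l).read) (fun l => (c.rotape l).read)
        (M.answer A c.tape) = none ∨
    ∃ q act ract, M.trans c.state (fun l => (c.tape l).read) (fun l => (c.rotape l).read)
        (M.answer A c.tape) = some (q, act, ract) ∧
      ((∃ l, (c.tape l).Blocked (act l).2) ∨ ∃ l, (c.rotape l).Blocked (ract l)) := by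
  unfold step at h
  split at h
  · exact .inl (by assumption)
  · split_ifs at h with hb
    exact .inr ⟨_, _, _, by assumption, hb⟩

theorem head_rotape_of_step (h : M.step A c = some d) :
    ∃ ract : ReadOnlyTape σ → HeadMove, ∀ l, (d.rotape l).head = (ract l).app
      (c.rotape l).head := by
  obtain ⟨act, ract, -, -, -, hv, hc, hs⟩ := of_step_eq_some h
  refine ⟨ract, fun l => ?_⟩
  cases l with
  | value i => rw [hv, SemiTape.head_move]
  | const i => rw [hc, SemiTape.head_move]
  | size => rw [hs, SemiTape.head_move]

end DirectAccessTM

namespace DirectAccessSim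

open CounterMem Ctrl

variable {A : FinOrderedStructure σ} {K : ℕ} (M : DirectAccessTM σ)

/-- The symbol on a read-only tape; before the first step, the value-tapes are blank. -/
def readOnlySymbol {k : ℕ} (first : Bool) (sym : DirectTape σ k → TapeSymbol) :
    ReadOnlyTape σ → TapeSymbol
  | .value i => if first then .blank else sym (.ans (.inr (.value i)))
  | .const i => sym (.ans (.inr (.const i)))
  | .size => sym (.ro .size)

open Classical in
/-- One step of the simulated machine, when the answers are known. -/
noncomputable def advance (q : M.State × Bool)
    (o : TapeObs (DirectTape σ M.numWork) Empty InputSymbol) :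
    TapeAction (DirectTape σ M.numWork) Empty × (M.State × Bool ⊕ Bool) :=
  match M.trans q.1 (fun t => o.sym (.sim t)) (readOnlySymbol q.2 o.sym)
      (fun i => decide (o.sym (.ans (.inl i)) = .one)) with
  | none => (⟨fun _ => (none, .stay), fun _ => .stay⟩, .inr false)
  | some (q', act, ract) =>
      if (∃ l, (act l).2 = .left ∧ o.atLeft (.sim l) = true) ∨
          ∃ l, ract l = .left ∧ o.atLeft (.ro l) = true then
        (⟨fun _ => (none, .stay), fun _ => .stay⟩, .inr false)
      else (⟨fun
        | .sim l => (some (act l).1, (act l).2)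
        | .ro l => (none, ract l)
        | _ => (none, .stay), fun _ => .stay⟩, .inl (q', false))

open Classical in
/-- Simulate one step. -/
noncomputable def simulateStep (q : M.State × Bool) :
    Control σ M.numWork (M.State × Bool ⊕ Bool) :=
  if q.1 ∈ M.final then ret (.inr true) else loadAll.seq (askAll.seq (rawStep (advance M q)))

variable {M}

/-- The contents of the value- and constant-tapes. -/
structure Consistent (A : FinOrderedStructure σ) (first : Bool) (c : M.Config) : Prop where
  const : ∀ i, (c.rotape (.const i)).cells = wordCells (A.encodeConst i)
  value : ∀ i, (c.rotape (.value i)).cells = wordCells (if first then [] else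
    DirectAccessTM.valueWordAt A i fun j => (c.tape (.funAddr i j)).number)

/-- Every step refreshes the value-tapes, so they differ from the current values only before the
first step. -/
theorem Consistent.step {first : Bool} {c d : M.Config} (h : Consistent A first c)
    (hs : M.step A c = some d) : Consistent A false d := by
  obtain ⟨act, ract, -, -, -, hv, hc, -⟩ := DirectAccessTM.of_step_eq_some hs
  exact ⟨fun i => by rw [hc, SemiTape.cells_move, h.const], fun i => by rw [hv]; rfl⟩

/-- `loadAll` saves addresses and head positions, and `askAll` finds the answers. The transition
function then receives the arguments that it has in `M`; a missing or blocked transition leads to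
the exit with `false`. -/
theorem spec_simulateStep {first : Bool} {c : M.Config} {a : Mem σ M.numWork}
    (ha : Ready A c.tape c.rotape a) (hcons : Consistent A first c) (hc : c.state ∉ M.final)
    (hblank : ∀ t j, K ≤ j → (c.tape t).cells j = .blank) (hK : A.encode.length < 2 ^ K) :
    (∀ d, M.step A c = some d → (∀ t, (d.tape t).head ≤ K) → (∀ l, (d.rotape l).head ≤ K) →
      ∃ a', Spec (ora A.encode) K (simulateStep M (c.state, first)) a (.inl (d.state, false)) a' ∧
        Ready A d.tape d.rotape a') ∧
    (M.step A c = none →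
      ∃ a', Spec (ora A.encode) K (simulateStep M (c.state, first)) a (.inr false) a') := by
  obtain ⟨a₁, h1, hl⟩ := exists_spec_loadAll (w := A.encode) (K := K) ha
    fun t => hblank t K le_rfl
  have h2 := spec_askAll hl hK
  set b := withAnswers a₁ (found A c.tape c.rotape (codeItems σ A.size A.logSize)) 0 with hb
  have hsim : ∀ t, b.raw.tape (.sim t) = c.tape t := hl.sim
  have hro : b.raw.tape (.ro .size) = c.rotape .size := hl.ro
  have hroHead : ∀ l, (b.raw.tape (.ro l)).head = (c.rotape l).head := hl.roHead
  have hans : ∀ q, b.raw.tape (.ans q) =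
      symbolTape (found A c.tape c.rotape (codeItems σ A.size A.logSize) q) := fun q => rfl
  set o := rawObs (ora A.encode) b with ho
  have hobs : M.trans c.state (fun t => o.sym (.sim t)) (readOnlySymbol first o.sym)
      (fun i => decide (o.sym (.ans (.inl i)) = .one)) =
      M.trans c.state (fun l => (c.tape l).read) (fun l => (c.rotape l).read)
        (M.answer A c.tape) := by
    congr 1
    · simp only [ho, rawObs, hsim]
    · funext l
      cases l with
      | value i =>
        simp only [readOnlySymbol, ho, rawObs, hans, symbolTape_read, found_value]
        simp only [SemiTape.read, hcons.value]
        -- In the first step the answer found is ignored, since the value-tape is still blank.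
        cases first
        · rfl
        · simp [wordCells]
      | const i =>
        simp only [readOnlySymbol, ho, rawObs, hans, symbolTape_read, found_const]
        simp only [SemiTape.read, hcons.const]
      | size => simp only [readOnlySymbol, ho, rawObs, hro]
    · funext i
      exact decide_eq_decide.2 (found_rel i)
  have hleft : ∀ act : WritableTape σ M.numWork → TapeSymbol × HeadMove,
      ∀ ract : ReadOnlyTape σ → HeadMove,
      ((∃ l, (act l).2 = .left ∧ o.atLeft (.sim l) = true) ∨
        ∃ l, ract l = .left ∧ o.atLeft (.ro l) = true) ↔
      ((∃ l, (c.tape l).Blocked (act l).2) ∨ ∃ l, (c.rotape l).Blocked (ract l)) := by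
    intro act ract
    simp only [ho, rawObs, hsim, hroHead, SemiTape.Blocked, beq_iff_eq]
  rw [simulateStep, if_neg hc]
  refine ⟨fun d hd htape hrotape => ?_, fun hn => ⟨b, h1.seq (h2.seq ?_)⟩⟩
  · obtain ⟨act, ract, htr, hbl, ht, hv, hcst, hsz⟩ := DirectAccessTM.of_step_eq_some hd
    have hbl' := mt (hleft act ract).1 hbl
    have hrh : ∀ l, (d.rotape l).head = (ract l).app (c.rotape l).head := fun l => by
      cases l with
      | value i => rw [hv, SemiTape.head_move]
      | const i => rw [hcst, SemiTape.head_move]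
      | size => rw [hsz, SemiTape.head_move]
    have key : ∀ hs : b.raw.InSpace K, _ := fun hs =>
      spec_rawStep (ora := ora A.encode) (K := K) (a := b) (f := advance M (c.state, first))
      (act := ⟨fun
        | .sim l => (some (act l).1, (act l).2)
        | .ro l => (none, ract l)
        | _ => (none, .stay), fun _ => .stay⟩) (e := .inl (d.state, false))
      (by
        simp only [advance]
        rw [← ho, hobs, htr]
        exact if_neg hbl')
      ⟨fun x => by
        cases x with
        | sim l =>
          intro h h0
          rw [hsim] at h0
          exact hbl (.inl ⟨l, h, h0⟩)
        | ro l =>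
          intro h h0
          rw [hroHead] at h0
          exact hbl (.inr ⟨l, h, h0⟩)
        | _ => simp, fun h => h.elim⟩
      ⟨fun x => by
        cases x with
        | sim l =>
          simp only [TapeMem.act, hsim]
          have := htape l
          rw [ht] at this
          exact this
        | ro l =>
          simp only [TapeMem.act, SemiTape.act, SemiTape.head_move, SemiTape.head_write, hroHead]
          rw [← hrh]
          exact hrotape l
        | _ => simpa [TapeMem.act] using hs.1 _, fun h => h.elim⟩
    refine ⟨_, h1.seq (h2.seq (Spec.of_cnt_lt fun _ hs => key hs)), ?_⟩
    refine ⟨(hl.toReady.withAnswers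
      (found A c.tape c.rotape (codeItems σ A.size A.logSize)) 0).of_eq (fun _ _ => rfl)
        (fun _ _ => rfl) rfl rfl rfl rfl,
      fun t => ?_, ?_, fun l => ?_, ?_, fun q =>
      ⟨found A c.tape c.rotape (codeItems σ A.size A.logSize) q, ?_⟩, ?_⟩
    · simp only [TapeMem.act, hsim, ht]
      rfl
    · simp only [TapeMem.act, hro, hsz, SemiTape.act, Option.getD_none, SemiTape.write_read]
    · simp only [TapeMem.act, SemiTape.act, SemiTape.head_move, SemiTape.head_write, hroHead, hrh]
    · simp only [TapeMem.act, SemiTape.act_none_stay]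
      exact hl.aux
    · simp only [TapeMem.act, SemiTape.act_none_stay]
      exact hans q
    · simp [hb, withAnswers]
  · refine Spec.of_cnt_lt fun _ hs => ?_
    have hadv : advance M (c.state, first) o =
        (⟨fun _ => (none, .stay), fun _ => .stay⟩, .inr false) := by
      simp only [advance]
      rw [hobs]
      rcases DirectAccessTM.of_step_eq_none hn with htr | ⟨q, act, ract, htr, hbl⟩
      · rw [htr]
      · rw [htr]
        exact if_pos ((hleft act ract).2 hbl)
    have := spec_rawStep (ora := ora A.encode) (K := K) (a := b)
      (f := advance M (c.state, first)) hadv ⟨by simp, by simp⟩ (by rwa [TapeMem.act_idle])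
    rwa [TapeMem.act_idle] at this

/-- Besides the blank cells from `K` on, the contents of the value- and constant-tapes have to be
carried along, because the simulating memory stores only the heads of these tapes. -/
theorem exists_spec_simulate {c d : M.Config} (h : StepPath (M.step A)
      (fun b => b.state ∉ M.final ∧ (∀ t, (b.tape t).head < K) ∧ ∀ l, (b.rotape l).head < K) c d)
    {a : Mem σ M.numWork} (ha : Ready A c.tape c.rotape a) {first : Bool}
    (hcons : Consistent A first c)
    (hblank : ∀ t j, K ≤ j → (c.tape t).cells j = .blank) (hK : A.encode.length < 2 ^ K) {x : Bool}
    (hd : d.state ∈ M.final ∧ x = true ∨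
      d.state ∉ M.final ∧ M.step A d = none ∧ x = false) :
    ∃ a', Spec (ora A.encode) K (iterate (simulateStep M) (c.state, first)) a x a' := by
  induction h generalizing a first with
  | refl c =>
    rcases hd with ⟨hd, rfl⟩ | ⟨hd, hs, rfl⟩
    · refine ⟨a, Spec.iterate_done ?_⟩
      rw [simulateStep, if_pos hd]
      exact spec_ret
    · obtain ⟨a', ha'⟩ := (spec_simulateStep ha hcons hd hblank hK).2 hs
      exact ⟨a', ha'.iterate_done⟩
  | @head c c' d hc hs _ ih =>
    obtain ⟨act, -, -, -, hact, -⟩ := DirectAccessTM.of_step_eq_some hs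
    obtain ⟨ract, hract⟩ := DirectAccessTM.head_rotape_of_step hs
    obtain ⟨a', ha', hr⟩ := (spec_simulateStep ha hcons hc.1 hblank hK).1 c' hs
      (fun l => by
        rw [hact, SemiTape.head_move]
        exact (HeadMove.app_le _ _).trans (hc.2.1 l))
      (fun l => by
        rw [hract]
        exact (HeadMove.app_le _ _).trans (hc.2.2 l))
    obtain ⟨a'', ha''⟩ := ih hr (hcons.step hs) (fun l j hj => by
      rw [hact]
      exact blank_move_write (hblank l) (hc.2.1 l) hj _ _) hd
    exact ⟨a'', ha'.iterate_next ha''⟩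

end DirectAccessSim

open DirectAccessSim Ctrl in
/-- Every direct-access machine is simulated by a random-access machine, where the space `K` has to
suffice for the length of the encoding and for the numbers up to twice the size of the domain. -/
theorem DirectAccessTM.exists_randomAccessTM
    (hσ : (∃ i, 0 < σ.relArity i) ∨ (∃ i, 0 < σ.funArity i)) (M : DirectAccessTM σ) :
    ∃ M' : RandomAccessTM, ∀ (A : FinOrderedStructure σ) (K : ℕ), 2 * A.size + 1 < 2 ^ K →
      A.encode.length < 2 ^ K → (M.Accepts A ∨ M.Rejects A) →
      (∀ l, (M.visited A l).encard ≤ (K : ℕ)) → (∀ l, (M.visitedReadOnly A l).encard ≤ (K : ℕ)) →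
      (M.Accepts A → M'.Accepts A.encode) ∧ (M.Rejects A → M'.Rejects A.encode) ∧
        ∀ l, (M'.visited A.encode l).encard ≤ (K + 1 : ℕ) := by
  refine ⟨RandomAccessTM.ofCtrl (.inr .addr)
    (setup.seq (iterate (simulateStep M) (M.start, true))), fun A K hK hK' hdec hvis hvis' => ?_⟩
  have hK0 : 0 < K := by
    by_contra h
    obtain rfl : K = 0 := by omega
    omega
  have hhead : ∀ l, ((M.initial A).rotape l).head = 0 := fun l => by cases l <;> rfl
  have hlt : ∀ (l : WritableTape σ M.numWork) (x : ℕ), x ∈ M.visited A l → x < K :=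
    fun l x hx => lt_of_mem_visitedCells (c := M.initial A) (head := fun c => (c.tape l).head) rfl
      (fun b d hbd => by
        obtain ⟨act, -, -, -, hact, -⟩ := DirectAccessTM.of_step_eq_some hbd
        simp only [hact, SemiTape.head_move, SemiTape.head_write]
        exact HeadMove.app_le _ _) (hvis l) hx
  have hlt' : ∀ (l : ReadOnlyTape σ) (x : ℕ), x ∈ M.visitedReadOnly A l → x < K :=
    fun l x hx => lt_of_mem_visitedCells (c := M.initial A) (head := fun c => (c.rotape l).head)
      (hhead l)
      (fun b d hbd => by
        obtain ⟨ract, hract⟩ := DirectAccessTM.head_rotape_of_step hbd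
        simp only [hract]
        exact HeadMove.app_le _ _) (hvis' l) hx
  -- One path has to bound the heads of writable and read-only tapes at once; hence the sum as index
  -- type.
  obtain ⟨d, hp, -, hd⟩ := exists_stepPath hdec (ι := WritableTape σ M.numWork ⊕ ReadOnlyTape σ)
    fun l c => Sum.elim (fun l => (c.tape l).head) (fun l => (c.rotape l).head) l
  have hp' : StepPath (M.step A) (fun b => b.state ∉ M.final ∧ (∀ l, (b.tape l).head < K) ∧
      ∀ l, (b.rotape l).head < K) (M.initial A) d :=
    hp.mono fun b hb => ⟨hb.1, fun l => hlt l _ (hb.2 (.inl l)), fun l => hlt' l _ (hb.2 (.inr l))⟩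
  obtain ⟨a, ha, hr⟩ := exists_spec_setup (k := M.numWork) hσ hK hK'
    (U := (M.initial A).rotape) hhead rfl
  -- The flag in the start state marks the value-tapes as still blank.
  have hcons : Consistent A true (M.initial A) := ⟨fun i => rfl, fun i => rfl⟩
  have hrun : ∀ x, (d.state ∈ M.final ∧ x = true ∨
      d.state ∉ M.final ∧ M.step A d = none ∧ x = false) →
      ∃ m : TapeMem (DirectTape σ M.numWork ⊕ Reg σ) Empty,
        (setup.seq (iterate (simulateStep M) (M.start, true))).Runs (ora A.encode) K
          (TapeMem.initial _ _) x m ∧ m.InSpace K := fun x hx => by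
    obtain ⟨a', ha'⟩ := exists_spec_simulate hp' hr hcons
      (fun l j _ => wordCells_of_le (w := []) (j := j) (by simp)) hK' hx
    obtain ⟨m, hm, hrep⟩ := ha.seq ha' _ (CounterMem.rep_initial hK0)
    exact ⟨m, hm, hrep.inSpace⟩
  rcases hd with ⟨hacc, hd⟩ | ⟨hrej, hd, hs⟩
  · obtain ⟨m, hm, hmK⟩ := hrun true (.inl ⟨hd, rfl⟩)
    have := RandomAccessTM.ofCtrl_spec _ _ hm hmK
    exact ⟨fun _ => this.1 rfl, fun h => absurd hacc h.2, this.2.2⟩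
  · obtain ⟨m, hm, hmK⟩ := hrun false (.inr ⟨hd, hs, rfl⟩)
    have := RandomAccessTM.ofCtrl_spec _ _ hm hmK
    exact ⟨fun h => absurd h hrej.2, fun _ => this.2.1 rfl, this.2.2⟩

end

section

variable {σ : FinVocabulary}

/-! ### The space bounds -/

/-- A computation that accepts or rejects visits finitely many cells. -/
theorem exists_encard_visitedCells_le {α : Type} {step : α → Option α} {acc : α → Prop} {c : α}
    (h : AcceptsFrom step acc c ∨ RejectsFrom step acc c) :
    ∃ K : ℕ, ∀ head : α → ℕ, (visitedCells step acc c head).encard ≤ (K : ℕ) := by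
  obtain ⟨t, ht⟩ : ∃ t, ∀ s b, runFor step c s = some b →
      (∀ s' < s, ∀ d, runFor step c s' = some d → ¬ acc d) → s ≤ t := by
    rcases h with ⟨t, d, hd, had⟩ | ⟨⟨t, d, hd, hs⟩, -⟩
    · exact ⟨t, fun s b _ hacc => not_lt.1 fun hts => hacc t hts d hd had⟩
    · refine ⟨t, fun s b hb _ => not_lt.1 fun hts => ?_⟩
      have : runFor step c (t + 1) = none := by rw [runFor, hd]; exact hs
      rw [runFor_eq_none_of_le this hts] at hb
      cases hb
  refine ⟨t + 1, fun head => ?_⟩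
  have hsub : visitedCells step acc c head ⊆
      (fun s => ((runFor step c s).map head).getD 0) '' Set.Iic t := by
    rintro x ⟨s, b, hb, hacc, rfl⟩
    exact ⟨s, ht s b hb hacc, by simp [hb]⟩
  refine (Set.encard_le_encard hsub).trans ((Set.encard_image_le _ _).trans ?_)
  rw [← Finset.coe_Iic, Set.encard_coe_eq_coe_finsetCard, Nat.card_Iic]

namespace FinOrderedStructure

theorem length_encode (A : FinOrderedStructure σ) :
    A.encode.length = (codeItems σ A.size (Nat.clog 2 A.size)).length := by
  rw [A.encode_eq_map, List.length_map]
  rfl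

/-- A relation contributes `n ^ r ≥ n` bits. A function contributes this number times the logarithm,
which is positive only for `n ≥ 2`; with functions alone the code for `n = 1` is empty. -/
theorem size_le_length_encode (hσ : (∃ i, 0 < σ.relArity i) ∨ (∃ i, 0 < σ.funArity i))
    {A : FinOrderedStructure σ} (hA : 2 ≤ A.size) : A.size ≤ A.encode.length := by
  rw [A.length_encode, length_codeItems]
  have hlog0 : 0 < Nat.clog 2 A.size := Nat.clog_pos (by norm_num) hA
  rcases hσ with ⟨i, hi⟩ | ⟨i, hi⟩
  · have h1 : A.size ≤ A.size ^ σ.relArity i := Nat.le_self_pow hi.ne' _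
    have h2 : A.size ^ σ.relArity i ≤ ∑ i, A.size ^ σ.relArity i :=
      Finset.single_le_sum (f := fun i => A.size ^ σ.relArity i) (fun _ _ => Nat.zero_le _)
        (Finset.mem_univ i)
    omega
  · have h1 : A.size ≤ A.size ^ σ.funArity i := Nat.le_self_pow hi.ne' _
    have h2 : Nat.clog 2 A.size * A.size ^ σ.funArity i ≤
        ∑ i, Nat.clog 2 A.size * A.size ^ σ.funArity i :=
      Finset.single_le_sum (f := fun i => Nat.clog 2 A.size * A.size ^ σ.funArity i)
        (fun _ _ => Nat.zero_le _) (Finset.mem_univ i)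
    have h3 := Nat.le_mul_of_pos_left (A.size ^ σ.funArity i) hlog0
    omega

/-- The length of the encoding is polynomial in the size of the domain. -/
theorem exists_clog_length_encode_le (σ : FinVocabulary) : ∃ D : ℕ, ∀ A : FinOrderedStructure σ,
    2 ≤ A.size → Nat.clog 2 A.encode.length ≤ D * Nat.clog 2 A.size := by
  -- `r` bounds every arity, and the exponent `r + 1` below also absorbs a factor `⌈log₂ n⌉ ≤ n`.
  set r := ∑ i, σ.relArity i + ∑ i, σ.funArity i with hr
  set m := σ.numRel + σ.numConst + σ.numFun with hm
  refine ⟨m + (r + 1), fun A hA => Nat.clog_le_of_le_pow ?_⟩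
  set n := A.size
  set l := Nat.clog 2 n
  have hn : n ≤ 2 ^ l := Nat.le_pow_clog (by norm_num) n
  have hln : l ≤ n := Nat.clog_le_of_le_pow Nat.lt_two_pow_self.le
  have hrel : ∀ i, n ^ σ.relArity i ≤ n ^ (r + 1) := fun i => by
    refine Nat.pow_le_pow_right (by omega) ?_
    have : σ.relArity i ≤ ∑ i, σ.relArity i :=
      Finset.single_le_sum (fun _ _ => Nat.zero_le _) (Finset.mem_univ i)
    omega
  have hfun : ∀ i, l * n ^ σ.funArity i ≤ n ^ (r + 1) := fun i => by
    have : σ.funArity i ≤ ∑ i, σ.funArity i :=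
      Finset.single_le_sum (fun _ _ => Nat.zero_le _) (Finset.mem_univ i)
    rw [pow_succ']
    exact Nat.mul_le_mul hln (Nat.pow_le_pow_right (by omega) (by omega))
  have h1 : ∑ i, n ^ σ.relArity i ≤ σ.numRel * n ^ (r + 1) := by
    simpa using Finset.sum_le_card_nsmul Finset.univ _ _ fun i _ => hrel i
  have h2 : ∑ i, l * n ^ σ.funArity i ≤ σ.numFun * n ^ (r + 1) := by
    simpa using Finset.sum_le_card_nsmul Finset.univ _ _ fun i _ => hfun i
  have h3 : σ.numConst * l ≤ σ.numConst * n ^ (r + 1) :=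
    Nat.mul_le_mul_left _ (hln.trans (Nat.le_self_pow (by omega) _))
  have h4 : A.encode.length ≤ m * n ^ (r + 1) := by
    rw [A.length_encode, length_codeItems, hm, add_mul, add_mul]
    exact Nat.add_le_add (Nat.add_le_add h1 h3) h2
  -- The number of symbols is absorbed into the exponent, so that the bound is a pure power of `n`
  -- and its logarithm has no additive term.
  have h5 : m ≤ n ^ m := Nat.lt_two_pow_self.le.trans (Nat.pow_le_pow_left hA m)
  calc A.encode.length ≤ m * n ^ (r + 1) := h4
    _ ≤ n ^ m * n ^ (r + 1) := Nat.mul_le_mul_right _ h5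
    _ = n ^ (m + (r + 1)) := (pow_add _ _ _).symm
    _ ≤ (2 ^ l) ^ (m + (r + 1)) := Nat.pow_le_pow_left hn _
    _ = 2 ^ ((m + (r + 1)) * l) := by rw [← pow_mul, mul_comm]

end FinOrderedStructure

/-- The counters cost an additive multiple of the logarithm, which one further power absorbs. -/
theorem mul_pow_add_mul_le {c a x : ℕ} (k : ℕ) (hx : 0 < x) :
    c * x ^ k + a * x ≤ (c + a) * x ^ (k + 1) := by
  rw [add_mul]
  exact Nat.add_le_add (Nat.mul_le_mul_left _ (Nat.pow_le_pow_right hx k.le_succ))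
    (Nat.mul_le_mul_left _ (Nat.le_self_pow k.succ_ne_zero _))

/-- Two spare digits suffice, as `2 * n + 1` is less than `4 * 2 ^ ⌈log₂ n⌉`. -/
theorem two_mul_add_one_lt_two_pow {n K : ℕ} (h : Nat.clog 2 n + 2 ≤ K) : 2 * n + 1 < 2 ^ K := by
  have h1 : n ≤ 2 ^ Nat.clog 2 n := Nat.le_pow_clog (by norm_num) n
  have h2 : 2 ^ (Nat.clog 2 n + 2) ≤ 2 ^ K := Nat.pow_le_pow_right (by norm_num) h
  have h3 : 0 < 2 ^ Nat.clog 2 n := by positivity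
  rw [pow_add] at h2
  omega

/-- The same machine is used with two choices of `K`. For correctness on every structure, `K` comes
from the fact that `M` halts; for the asymptotic bound, it comes from the space bound of `M`. -/
theorem exists_directAccessTM_of_randomAccessTM
    (hσ : (∃ i, 0 < σ.relArity i) ∨ (∃ i, 0 < σ.funArity i)) {C : Set (FinOrderedStructure σ)}
    {M : RandomAccessTM} (hdec : M.Decides C) (hspace : M.WorksInPolylogSpace σ) :
    ∃ M' : DirectAccessTM σ, M'.Decides C ∧ M'.WorksInPolylogSpace := by
  obtain ⟨M', hM'⟩ := M.exists_directAccessTM (σ := σ)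
  have hhalt : ∀ A : FinOrderedStructure σ, M.Accepts A.encode ∨ M.Rejects A.encode := fun A => by
    by_cases hA : A ∈ C
    · exact .inl ((hdec A).1 hA)
    · exact .inr ((hdec A).2 hA)
  refine ⟨M', fun A => ?_, ?_⟩
  · obtain ⟨K, hK⟩ := exists_encard_visitedCells_le (hhalt A)
    obtain ⟨h1, h2, -⟩ := hM' A (K + (Nat.clog 2 A.size + 2))
      (two_mul_add_one_lt_two_pow (Nat.le_add_left _ _)) (hhalt A)
      fun l => (hK _).trans (Nat.cast_le.2 (Nat.le_add_right _ _))
    exact ⟨fun hA => h1 ((hdec A).1 hA), fun hA => h2 ((hdec A).2 hA)⟩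
  · obtain ⟨k, c, n₀, hc⟩ := hspace
    obtain ⟨D, hD⟩ := FinOrderedStructure.exists_clog_length_encode_le σ
    -- The factor `D ^ k` comes from `⌈log₂ n̂⌉ ≤ D * ⌈log₂ n⌉`; the `4` covers the counters, two
    -- spare digits and the last cell, as the logarithm is at least `1`.
    refine ⟨k + 1, c * D ^ k + 4, max n₀ 2, fun A hA => ?_⟩
    have hA2 : 2 ≤ A.size := (le_max_right _ _).trans hA
    have hlen := FinOrderedStructure.size_le_length_encode hσ hA2
    have hlog0 : 0 < Nat.clog 2 A.size := Nat.clog_pos (by norm_num) hA2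
    obtain ⟨-, -, h3, h4⟩ := hM' A
      (c * Nat.clog 2 A.encode.length ^ k + (Nat.clog 2 A.size + 2))
      (two_mul_add_one_lt_two_pow (Nat.le_add_left _ _)) (hhalt A)
      fun l => (hc A (((le_max_left _ _).trans hA).trans hlen) l).trans
        (Nat.cast_le.2 (Nat.le_add_right _ _))
    have hle : c * Nat.clog 2 A.encode.length ^ k + (Nat.clog 2 A.size + 2) + 1 ≤
        (c * D ^ k + 4) * Nat.clog 2 A.size ^ (k + 1) := by
      refine le_trans ?_ (mul_pow_add_mul_le k hlog0)
      have : c * Nat.clog 2 A.encode.length ^ k ≤ c * D ^ k * Nat.clog 2 A.size ^ k := by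
        rw [mul_assoc, ← mul_pow]
        exact Nat.mul_le_mul_left _ (Nat.pow_le_pow_left (hD A hA2) k)
      omega
    exact ⟨fun l => (h3 l).trans (Nat.cast_le.2 hle), fun l => (h4 l).trans (Nat.cast_le.2 hle)⟩

/-- As in the other direction, but `K` must also suffice for the address, a number up to the length
of the encoding. -/
theorem exists_randomAccessTM_of_directAccessTM
    (hσ : (∃ i, 0 < σ.relArity i) ∨ (∃ i, 0 < σ.funArity i)) {C : Set (FinOrderedStructure σ)}
    {M : DirectAccessTM σ} (hdec : M.Decides C) (hspace : M.WorksInPolylogSpace) :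
    ∃ M' : RandomAccessTM, M'.Decides C ∧ M'.WorksInPolylogSpace σ := by
  obtain ⟨M', hM'⟩ := M.exists_randomAccessTM hσ
  have hhalt : ∀ A : FinOrderedStructure σ, M.Accepts A ∨ M.Rejects A := fun A => by
    by_cases hA : A ∈ C
    · exact .inl ((hdec A).1 hA)
    · exact .inr ((hdec A).2 hA)
  have hpow : ∀ {n K : ℕ}, Nat.clog 2 n < K → n < 2 ^ K := fun {n K} h =>
    (Nat.le_pow_clog (by norm_num) n).trans_lt (Nat.pow_lt_pow_right (by norm_num) h)
  refine ⟨M', fun A => ?_, ?_⟩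
  · obtain ⟨K, hK⟩ := exists_encard_visitedCells_le (hhalt A)
    have hcast : (K : ℕ∞) ≤
        ((K + (Nat.clog 2 A.size + Nat.clog 2 A.encode.length + 2) : ℕ) : ℕ∞) :=
      Nat.cast_le.2 (Nat.le_add_right _ _)
    obtain ⟨h1, h2, -⟩ := hM' A (K + (Nat.clog 2 A.size + Nat.clog 2 A.encode.length + 2))
      (two_mul_add_one_lt_two_pow (by omega)) (hpow (by omega)) (hhalt A)
      (fun l => (hK _).trans hcast) fun l => (hK _).trans hcast
    exact ⟨fun hA => h1 ((hdec A).1 hA), fun hA => h2 ((hdec A).2 hA)⟩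
  · obtain ⟨k, c, n₀, hc⟩ := hspace
    set n₁ := max n₀ 2 with hn₁
    -- The threshold is the code length at size `n₁`, so that by strict monotonicity a code of at
    -- least this length belongs to a domain of at least `n₁` elements. The `5` covers two
    -- logarithms, two spare digits and the last cell.
    refine ⟨k + 1, c + 5, (codeItems σ n₁ (Nat.clog 2 n₁)).length, fun A hA => ?_⟩
    have hA1 : n₁ ≤ A.size := by
      by_contra hlt
      have := length_codeItems_lt hσ A.size_pos (not_le.1 hlt)
      rw [A.length_encode] at hA
      omega
    have hA2 : 2 ≤ A.size := (le_max_right _ _).trans hA1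
    have hlen := FinOrderedStructure.size_le_length_encode hσ hA2
    have hlog : Nat.clog 2 A.size ≤ Nat.clog 2 A.encode.length := Nat.clog_mono_right 2 hlen
    have hlog0 : 0 < Nat.clog 2 A.size := Nat.clog_pos (by norm_num) hA2
    have hcA := hc A ((le_max_left _ _).trans hA1)
    have hcast : ((c * Nat.clog 2 A.size ^ k : ℕ) : ℕ∞) ≤ ((c * Nat.clog 2 A.size ^ k +
        (Nat.clog 2 A.size + Nat.clog 2 A.encode.length + 2) : ℕ) : ℕ∞) :=
      Nat.cast_le.2 (Nat.le_add_right _ _)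
    obtain ⟨-, -, h3⟩ := hM' A (c * Nat.clog 2 A.size ^ k +
        (Nat.clog 2 A.size + Nat.clog 2 A.encode.length + 2))
      (two_mul_add_one_lt_two_pow (by omega)) (hpow (by omega)) (hhalt A)
      (fun l => (hcA.1 l).trans hcast) fun l => (hcA.2 l).trans hcast
    refine fun l => (h3 l).trans (Nat.cast_le.2 ?_)
    refine le_trans ?_ (mul_pow_add_mul_le k (hlog0.trans_le hlog))
    have : c * Nat.clog 2 A.size ^ k ≤ c * Nat.clog 2 A.encode.length ^ k :=
      Nat.mul_le_mul_left _ (Nat.pow_le_pow_left hlog k)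
    omega

end

/-- A class of finite ordered structures of a vocabulary with a relation or function symbol of
positive arity is decidable by a random-access Turing machine in polylogarithmic space with respect
to the length of the binary encoding iff it is decidable by a direct-access Turing machine in
polylogarithmic space with respect to the size of the domain. -/
theorem mainTheorem8 (σ : FinVocabulary)
    (hσ : (∃ i, 0 < σ.relArity i) ∨ (∃ i, 0 < σ.funArity i))
    (C : Set (FinOrderedStructure σ)) :
    (∃ M : RandomAccessTM, M.Decides C ∧ M.WorksInPolylogSpace σ) ↔
      (∃ M : DirectAccessTM σ, M.Decides C ∧ M.WorksInPolylogSpace) :=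
  ⟨fun ⟨_, h, h'⟩ => exists_directAccessTM_of_randomAccessTM hσ h h',
    fun ⟨_, h, h'⟩ => exists_randomAccessTM_of_directAccessTM hσ h h'⟩
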